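/- **Setting.** Let $N\ge 1$, $\omega\in\mathbb C$ with $\Im\omega>0$, $\Gamma=\pi\mathbb Z+\pi\omega\mathbb Z$, and $$\theta(z)=-i\sum_{k\in\mathbb Z}(-1)^k e^{i\pi\omega(k+\frac12)^2}e^{2i(k+\frac12)z}.$$ Let $\mathsf x,\mathsf y\in\{0,1\}$ with $(\mathsf x,\mathsf y)\ne(0,0)$ if $N$ is even; let $\eta\in\mathbb C$ be generic, i.e. $m\eta\notin\Gamma$ for every integer $m\neq0$; let $\xi_1,\dots,\xi_N\in\mathbb C$ satisfy $\xi_a-\xi_b+\epsilon\eta\notin\Gamma$ for all $a\ne b$ and $\epsilon\in\{-1,0,1\}$; let $\kappa\in\mathbb C\setminus\{0\}$. *The model.* The dynamical R-matrix is $$R(\lambda|t)=\begin{pmatrix}a(\lambda)&0&0&0\\0&e^{i\mathsf y\eta}b(\lambda|t)&e^{i\mathsf y\lambda}c(\lambda|t)&0\\0&e^{-i\mathsf y\lambda}c(\lambda|-t)&e^{-i\mathsf y\eta}b(\lambda|-t)&0\\0&0&0&a(\lambda)\end{pmatrix},$$ $a(\lambda)=\theta(\lambda+\eta)$, $b(\lambda|t)=\frac{\theta(\lambda)\theta(t+\eta)}{\theta(t)}$,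 $c(\lambda|t)=\frac{\theta(\eta)\theta(t+\lambda)}{\theta(t)}$. Set $t_0=-\frac\eta2N+\mathsf x\frac\pi2+\mathsf y\frac\pi2\omega$ and $t(k)=t_0-\eta k$. On the space with basis $\big(\otimes_n|n,h_n\rangle\big)\otimes|t(k)\rangle$, $\mathbf h\in\{0,1\}^N$, $k\in\mathbb Z$, let $\sigma^z_n$ have eigenvalue $1-2h_n$, let $\tau$ have eigenvalue $t(k)$, let $\mathsf T_\tau^{\pm}|t(k)\rangle=|t(k\pm1)\rangle$, and set $\mathsf S=\sum_n\sigma_n^z$, $\mathsf S_\tau=\eta\mathsf S+2\tau$. Define $\mathcal B,\mathcal C$ by $$R_{0,N}\Big(\lambda-\xi_N\Big|\tau+\eta\sum_{a=1}^{N-1}\sigma_a^z\Big)\cdots R_{0,1}(\lambda-\xi_1|\tau)\begin{pmatrix}\mathsf T_\tau^+&0\\0&\mathsf T_\tau^-\end{pmatrix}_{[0]}=\begin{pmatrix}\mathcal A(\lambda)&\mathcal B(\lambda)\\\mathcal C(\lambda)&\mathcal D(\lambda)\end{pmatrix}_{[0]},$$ and the $\kappa$-twisted antiperiodic transfer matrix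 by $\overline{\mathcal T}^{(\kappa)}(\lambda)=\kappa^{-1}\mathcal B(\lambda)+\kappa\,\mathcal C(\lambda)$. Let $\bar{\mathbb D}^{(0,\mathcal R)}$ (kets) and $\bar{\mathbb D}^{(0,\mathcal L)}$ (bras in the span of the dual basis, operators acting to the left) be the eigenspaces of $\mathsf S_\tau$ with eigenvalue $\mathsf x\pi+\mathsf y\pi\omega$. A right (left) *eigenstate* with eigenvalue function $\bar t$ is a nonzero element of $\bar{\mathbb D}^{(0,\mathcal R)}$ (of $\bar{\mathbb D}^{(0,\mathcal L)}$) on which $\overline{\mathcal T}^{(\kappa)}(\lambda)$ acts as $\bar t(\lambda)$ for every $\lambda\in\mathbb C$; $\Sigma_{\overline{\mathcal T}}$ denotes the set of eigenvalue functions. *SOV states.* Put $\mathsf a(\lambda)=\prod_{n}\theta(\lambda-\xi_n+\eta)$, $\mathsf d(\lambda)=\mathsf a(\lambda-\eta)$, $\mathsf a_{\mathsf x,\mathsf y}=(-1)^{\mathsf x+\mathsf y+\mathsf x\mathsf y}\mathsf a$, $\xi_a^{(h)}=\xi_a-\eta h$, $t_{0,\mathbf h}=-\frac\eta2\sum_k(1-2h_k)+\mathsf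 x\frac\pi2+\mathsf y\frac\pi2\omega$. For a fixed normalization constant $\mathsf n\neq0$ let $$\langle 0,\mathbf h|=\frac1{\mathsf n}\Big(\otimes_n\langle n,0|\otimes\langle t_{0,\mathbf 0}|\Big)\prod_{n=1}^N\Big(\frac{\mathcal C(\xi_n)}{\mathsf d(\xi_n-\eta)}\Big)^{h_n},\qquad |\mathbf h,0\rangle=\prod_{n=1}^N\Big(\frac{\mathcal C(\xi_n-\eta)}{\mathsf d(\xi_n-\eta)}\Big)^{1-h_n}\frac1{\mathsf n}\Big(\otimes_n|n,1\rangle\otimes|t_{0,\mathbf 1}\rangle\Big),$$ and let $\Theta^{(0,\mathbf h)}$ be the $N\times N$ matrix with entries $\vartheta_{j-1}\big(\xi_i^{(h_i)}-\bar\xi_0\big)$, where $\bar\xi_0=\frac1N\big(\sum_k\xi_k+t_{0,\mathbf 0}\big)$ and $$\vartheta_j(\lambda)=\sum_{n\in\mathbb Z}e^{i\pi N\omega(n+\frac12-\frac jN)^2+2iN(n+\frac12-\frac jN)(\lambda-\frac\pi2)}.$$ **Theorem.** Let $\bar t$ be an entire function such that 1. there is a function $Q:\mathbb C\to\mathbb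 C$ with $$\bar t(\lambda)=\frac{\mathsf a_{\mathsf x,\mathsf y}(\lambda)\,Q(\lambda-\eta)+\mathsf d(\lambda)\,Q(\lambda+\eta)}{Q(\lambda)},$$ understood as $\bar t(\lambda)Q(\lambda)=\mathsf a_{\mathsf x,\mathsf y}(\lambda)Q(\lambda-\eta)+\mathsf d(\lambda)Q(\lambda+\eta)$ for all $\lambda\in\mathbb C$; 2. $\big(Q(\xi_n),Q(\xi_n-\eta)\big)\neq(0,0)$ for every $n\in\{1,\dots,N\}$; 3. for all $\lambda\in\mathbb C$, $\bar t(\lambda+\pi)=(-1)^{N+\mathsf y}\,\bar t(\lambda)$ and $\bar t(\lambda+\pi\omega)=\big(-e^{-2i\lambda-i\pi\omega}\big)^N e^{2i[\sum_k\xi_k-\frac N2\eta+\mathsf x\frac\pi2]}\,\bar t(\lambda)$. Then $\bar t\in\Sigma_{\overline{\mathcal T}}$, and the corresponding right and left eigenstates are, up to a scalar factor, exactly $$|\Psi_{\bar t}^{(\kappa)}\rangle=\sum_{\mathbf h\in\{0,1\}^N}\prod_{a=1}^N\left[\Big(\kappa^{-1}e^{i\mathsf y\eta}\frac{\mathsf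 a_{\mathsf x,\mathsf y}(\xi_a)}{\mathsf d(\xi_a-\eta)}\Big)^{h_a}Q(\xi_a^{(h_a)})\right]\det\big[\Theta^{(0,\mathbf h)}\big]\,|\mathbf h,0\rangle,$$ $$\langle\Psi_{\bar t}^{(\kappa)}|=\sum_{\mathbf h\in\{0,1\}^N}\prod_{a=1}^N\left[\big(\kappa\,e^{i\mathsf y\eta}\big)^{h_a}Q(\xi_a^{(h_a)})\right]\det\big[\Theta^{(0,\mathbf h)}\big]\,\langle0,\mathbf h|,$$ and both of these are nonzero. -/

import Mathlib

noncomputable section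

namespace DynSixVertex

/-- The data of an inhomogeneous dynamical 6-vertex model with `N` sites: elliptic modulus `ω`,
crossing parameter `η`, inhomogeneities `ξ`, and the two discrete parameters `x`, `y` (taken in
`{0, 1}`) which fix the global shift of the dynamical parameter. -/
structure Model (N : ℕ) where
  ω : ℂ
  η : ℂ
  ξ : Fin N → ℂ
  x : ℕ
  y : ℕ

/-- The theta function `θ₁(z | ω)` with quasi-periods `π` and `π ω`. -/
def theta (ω z : ℂ) : ℂ :=
  -Complex.I * ∑' k : ℤ, (-1 : ℂ) ^ k * Complex.exp (Complex.I * Real.pi * ω * (k + 1 / 2) ^ 2) *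
    Complex.exp (2 * Complex.I * (k + 1 / 2) * z)

/-- The period lattice `Γ = π ℤ + π ω ℤ`. -/
def lattice (ω : ℂ) : Set ℂ :=
  {z | ∃ m n : ℤ, z = m * (Real.pi : ℂ) + n * ((Real.pi : ℂ) * ω)}

/-- Spin configurations `h = (h₁, …, h_N)`; `h_n = 0` is spin up and `h_n = 1` is spin down. -/
abbrev Spins (N : ℕ) : Type := Fin N → Fin 2

/-- The space of kets: finite linear combinations of the dynamical-spin basis states
`(⊗ₙ |n, h_n⟩) ⊗ |t(a)⟩`, which are labelled by `(h, a)` with `a : ℤ`. -/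
abbrev Ket (N : ℕ) : Type := (Spins N × ℤ) →₀ ℂ

/-- Covectors. Operators act on them to the left: `⟨φ| X` is `X.dualMap φ`, that is `φ ∘ X`. -/
abbrev Bra (N : ℕ) : Type := Module.Dual ℂ (Ket N)

/-- Operators on the space of kets. -/
abbrev Op (N : ℕ) : Type := Module.End ℂ (Ket N)

/-- The basis ket `(⊗ₙ |n, h_n⟩) ⊗ |t(a)⟩`. -/
def basisKet {N : ℕ} (h : Spins N) (a : ℤ) : Ket N := Finsupp.single (h, a) 1

/-- The dual basis covector `(⊗ₙ ⟨n, h_n|) ⊗ ⟨t(a)|`. -/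
def basisBra {N : ℕ} (h : Spins N) (a : ℤ) : Bra N := Finsupp.lapply (h, a)

/-- The eigenvalue `1 - 2 h` of `σᶻ`. -/
def spinVal (h : Fin 2) : ℂ := 1 - 2 * ((h : ℕ) : ℂ)

/-- The operator that is diagonal in the dynamical-spin basis, with eigenvalues `f (h, a)`. -/
def diagOp {N : ℕ} (f : Spins N × ℤ → ℂ) : Op N :=
  Finsupp.linearCombination ℂ fun s => Finsupp.single s (f s)

/-- The operator `T_τ ^ e`, which maps `|t(a)⟩` to `|t(a + e)⟩`. -/
def shiftOp {N : ℕ} (e : ℤ) : Op N :=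
  Finsupp.linearCombination ℂ fun s => Finsupp.single (s.1, s.2 + e) 1

/-- The local spin operator `σₙᶻ`. -/
def sigmaZ {N : ℕ} (n : Fin N) : Op N := diagOp fun s => spinVal (s.1 n)

/-- The total spin `S = ∑ₙ σₙᶻ`. -/
def spinOp {N : ℕ} : Op N := ∑ n : Fin N, sigmaZ n

/-- The integer `a` for which `t(a) = t_{r,h}`. -/
def heightIndex {N : ℕ} (r : ℤ) (h : Spins N) : ℤ := -(∑ k, ((h k : ℕ) : ℤ)) - r

namespace Model

variable {N : ℕ} (p : Model N)

/-- `θ` with the modulus of the model. -/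
def th (z : ℂ) : ℂ := theta p.ω z

/-- The half period `x π / 2 + y π ω / 2`. -/
def halfPeriod : ℂ := p.x * ((Real.pi : ℂ) / 2) + p.y * ((Real.pi : ℂ) / 2 * p.ω)

/-- The reference height `t₀ = - (η / 2) N + x π / 2 + y π ω / 2`. -/
def t0 : ℂ := -(p.η / 2) * N + p.halfPeriod

/-- The height `t(a) = - η a + t₀`. -/
def height (a : ℤ) : ℂ := -p.η * a + p.t0

/-- The shifted inhomogeneity `ξ_a ^ (h) = ξ_a - η h`. -/
def xiShift (a : Fin N) (h : Fin 2) : ℂ := p.ξ a - p.η * ((h : ℕ) : ℂ)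

/-- `t_{r,h} = - (η / 2) s_h + x π / 2 + y π ω / 2 + r η`, with `s_h = ∑ₖ (1 - 2 h_k)`. -/
def tVal (r : ℤ) (h : Spins N) : ℂ :=
  -(p.η / 2) * (∑ k, spinVal (h k)) + p.halfPeriod + r * p.η

theorem height_heightIndex (r : ℤ) (h : Spins N) :
    p.height (heightIndex r h) = p.tVal r h := by
  simp only [height, heightIndex, tVal, t0, spinVal, Finset.sum_sub_distrib, ← Finset.mul_sum]
  push_cast
  simp
  ring

/-! ### The R-matrix and the monodromy matrix -/

def wa (u : ℂ) : ℂ := p.th (u + p.η)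

def wb (u t : ℂ) : ℂ := p.th u * p.th (t + p.η) / p.th t

def wc (u t : ℂ) : ℂ := p.th p.η * p.th (t + u) / p.th t

/-- The dynamical R-matrix `R(u | t)`: the entry in row `(i, k)` and column `(j, l)`, where the
first index is that of the first tensor factor. -/
def R (u t : ℂ) : Fin 2 × Fin 2 → Fin 2 × Fin 2 → ℂ
  | (0, 0), (0, 0) => p.wa u
  | (0, 1), (0, 1) => Complex.exp (Complex.I * p.y * p.η) * p.wb u t
  | (0, 1), (1, 0) => Complex.exp (Complex.I * p.y * u) * p.wc u t
  | (1, 0), (0, 1) => Complex.exp (-(Complex.I * p.y * u)) * p.wc u (-t)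
  | (1, 0), (1, 0) => Complex.exp (-(Complex.I * p.y * p.η)) * p.wb u (-t)
  | (1, 1), (1, 1) => p.wa u
  | _, _ => 0

/-- The operator `τ`. -/
def tauOp : Op N := diagOp fun s => p.height s.2

/-- The operator `S_τ = η S + 2 τ`. -/
def sTau : Op N := p.η • spinOp + (2 : ℂ) • p.tauOp

/-- The operator `R_{0,n}(u - ξₙ | τ + η ∑_{m < n} σₘᶻ)`, as a `2 × 2` matrix, in the auxiliary
space `0`, of operators on the quantum space. -/
def lax (n : Fin N) (u : ℂ) : Matrix (Fin 2) (Fin 2) (Op N) := fun i j =>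
  Finsupp.linearCombination ℂ fun s : Spins N × ℤ =>
    ∑ k : Fin 2, Finsupp.single (Function.update s.1 n k, s.2)
      (p.R (u - p.ξ n) (p.height s.2 + p.η * ∑ m ∈ Finset.univ.filter (fun m => m < n),
        spinVal (s.1 m)) (i, k) (j, s.1 n))

/-- The monodromy matrix `M₀(u | τ)`, the product `R_{0,N} ⋯ R_{0,1}`. -/
def monodromy (u : ℂ) : Matrix (Fin 2) (Fin 2) (Op N) :=
  ((List.finRange N).map fun n => p.lax n u).reverse.prod

/-- The monodromy matrix with dynamical shifts, `M₀(u | τ) T_τ ^ (σ₀ᶻ)`. -/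
def dynMonodromy (u : ℂ) : Matrix (Fin 2) (Fin 2) (Op N) :=
  p.monodromy u * Matrix.diagonal ![shiftOp 1, shiftOp (-1)]

/-- The entry `B(u)` of the monodromy matrix with dynamical shifts. -/
def opB (u : ℂ) : Op N := p.dynMonodromy u 0 1

/-- The entry `C(u)` of the monodromy matrix with dynamical shifts. -/
def opC (u : ℂ) : Op N := p.dynMonodromy u 1 0

/-- The `κ`-twisted antiperiodic transfer matrix `κ⁻¹ B(u) + κ C(u)`. -/
def transfer (κ u : ℂ) : Op N := κ⁻¹ • p.opB u + κ • p.opC u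

/-! ### The space of states and the transfer-matrix spectrum -/

/-- The eigenvalue `2 r η + x π + y π ω` of `S_τ`. -/
def sTauVal (r : ℤ) : ℂ :=
  2 * r * p.η + p.x * (Real.pi : ℂ) + p.y * ((Real.pi : ℂ) * p.ω)

/-- The right eigenspace of `S_τ` with eigenvalue `2 r η + x π + y π ω`. -/
def ketSpace (r : ℤ) : Submodule ℂ (Ket N) := p.sTau.eigenspace (p.sTauVal r)

/-- The left eigenspace of `S_τ` with eigenvalue `2 r η + x π + y π ω`, in the restricted dual
spanned by the dual dynamical-spin basis. -/
def braSpace (r : ℤ) : Submodule ℂ (Bra N) :=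
  Submodule.span ℂ (Set.range fun s : Spins N × ℤ => basisBra s.1 s.2) ⊓
    Module.End.eigenspace p.sTau.dualMap (p.sTauVal r)

/-- `v` is a right eigenstate of the transfer matrices, in the space of states of the antiperiodic
model, with eigenvalue function `t`. -/
def IsEigenKet (κ : ℂ) (t : ℂ → ℂ) (v : Ket N) : Prop :=
  v ∈ p.ketSpace 0 ∧ v ≠ 0 ∧ ∀ u, p.transfer κ u v = t u • v

/-- `φ` is a left eigenstate of the transfer matrices, in the space of states of the antiperiodic
model, with eigenvalue function `t`. -/
def IsEigenBra (κ : ℂ) (t : ℂ → ℂ) (φ : Bra N) : Prop :=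
  φ ∈ p.braSpace 0 ∧ φ ≠ 0 ∧ ∀ u, (p.transfer κ u).dualMap φ = t u • φ

/-- The set of eigenvalue functions of the `κ`-twisted antiperiodic transfer matrix. -/
def transferSpectrum (κ : ℂ) : Set (ℂ → ℂ) := {t | ∃ v, p.IsEigenKet κ t v}

/-! ### Separation of variables -/

/-- `a(u) = ∏ₙ θ(u - ξₙ + η)`. -/
def aFun (u : ℂ) : ℂ := ∏ n, p.wa (u - p.ξ n)

/-- `d(u) = a(u - η)`. -/
def dFun (u : ℂ) : ℂ := p.aFun (u - p.η)

/-- `a_{x,y}(u) = (-1) ^ (x + y + x y) a(u)`. -/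
def aXY (u : ℂ) : ℂ := (-1) ^ (p.x + p.y + p.x * p.y) * p.aFun u

/-- The left state `⟨r, h| = ⟨r, 0| ∏ₙ (C(ξₙ) / d(ξₙ - η)) ^ hₙ`, where the reference state
`⟨r, 0|` is `nrm⁻¹` times a dual basis covector. -/
def sovBra (nrm : ℂ) (r : ℤ) (h : Spins N) : Bra N :=
  (((List.finRange N).map fun n =>
      ((p.dFun (p.ξ n - p.η))⁻¹ • p.opC (p.ξ n)) ^ (h n : ℕ)).prod).dualMap
    (nrm⁻¹ • basisBra (fun _ => 0) (heightIndex r fun _ : Fin N => 0))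

/-- The right state `|h, r⟩ = ∏ₙ (C(ξₙ - η) / d(ξₙ - η)) ^ (1 - hₙ) |1, r⟩`, where the reference
state `|1, r⟩` is `nrm⁻¹` times a basis ket. -/
def sovKet (nrm : ℂ) (r : ℤ) (h : Spins N) : Ket N :=
  (((List.finRange N).map fun n =>
      ((p.dFun (p.ξ n - p.η))⁻¹ • p.opC (p.ξ n - p.η)) ^ (1 - (h n : ℕ))).prod)
    (nrm⁻¹ • basisKet (fun _ => 1) (heightIndex r fun _ : Fin N => 1))

/-- The functions `ϑ_j`, `0 ≤ j ≤ N - 1`, a basis of the theta functions of order `N`, norm `0`. -/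
def vartheta (j : Fin N) (u : ℂ) : ℂ :=
  ∑' n : ℤ, Complex.exp
    (Complex.I * Real.pi * N * p.ω * ((n : ℂ) + 1 / 2 - ((j : ℕ) : ℂ) / N) ^ 2 +
      2 * Complex.I * N * ((n : ℂ) + 1 / 2 - ((j : ℕ) : ℂ) / N) * (u - (Real.pi : ℂ) / 2))

/-- `ξ̄_r = N⁻¹ (∑ₖ ξₖ + t_{r,0})`. -/
def xiBar (r : ℤ) : ℂ := (∑ k, p.ξ k + p.tVal r fun _ => 0) / N

/-- The matrix `Θ ^ (r, h)`. -/
def thetaMatrix (r : ℤ) (h : Spins N) : Matrix (Fin N) (Fin N) ℂ := fun i j =>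
  p.vartheta j (p.xiShift i (h i) - p.xiBar r)

/-- The separate right state with coefficients `q a h`. -/
def separateKet (nrm κ : ℂ) (q : Fin N → Fin 2 → ℂ) : Ket N :=
  ∑ h : Spins N,
    ((∏ a, (κ⁻¹ * Complex.exp (Complex.I * p.y * p.η) *
        (p.aXY (p.ξ a) / p.dFun (p.ξ a - p.η))) ^ (h a : ℕ) * q a (h a)) *
      (p.thetaMatrix 0 h).det) • p.sovKet nrm 0 h

/-- The separate left state with coefficients `q a h`. -/
def separateBra (nrm κ : ℂ) (q : Fin N → Fin 2 → ℂ) : Bra N :=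
  ∑ h : Spins N,
    ((∏ a, (κ * Complex.exp (Complex.I * p.y * p.η)) ^ (h a : ℕ) * q a (h a)) *
      (p.thetaMatrix 0 h).det) • p.sovBra nrm 0 h

/-- `t(u) = (a_{x,y}(u) Q(u - η) + d(u) Q(u + η)) / Q(u)` for all `u`, with the denominator cleared
so that the relation also has its intended meaning at the zeros of `Q`. -/
def IsTQ (t Q : ℂ → ℂ) : Prop :=
  ∀ u, t u * Q u = p.aXY u * Q (u - p.η) + p.dFun u * Q (u + p.η)

/-- The quasi-periodicity in `u` of the transfer-matrix eigenvalues. -/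
def IsQuasiPeriodic (t : ℂ → ℂ) : Prop :=
  (∀ u, t (u + Real.pi) = (-1) ^ (N + p.y) * t u) ∧
  (∀ u, t (u + Real.pi * p.ω) =
    (-Complex.exp (-2 * Complex.I * u - Complex.I * Real.pi * p.ω)) ^ N *
      Complex.exp (2 * Complex.I *
        (∑ k, p.ξ k - (N : ℂ) / 2 * p.η + p.x * ((Real.pi : ℂ) / 2))) * t u)

/-- The crossing parameter is generic: it has infinite order modulo the period lattice. -/
def IsGeneric : Prop := ∀ m : ℤ, m ≠ 0 → (m : ℂ) * p.η ∉ lattice p.ω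

/-- The condition on the inhomogeneities: `ξ_a - ξ_b + ε η ∉ Γ` for `a ≠ b`, `ε ∈ {-1, 0, 1}`. -/
def InhomogeneityCondition : Prop :=
  ∀ a b, a ≠ b → ∀ ε ∈ ({-1, 0, 1} : Set ℤ), p.ξ a - p.ξ b + (ε : ℂ) * p.η ∉ lattice p.ω

end Model

end DynSixVertex

end

noncomputable section

namespace DynSixVertex

open Complex MeasureTheory Filter Topology

/-! ### Fourier expansion of entire periodic functions -/

/-- The Fourier coefficients of a `π`-periodic function. -/
def periodCoeff (F : ℂ → ℂ) (m : ℤ) (z : ℂ) : ℂ :=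
  (Real.pi : ℂ)⁻¹ * ∫ x in (0 : ℝ)..Real.pi, exp (-2 * I * m * (z + x)) * F (z + x)

theorem integral_period_shift {G : ℂ → ℂ} (hG : Differentiable ℂ G)
    (hper : ∀ z, G (z + Real.pi) = G z) (z : ℂ) :
    ∫ x in (0 : ℝ)..Real.pi, G (z + x) = ∫ x in (0 : ℝ)..Real.pi, G x := by
  have hper' : ∀ z : ℂ, Function.Periodic (fun x : ℝ => G (z + x)) Real.pi := by
    intro z x
    have := hper (z + x)
    simp only [ofReal_add]
    rw [← this]; ring_nf
  have key := Complex.integral_boundary_rect_eq_zero_of_differentiableOn G 0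
    (⟨Real.pi, z.im⟩ : ℂ) hG.differentiableOn
  have hv : ∫ y in (0 : ℝ)..z.im, G (Real.pi + y * I) = ∫ y in (0 : ℝ)..z.im, G (0 + y * I) := by
    congr 1; ext y
    rw [← hper (0 + y * I)]; ring_nf
  simp only [zero_re, zero_im, ofReal_zero, zero_mul, add_zero] at key
  rw [hv] at key
  have h2 : ∫ x in (0 : ℝ)..Real.pi, G (x + z.im * I) = ∫ x in (0 : ℝ)..Real.pi, G x := by
    linear_combination -key
  rw [← h2]
  have h3 : (fun x : ℝ => G (z + x)) = fun x : ℝ => (fun y : ℝ => G (z.im * I + y)) (x + z.re) := by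
    ext x
    simp only
    congr 1
    conv_lhs => rw [← re_add_im z]
    push_cast; ring
  rw [h3, intervalIntegral.integral_comp_add_right (fun y : ℝ => G (z.im * I + y))]
  have := (hper' (z.im * I)).intervalIntegral_add_eq z.re 0
  rw [zero_add] at this
  rw [zero_add, add_comm Real.pi, this]
  congr 1; ext x; ring_nf

theorem exp_two_mul_int_mul_add_pi (m : ℤ) (z : ℂ) :
    exp (-2 * I * m * (z + Real.pi)) = exp (-2 * I * m * z) := by
  rw [show -2 * I * m * (z + Real.pi) = -2 * I * m * z + ((-m : ℤ) : ℂ) * (2 * Real.pi * I) by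
    push_cast; ring, exp_add, exp_int_mul_two_pi_mul_I, mul_one]

theorem periodCoeff_eq {F : ℂ → ℂ} (hF : Differentiable ℂ F)
    (hper : ∀ z, F (z + Real.pi) = F z) (m : ℤ) (z : ℂ) :
    periodCoeff F m z = periodCoeff F m 0 := by
  have := integral_period_shift (G := fun z => exp (-2 * I * m * z) * F z)
    (by fun_prop) (fun z => by rw [exp_two_mul_int_mul_add_pi, hper]) z
  simp only [periodCoeff, zero_add, this]

instance fact_pi_pos : Fact (0 < Real.pi) := ⟨Real.pi_pos⟩

theorem hasSum_periodCoeff {F : ℂ → ℂ} (hF : Differentiable ℂ F)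
    (hper : ∀ z, F (z + Real.pi) = F z) (z : ℂ)
    (hs : Summable fun m : ℤ => periodCoeff F m 0 * exp (2 * I * m * z)) :
    HasSum (fun m : ℤ => periodCoeff F m 0 * exp (2 * I * m * z)) (F z) := by
  have hp : Function.Periodic (fun x : ℝ => F (z + x)) Real.pi := by
    intro x
    have := hper (z + x)
    simp only [ofReal_add]
    rw [← this]; ring_nf
  have hc : Continuous fun x : ℝ => F (z + x) := hF.continuous.comp (by fun_prop)
  let f : C(AddCircle Real.pi, ℂ) := ⟨hp.lift, continuous_coinduced_dom.mpr hc⟩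
  have hcoef : ∀ m : ℤ, fourierCoeff f m = periodCoeff F m 0 * exp (2 * I * m * z) := by
    intro m
    rw [fourierCoeff_eq_intervalIntegral _ _ 0, ← periodCoeff_eq hF hper m z, periodCoeff,
      mul_assoc, ← intervalIntegral.integral_mul_const]
    simp only [zero_add, one_div, real_smul, ofReal_inv]
    congr 2
    ext x
    rw [fourier_coe_apply]
    have : f (x : AddCircle Real.pi) = F (z + x) := rfl
    rw [this, smul_eq_mul, mul_right_comm _ _ (exp (2 * I * m * z)), ← exp_add]
    congr 2
    have : (Real.pi : ℂ) ≠ 0 := by exact_mod_cast Real.pi_ne_zero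
    push_cast
    field_simp
    ring
  have := has_pointwise_sum_fourier_series_of_summable (f := f)
    (by rw [show fourierCoeff f = _ from funext hcoef]; exact hs) (0 : ℝ)
  simp only [hcoef] at this
  have h0 : f ((0 : ℝ) : AddCircle Real.pi) = F (z + (0 : ℝ)) := rfl
  rw [h0] at this
  simpa using this

/-! ### Theta functions of order `N` -/

/-- The `n`-th term of the theta function with characteristic `b` of order `N`. -/
def thetaTerm (ω : ℂ) (N : ℕ) (b u : ℂ) (n : ℤ) : ℂ :=
  exp (I * Real.pi * N * ω * ((n : ℂ) + b) ^ 2 + 2 * I * N * ((n : ℂ) + b) * (u - (Real.pi : ℂ) / 2))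

theorem thetaTerm_eq (ω : ℂ) (N : ℕ) (b u : ℂ) (n : ℤ) :
    thetaTerm ω N b u n = exp (I * Real.pi * N * ω * b ^ 2 + 2 * I * N * b * (u - Real.pi / 2)) *
      jacobiTheta₂_term n (N * ω * b + N * (u / Real.pi - 1 / 2)) (N * ω) := by
  have : (Real.pi : ℂ) ≠ 0 := by exact_mod_cast Real.pi_ne_zero
  rw [jacobiTheta₂_term, thetaTerm, ← exp_add]
  congr 1
  field_simp
  ring

theorem im_natCast_mul_pos {ω : ℂ} (hω : 0 < ω.im) {N : ℕ} (hN : 1 ≤ N) : 0 < (N * ω : ℂ).im := by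
  have : (0 : ℝ) < N := by exact_mod_cast hN
  simp only [mul_im, natCast_re, natCast_im, zero_mul, add_zero]
  positivity

theorem summable_thetaTerm {ω : ℂ} (hω : 0 < ω.im) {N : ℕ} (hN : 1 ≤ N) (b u : ℂ) :
    Summable (thetaTerm ω N b u) := by
  have : thetaTerm ω N b u = fun n => _ := funext (thetaTerm_eq ω N b u)
  rw [this]
  exact ((summable_jacobiTheta₂_term_iff _ _).2 (im_natCast_mul_pos hω hN)).mul_left _

/-- The multiplier conditions of theta functions of order `N` and norm `c`. -/
structure IsThetaOrder (ω : ℂ) (N : ℕ) (c : ℂ) (f : ℂ → ℂ) : Prop where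
  differentiable : Differentiable ℂ f
  add_pi : ∀ u, f (u + Real.pi) = (-1) ^ N * f u
  add_pi_mul : ∀ u, f (u + Real.pi * ω) =
    (-exp (-2 * I * u - I * Real.pi * ω)) ^ N * exp (2 * I * c) * f u

theorem exp_neg_mul_pi (N : ℕ) : exp (-(I * N * Real.pi)) = (-1) ^ N := by
  rw [show -(I * N * Real.pi) = N * (-(Real.pi * I)) by ring, exp_nat_mul, exp_neg, exp_pi_mul_I]
  norm_num

theorem neg_one_pow_mul_self' (N : ℕ) : ((-1 : ℂ) ^ N) * (-1) ^ N = 1 := by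
  rw [← mul_pow]; norm_num

theorem periodCoeff_add {G : ℂ → ℂ} (hG : Differentiable ℂ G) {ω : ℂ} {N : ℕ}
    (hper : ∀ z, G (z + Real.pi) = G z)
    (hq : ∀ z, G (z + Real.pi * ω) =
      (-1) ^ N * exp (-2 * I * N * (Real.pi * ω)) * exp (-2 * I * N * z) * G z) (m : ℤ) :
    periodCoeff G (m + N) 0 =
      (-1) ^ N * exp (2 * I * (m + N) * (Real.pi * ω)) * periodCoeff G m 0 := by
  rw [← periodCoeff_eq hG hper m (Real.pi * ω)]
  simp only [periodCoeff]
  rw [mul_left_comm _ (Real.pi : ℂ)⁻¹]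
  congr 1
  rw [← intervalIntegral.integral_const_mul ((-1) ^ N * exp (2 * I * (m + N) * (Real.pi * ω)))]
  refine intervalIntegral.integral_congr fun x _ => ?_
  rw [add_comm (Real.pi * ω : ℂ) x, hq, zero_add]
  have h1 : exp (-2 * I * (m + N : ℤ) * x) = exp (2 * I * (m + N) * (Real.pi * ω)) *
      exp (-2 * I * m * (x + Real.pi * ω)) * exp (-2 * I * N * (Real.pi * ω)) *
      exp (-2 * I * N * x) := by
    simp only [← exp_add]
    congr 1
    push_cast
    ring
  rw [h1]
  linear_combination -(exp (2 * I * (m + N) * (Real.pi * ω)) *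
      exp (-2 * I * m * (x + Real.pi * ω)) * exp (-2 * I * N * (Real.pi * ω)) *
      exp (-2 * I * N * x) * G x) * neg_one_pow_mul_self' N

theorem thetaTerm_zero_succ (ω : ℂ) {N : ℕ} (hN : 1 ≤ N) (j n : ℤ) :
    thetaTerm ω N (1 / 2 - j / N) 0 (n + 1) =
      (-1) ^ N * exp (2 * I * ((N * n - j : ℤ) + N) * (Real.pi * ω)) *
        thetaTerm ω N (1 / 2 - j / N) 0 n := by
  have hN' : (N : ℂ) ≠ 0 := by exact_mod_cast (by lia : N ≠ 0)
  rw [← exp_neg_mul_pi, thetaTerm, thetaTerm, ← exp_add, ← exp_add]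
  congr 1
  push_cast
  field_simp
  ring

theorem periodCoeff_eq_thetaTerm {G : ℂ → ℂ} (hG : Differentiable ℂ G) {ω : ℂ} {N : ℕ}
    (hN : 1 ≤ N) (hper : ∀ z, G (z + Real.pi) = G z)
    (hq : ∀ z, G (z + Real.pi * ω) =
      (-1) ^ N * exp (-2 * I * N * (Real.pi * ω)) * exp (-2 * I * N * z) * G z) (j : ℤ) :
    ∃ A : ℂ, ∀ n : ℤ, periodCoeff G (N * n - j) 0 = A * thetaTerm ω N (1 / 2 - j / N) 0 n := by
  have hne : ∀ n, thetaTerm ω N (1 / 2 - j / N) 0 n ≠ 0 := fun n => exp_ne_zero _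
  refine ⟨periodCoeff G (N * 0 - j) 0 / thetaTerm ω N (1 / 2 - j / N) 0 0, fun n => ?_⟩
  have hstep : ∀ n : ℤ, periodCoeff G (N * (n + 1) - j) 0 / thetaTerm ω N (1 / 2 - j / N) 0 (n + 1)
      = periodCoeff G (N * n - j) 0 / thetaTerm ω N (1 / 2 - j / N) 0 n := by
    intro n
    rw [show (N * (n + 1) - j : ℤ) = (N * n - j) + N by ring, periodCoeff_add hG hper hq,
      thetaTerm_zero_succ ω hN]
    exact mul_div_mul_left _ _ (mul_ne_zero (pow_ne_zero _ (by norm_num)) (exp_ne_zero _))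
  rw [← div_eq_iff (hne n)]
  induction n using Int.induction_on with
  | zero => rfl
  | succ n ih => rw [hstep, ih]
  | pred n ih => rw [← hstep, sub_add_cancel, ih]

theorem hasSum_prod_fin {N : ℕ} {f : Fin N × ℤ → ℂ} (h : ∀ j, Summable fun n => f (j, n)) :
    HasSum f (∑ j, ∑' n, f (j, n)) := by
  have hs : Summable f := by
    rw [← summable_norm_iff, summable_prod_of_nonneg (fun _ => norm_nonneg _)]
    exact ⟨fun j => (h j).norm, Summable.of_finite⟩
  have := hs.hasSum
  rwa [hs.tsum_prod, tsum_fintype] at this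

/-- Theta functions of order `N` are spanned by the `N` theta functions with characteristics. -/
theorem IsThetaOrder.exists_coeff {ω : ℂ} (hω : 0 < ω.im) {N : ℕ} (hN : 1 ≤ N) {c : ℂ} {f : ℂ → ℂ}
    (hf : IsThetaOrder ω N c f) :
    ∃ A : Fin N → ℂ, ∀ u, f u =
      ∑ j : Fin N, A j * ∑' n, thetaTerm ω N (1 / 2 - ((j : ℕ) : ℂ) / N) (u - c / N) n := by
  have hN' : (N : ℂ) ≠ 0 := by exact_mod_cast (by lia : N ≠ 0)
  have : NeZero N := ⟨by lia⟩
  set G : ℂ → ℂ := fun u => exp (-(I * N * u)) * f (u + c / N) with hGdef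
  have hG : Differentiable ℂ G := by
    have := hf.differentiable
    fun_prop
  have hper : ∀ z, G (z + Real.pi) = G z := by
    intro z
    simp only [hGdef]
    rw [add_right_comm, hf.add_pi, mul_add, neg_add, exp_add, exp_neg_mul_pi]
    linear_combination (exp (-(I * N * z)) * f (z + c / N)) * neg_one_pow_mul_self' N
  have hq : ∀ z, G (z + Real.pi * ω) =
      (-1) ^ N * exp (-2 * I * N * (Real.pi * ω)) * exp (-2 * I * N * z) * G z := by
    intro z
    simp only [hGdef]
    rw [add_right_comm, hf.add_pi_mul, neg_pow, ← exp_nat_mul]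
    have : exp (-(I * N * (z + Real.pi * ω))) *
        (exp (N * (-2 * I * (z + c / N) - I * Real.pi * ω)) * exp (2 * I * c)) =
        exp (-2 * I * N * (Real.pi * ω)) * exp (-2 * I * N * z) * exp (-(I * N * z)) := by
      simp only [← exp_add]
      congr 1
      field_simp
      ring
    linear_combination ((-1) ^ N * f (z + c / N)) * this
  choose A hA using fun j : Fin N => periodCoeff_eq_thetaTerm hG hN hper hq ((j : ℕ) : ℤ)
  refine ⟨A, fun u => ?_⟩
  set z := u - c / N with hz
  let e : Fin N × ℤ ≃ ℤ := (Equiv.prodComm _ _).trans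
    ((Equiv.prodCongr (Equiv.neg ℤ) (Equiv.refl _)).trans
      ((Int.divModEquiv N).symm.trans (Equiv.neg ℤ)))
  have he : ∀ j n, e (j, n) = N * n - ((j : ℕ) : ℤ) := by
    intro j n
    simp [e, Int.divModEquiv]
    ring
  have hterm : ∀ (j : Fin N) (n : ℤ), periodCoeff G (e (j, n)) 0 * exp (2 * I * (e (j, n)) * z) =
      exp (-(I * N * z)) * (A j * thetaTerm ω N (1 / 2 - ((j : ℕ) : ℂ) / N) z n) := by
    intro j n
    rw [he, hA, thetaTerm, thetaTerm, mul_assoc, ← exp_add, mul_left_comm, ← exp_add]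
    congr 2
    push_cast
    field_simp
    ring
  have hsum : ∀ j : Fin N, Summable fun n : ℤ =>
      periodCoeff G (e (j, n)) 0 * exp (2 * I * (e (j, n)) * z) := by
    intro j
    simp only [hterm]
    exact ((summable_thetaTerm hω hN _ _).mul_left _).mul_left _
  have h1 := hasSum_prod_fin (f := fun x => periodCoeff G (e x) 0 * exp (2 * I * (e x) * z)) hsum
  have h2 := (e.hasSum_iff (f := fun m : ℤ => periodCoeff G m 0 * exp (2 * I * m * z))).1 h1
  have h3 := h2.unique (hasSum_periodCoeff hG hper z h2.summable)
  simp only [hterm, tsum_mul_left, ← Finset.mul_sum] at h3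
  simp only [hGdef] at h3
  rw [mul_right_inj' (exp_ne_zero _)] at h3
  rw [h3, hz, sub_add_cancel]

/-! ### Basic properties of `θ` -/

theorem theta_term_eq (ω z : ℂ) (k : ℤ) :
    -I * ((-1 : ℂ) ^ k * exp (I * Real.pi * ω * (k + 1 / 2) ^ 2) * exp (2 * I * (k + 1 / 2) * z)) =
      thetaTerm ω 1 (1 / 2) z k := by
  have h1 : (-1 : ℂ) ^ k = exp (-(k * (Real.pi * I))) := by
    rw [exp_neg, exp_int_mul, exp_pi_mul_I, ← inv_zpow]; norm_num
  have h2 : -I = exp (-(Real.pi / 2 * I)) := by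
    rw [exp_neg, exp_pi_div_two_mul_I, inv_I]
  rw [h1, h2, thetaTerm]
  simp only [← exp_add]
  congr 1
  push_cast
  ring

theorem theta_eq_tsum (ω z : ℂ) : theta ω z = ∑' k, thetaTerm ω 1 (1 / 2) z k := by
  rw [theta, ← tsum_mul_left]
  exact tsum_congr fun k => theta_term_eq ω z k

theorem tsum_thetaTerm (ω : ℂ) (N : ℕ) (b u : ℂ) : ∑' n, thetaTerm ω N b u n =
    exp (I * Real.pi * N * ω * b ^ 2 + 2 * I * N * b * (u - Real.pi / 2)) *
      jacobiTheta₂ (N * ω * b + N * (u / Real.pi - 1 / 2)) (N * ω) := by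
  rw [jacobiTheta₂, ← tsum_mul_left]
  exact tsum_congr fun n => thetaTerm_eq ω N b u n

theorem theta_eq_jacobiTheta₂ (ω z : ℂ) : theta ω z =
    exp (I * Real.pi * ω / 4 + I * (z - Real.pi / 2)) *
      jacobiTheta₂ (z / Real.pi + (ω / 2 - 1 / 2)) ω := by
  rw [theta_eq_tsum, tsum_thetaTerm]
  congr 2
  · push_cast; ring
  · push_cast; ring
  · push_cast; ring

variable {ω : ℂ}

theorem differentiable_theta (hω : 0 < ω.im) : Differentiable ℂ (theta ω) := by
  have h : theta ω = fun z => _ := funext (theta_eq_jacobiTheta₂ ω)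
  rw [h]
  intro z
  refine DifferentiableAt.mul (by fun_prop) ?_
  exact (differentiableAt_jacobiTheta₂_fst (z / Real.pi + (ω / 2 - 1 / 2)) hω).comp
    (f := fun z : ℂ => z / Real.pi + (ω / 2 - 1 / 2)) z (by fun_prop)

theorem theta_add_pi (z : ℂ) : theta ω (z + Real.pi) = -theta ω z := by
  have : (Real.pi : ℂ) ≠ 0 := by exact_mod_cast Real.pi_ne_zero
  rw [theta_eq_jacobiTheta₂, theta_eq_jacobiTheta₂,
    show (z + Real.pi) / Real.pi + (ω / 2 - 1 / 2) = z / Real.pi + (ω / 2 - 1 / 2) + 1 by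
      field_simp; ring, jacobiTheta₂_add_left,
    show I * Real.pi * ω / 4 + I * (z + Real.pi - Real.pi / 2) =
      I * Real.pi * ω / 4 + I * (z - Real.pi / 2) + Real.pi * I by ring, exp_add, exp_pi_mul_I]
  ring

theorem theta_add_pi_mul (z : ℂ) :
    theta ω (z + Real.pi * ω) = -exp (-2 * I * z - I * Real.pi * ω) * theta ω z := by
  have : (Real.pi : ℂ) ≠ 0 := by exact_mod_cast Real.pi_ne_zero
  rw [theta_eq_jacobiTheta₂, theta_eq_jacobiTheta₂,
    show (z + Real.pi * ω) / Real.pi + (ω / 2 - 1 / 2) = z / Real.pi + (ω / 2 - 1 / 2) + ω by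
      field_simp; ring, jacobiTheta₂_add_left']
  have h : exp (I * Real.pi * ω / 4 + I * (z + Real.pi * ω - Real.pi / 2)) *
      exp (-Real.pi * I * (ω + 2 * (z / Real.pi + (ω / 2 - 1 / 2)))) =
      exp (Real.pi * I) * exp (-2 * I * z - I * Real.pi * ω) *
        exp (I * Real.pi * ω / 4 + I * (z - Real.pi / 2)) := by
    simp only [← exp_add]
    congr 1
    field_simp
    ring
  rw [exp_pi_mul_I] at h
  linear_combination jacobiTheta₂ (z / Real.pi + (ω / 2 - 1 / 2)) ω * h

theorem theta_neg (z : ℂ) : theta ω (-z) = -theta ω z := by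
  rw [theta_eq_jacobiTheta₂, theta_eq_jacobiTheta₂, ← jacobiTheta₂_neg_left,
    show -(-z / Real.pi + (ω / 2 - 1 / 2)) = z / Real.pi + (-ω/2 + 1 / 2) by ring]
  have h1 := jacobiTheta₂_add_left (z / Real.pi + (-ω/2 - 1 / 2)) ω
  have h2 := jacobiTheta₂_add_left' (z / Real.pi + (-ω/2 - 1 / 2)) ω
  rw [show z / Real.pi + (-ω/2 - 1 / 2) + 1 = z / Real.pi + (-ω/2 + 1 / 2) by ring] at h1
  rw [show z / Real.pi + (-ω/2 - 1 / 2) + ω = z / Real.pi + (ω/2 - 1 / 2) by ring] at h2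
  rw [h1, h2, ← mul_assoc, ← exp_add]
  have : (Real.pi : ℂ) ≠ 0 := by exact_mod_cast Real.pi_ne_zero
  rw [show I * Real.pi * ω / 4 + I * (z - Real.pi / 2) + -Real.pi * I *
    (ω + 2 * (z / Real.pi + (-ω / 2 - 1 / 2))) = I * Real.pi * ω / 4 + I * (-z - Real.pi / 2) +
      Real.pi * I by field_simp; ring, exp_add _ (Real.pi * I), exp_pi_mul_I]
  ring

theorem theta_zero : theta ω 0 = 0 := by
  have := theta_neg (ω := ω) 0
  rw [neg_zero] at this
  exact self_eq_neg.1 this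

/-- The function `θ(u - x)` is a theta function of order one. -/
theorem isThetaOrder_theta_sub (hω : 0 < ω.im) (x : ℂ) :
    IsThetaOrder ω 1 x fun u => theta ω (u - x) where
  differentiable := (differentiable_theta hω).comp (by fun_prop)
  add_pi u := by
    rw [add_sub_right_comm, theta_add_pi]; ring
  add_pi_mul u := by
    have h : exp (-2 * I * (u - x) - I * Real.pi * ω) =
        exp (-2 * I * u - I * Real.pi * ω) * exp (2 * I * x) := by
      rw [← exp_add]; congr 1; ring
    rw [add_sub_right_comm, theta_add_pi_mul, pow_one, h, neg_mul]
    ring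

theorem IsThetaOrder.mul {M N : ℕ} {c d : ℂ} {f g : ℂ → ℂ} (hf : IsThetaOrder ω M c f)
    (hg : IsThetaOrder ω N d g) : IsThetaOrder ω (M + N) (c + d) fun u => f u * g u where
  differentiable := hf.differentiable.mul hg.differentiable
  add_pi u := by rw [hf.add_pi, hg.add_pi]; ring
  add_pi_mul u := by rw [hf.add_pi_mul, hg.add_pi_mul, mul_add, exp_add]; ring

theorem IsThetaOrder.add {N : ℕ} {c : ℂ} {f g : ℂ → ℂ} (hf : IsThetaOrder ω N c f)
    (hg : IsThetaOrder ω N c g) : IsThetaOrder ω N c fun u => f u + g u where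
  differentiable := hf.differentiable.add hg.differentiable
  add_pi u := by rw [hf.add_pi, hg.add_pi]; ring
  add_pi_mul u := by rw [hf.add_pi_mul, hg.add_pi_mul]; ring

theorem IsThetaOrder.const_mul {N : ℕ} {c : ℂ} {f : ℂ → ℂ} (hf : IsThetaOrder ω N c f) (k : ℂ) :
    IsThetaOrder ω N c fun u => k * f u where
  differentiable := hf.differentiable.const_mul k
  add_pi u := by rw [hf.add_pi]; ring
  add_pi_mul u := by rw [hf.add_pi_mul]; ring

theorem isThetaOrder_one : IsThetaOrder ω 0 0 fun _ => 1 where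
  differentiable := by fun_prop
  add_pi u := by simp
  add_pi_mul u := by simp

theorem isThetaOrder_prod (hω : 0 < ω.im) {ι : Type*} (s : Finset ι) (x : ι → ℂ) :
    IsThetaOrder ω s.card (∑ i ∈ s, x i) fun u => ∏ i ∈ s, theta ω (u - x i) := by
  classical
  induction s using Finset.induction_on with
  | empty => simpa using isThetaOrder_one
  | insert a s ha ih =>
    simp only [Finset.prod_insert ha, Finset.sum_insert ha, Finset.card_insert_of_notMem ha]
    rw [add_comm s.card]
    exact (isThetaOrder_theta_sub hω (x a)).mul ih

theorem IsThetaOrder.eq_const_mul_theta (hω : 0 < ω.im) {f : ℂ → ℂ} (hf : IsThetaOrder ω 1 0 f) :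
    ∃ A : ℂ, ∀ u, f u = A * theta ω u := by
  obtain ⟨A, hA⟩ := hf.exists_coeff hω le_rfl
  refine ⟨A 0, fun u => ?_⟩
  rw [hA, Fin.sum_univ_one, theta_eq_tsum]
  simp

/-! ### The zeros of `θ` -/

/-- The infinite product `∏ (1 - e^{2 i (z + n π ω)})`. -/
def thetaProd (ω z : ℂ) : ℂ := ∏' n : ℕ, (1 + -exp (2 * I * (z + n * (Real.pi * ω))))

theorem norm_exp_thetaProd (z : ℂ) (n : ℕ) : ‖-exp (2 * I * (z + n * (Real.pi * ω)))‖ =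
    Real.exp (-2 * z.im) * Real.exp (-2 * (Real.pi * ω.im)) ^ n := by
  rw [norm_neg, norm_exp, ← Real.exp_nat_mul, ← Real.exp_add]
  congr 1
  simp [mul_re, mul_im]
  ring

theorem exp_neg_two_pi_lt_one (hω : 0 < ω.im) : Real.exp (-2 * (Real.pi * ω.im)) < 1 := by
  rw [Real.exp_lt_one_iff]
  have := mul_pos Real.pi_pos hω
  linarith

theorem summable_thetaProd (hω : 0 < ω.im) (z : ℂ) :
    Summable fun n : ℕ => ‖-exp (2 * I * (z + n * (Real.pi * ω)))‖ := by
  simp only [norm_exp_thetaProd]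
  exact (summable_geometric_of_lt_one (Real.exp_pos _).le (exp_neg_two_pi_lt_one hω)).mul_left _

theorem thetaProd_ne_zero (hω : 0 < ω.im) {z : ℂ}
    (h : ∀ n : ℕ, exp (2 * I * (z + n * (Real.pi * ω))) ≠ 1) : thetaProd ω z ≠ 0 := by
  refine tprod_one_add_ne_zero_of_summable (fun n hn => h n ?_) (summable_thetaProd hω z)
  linear_combination -hn

theorem thetaProd_eq (hω : 0 < ω.im) (z : ℂ) :
    thetaProd ω z = (1 - exp (2 * I * z)) * thetaProd ω (z + Real.pi * ω) := by
  let f : ℕ → ℂ := fun n => 1 + -exp (2 * I * (z + n * (Real.pi * ω)))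
  have h : (fun n : ℕ => f (n + 1)) =
      fun n : ℕ => 1 + -exp (2 * I * (z + Real.pi * ω + n * (Real.pi * ω))) := by
    funext n
    simp only [f]
    push_cast
    ring_nf
  have hm : Multipliable fun n : ℕ => f (n + 1) := by
    rw [h]
    exact multipliable_one_add_of_summable (summable_thetaProd hω _)
  have h0 : f 0 = 1 - exp (2 * I * z) := by
    simp [f, sub_eq_add_neg]
  have key := tprod_eq_zero_mul' hm
  rw [h, h0] at key
  exact key

theorem thetaProd_add_pi (z : ℂ) : thetaProd ω (z + Real.pi) = thetaProd ω z := by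
  refine tprod_congr fun n => ?_
  rw [show 2 * I * (z + Real.pi + n * (Real.pi * ω)) = 2 * I * (z + n * (Real.pi * ω)) +
    2 * Real.pi * I by ring, exp_periodic]

theorem differentiable_thetaProd (hω : 0 < ω.im) : Differentiable ℂ (thetaProd ω) := by
  intro z
  let K : Set ℂ := {w | z.im - 1 < w.im}
  have hK : IsOpen K := isOpen_lt continuous_const continuous_im
  have hsum : Summable fun n : ℕ =>
      Real.exp (-2 * (z.im - 1)) * Real.exp (-2 * (Real.pi * ω.im)) ^ n :=
    (summable_geometric_of_lt_one (Real.exp_pos _).le (exp_neg_two_pi_lt_one hω)).mul_left _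
  have h := hsum.hasProdLocallyUniformlyOn_nat_one_add (K := K) hK
    (f := fun (n : ℕ) w => -exp (2 * I * (w + n * (Real.pi * ω))))
    (Filter.Eventually.of_forall fun n w hw => by
      rw [norm_exp_thetaProd]
      have hw' : z.im - 1 < w.im := hw
      exact mul_le_mul_of_nonneg_right (Real.exp_le_exp.2 (by linarith)) (by positivity))
    (fun n => by fun_prop)
  have hd : DifferentiableOn ℂ (thetaProd ω) K :=
    TendstoLocallyUniformlyOn.differentiableOn h.tendstoLocallyUniformlyOn_finsetRange
      (Filter.Eventually.of_forall fun n => by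
        apply Differentiable.differentiableOn
        fun_prop) hK
  exact hd.differentiableAt (hK.mem_nhds (by simp [K]))

theorem isThetaOrder_thetaProd (hω : 0 < ω.im) : IsThetaOrder ω 1 0
    fun z => exp (I * z) * (thetaProd ω (z + Real.pi * ω) * thetaProd ω (-z)) where
  differentiable := by
    have := differentiable_thetaProd hω
    fun_prop
  add_pi z := by
    have h1 := thetaProd_add_pi (ω := ω) (-(z + Real.pi))
    rw [show -(z + Real.pi) + (Real.pi : ℂ) = -z by ring] at h1
    rw [add_right_comm, thetaProd_add_pi, ← h1, mul_add, exp_add, mul_comm I (Real.pi : ℂ),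
      exp_pi_mul_I]
    ring
  add_pi_mul z := by
    have h1 := thetaProd_eq hω (z + Real.pi * ω)
    have h2 := thetaProd_eq hω (-(z + Real.pi * ω))
    rw [show -(z + Real.pi * ω) + Real.pi * ω = -z by ring] at h2
    have h3 : exp (2 * I * (z + Real.pi * ω)) * exp (2 * I * -(z + Real.pi * ω)) = 1 := by
      rw [← exp_add, ← exp_zero]; congr 1; ring
    have h4 : exp (I * (z + Real.pi * ω)) * exp (2 * I * -(z + Real.pi * ω)) =
        exp (-2 * I * z - I * Real.pi * ω) * exp (I * z) := by
      rw [← exp_add, ← exp_add]; congr 1; ring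
    rw [h2, h1]
    simp only [mul_zero, exp_zero, pow_one, mul_one]
    linear_combination thetaProd ω (z + Real.pi * ω + Real.pi * ω) * thetaProd ω (-z) *
      (-exp (I * (z + Real.pi * ω)) * h3 - (1 - exp (2 * I * (z + Real.pi * ω))) * h4)

theorem mem_lattice_of_exp_eq_one {z : ℂ} (n : ℤ) (h : exp (2 * I * (z + n * (Real.pi * ω))) = 1) :
    z ∈ lattice ω := by
  obtain ⟨m, hm⟩ := exp_eq_one_iff.1 h
  refine ⟨m, -n, ?_⟩
  have : (2 * I) * (z + n * (Real.pi * ω) - m * Real.pi) = 0 := by linear_combination hm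
  have h2 : (2 * I : ℂ) ≠ 0 := by simp
  have := (mul_eq_zero.1 this).resolve_left h2
  push_cast
  linear_combination this

theorem neg_mem_lattice {z : ℂ} (h : z ∈ lattice ω) : -z ∈ lattice ω := by
  obtain ⟨m, n, rfl⟩ := h
  exact ⟨-m, -n, by push_cast; ring⟩

theorem theta_ne_zero (hω : 0 < ω.im) {z : ℂ} (hz : z ∉ lattice ω) : theta ω z ≠ 0 := by
  obtain ⟨A, hA⟩ := (isThetaOrder_thetaProd hω).eq_const_mul_theta hω
  intro h
  have := hA z
  rw [h, mul_zero] at this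
  refine absurd this (mul_ne_zero (exp_ne_zero _) (mul_ne_zero ?_ ?_))
  · refine thetaProd_ne_zero hω fun n hn => hz (mem_lattice_of_exp_eq_one (n + 1) ?_)
    rw [← hn]; push_cast; ring_nf
  · refine thetaProd_ne_zero hω fun n hn => hz ?_
    have := neg_mem_lattice (mem_lattice_of_exp_eq_one n hn)
    rwa [neg_neg] at this

/-! ### Interpolation by theta functions -/

theorem det_thetaTerm_ne_zero (hω : 0 < ω.im) {N : ℕ} (hN : 1 ≤ N) {c : ℂ} {x : Fin N → ℂ}
    (hx : ∀ i j, i ≠ j → theta ω (x i - x j) ≠ 0) (hs : theta ω (∑ i, x i - c) ≠ 0) :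
    (Matrix.of fun i j : Fin N =>
      ∑' n, thetaTerm ω N (1 / 2 - ((j : ℕ) : ℂ) / N) (x i - c / N) n).det ≠ 0 := by
  set M : Matrix (Fin N) (Fin N) ℂ := Matrix.of fun i j : Fin N =>
      ∑' n, thetaTerm ω N (1 / 2 - ((j : ℕ) : ℂ) / N) (x i - c / N) n with hM
  let s := ∑ i, x i - c
  let x' : Fin N → Fin N → ℂ := fun n => Function.update x n (x n - s)
  have hord : ∀ n, IsThetaOrder ω N c fun u => ∏ i, theta ω (u - x' n i) := by
    intro n
    have h := isThetaOrder_prod hω Finset.univ (x' n)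
    rw [Finset.card_univ, Fintype.card_fin] at h
    convert h using 1
    simp only [x', Finset.sum_update_of_mem (Finset.mem_univ n), s]
    rw [← Finset.add_sum_erase _ x (Finset.mem_univ n), Finset.sdiff_singleton_eq_erase]
    ring
  choose A hA using fun n => (hord n).exists_coeff hω hN
  have hmul : M * (Matrix.of A).transpose = Matrix.diagonal fun n => ∏ i, theta ω (x n - x' n i) := by
    ext i n
    rw [Matrix.mul_apply, Matrix.diagonal_apply]
    have h1 : ∑ j, M i j * (Matrix.of A).transpose j n = ∏ k, theta ω (x i - x' n k) := by
      rw [hA]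
      exact Finset.sum_congr rfl fun j _ => by simp [hM, mul_comm]
    rw [h1]
    split_ifs with h
    · rw [h]
    · refine Finset.prod_eq_zero (Finset.mem_univ i) ?_
      simp [x', Function.update_of_ne h, theta_zero]
  have hdet := congrArg Matrix.det hmul
  rw [Matrix.det_mul, Matrix.det_diagonal] at hdet
  refine left_ne_zero_of_mul (b := (Matrix.of A).transpose.det) ?_
  rw [hdet]
  refine Finset.prod_ne_zero_iff.2 fun n _ => Finset.prod_ne_zero_iff.2 fun i _ => ?_
  by_cases h : i = n
  · subst h
    simpa [x'] using hs
  · simpa [x', Function.update_of_ne h] using hx n i (Ne.symm h)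

theorem IsThetaOrder.eq_zero (hω : 0 < ω.im) {N : ℕ} (hN : 1 ≤ N) {c : ℂ} {x : Fin N → ℂ}
    (hx : ∀ i j, i ≠ j → theta ω (x i - x j) ≠ 0) (hs : theta ω (∑ i, x i - c) ≠ 0)
    {f : ℂ → ℂ} (hf : IsThetaOrder ω N c f) (h0 : ∀ i, f (x i) = 0) (u : ℂ) : f u = 0 := by
  obtain ⟨A, hA⟩ := hf.exists_coeff hω hN
  have hdet := det_thetaTerm_ne_zero hω hN hx hs
  have hz : A = 0 := by
    refine Matrix.eq_zero_of_mulVec_eq_zero hdet ?_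
    funext i
    have := h0 i
    rw [hA] at this
    simpa [Matrix.mulVec, dotProduct, mul_comm] using this
  rw [hA, hz]
  simp

/-! ### The three-term identity -/

theorem isThetaOrder_theta_mul_theta (hω : 0 < ω.im) (b : ℂ) :
    IsThetaOrder ω 2 0 fun a => theta ω (a + b) * theta ω (a - b) := by
  have := (isThetaOrder_theta_sub hω (-b)).mul (isThetaOrder_theta_sub hω b)
  simpa using this

theorem countable_lattice : (lattice ω).Countable := by
  have : lattice ω = Set.range fun x : ℤ × ℤ => x.1 * (Real.pi : ℂ) + x.2 * ((Real.pi : ℂ) * ω) := by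
    ext z
    simp only [lattice, Set.mem_range, Prod.exists]
    exact ⟨fun ⟨m, n, h⟩ => ⟨m, n, h.symm⟩, fun ⟨m, n, h⟩ => ⟨m, n, h.symm⟩⟩
  rw [this]
  exact Set.countable_range _

theorem theta_three_term (hω : 0 < ω.im) (a b c d : ℂ) :
    theta ω (a + b) * theta ω (a - b) * (theta ω (c + d) * theta ω (c - d)) +
      theta ω (b + c) * theta ω (b - c) * (theta ω (a + d) * theta ω (a - d)) +
      theta ω (c + a) * theta ω (c - a) * (theta ω (b + d) * theta ω (b - d)) = 0 := by
  have hθ := (differentiable_theta hω).continuous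
  have hdense : Dense ({b : ℂ | b - c ∈ lattice ω} ∪ {b : ℂ | b + c ∈ lattice ω})ᶜ := by
    refine Set.Countable.dense_compl ℝ (Set.Countable.union ?_ ?_)
    · exact countable_lattice.preimage_of_injOn (sub_left_injective.injOn)
    · exact countable_lattice.preimage_of_injOn ((add_left_injective c).injOn)
  refine congrFun (Continuous.ext_on (f := fun b => theta ω (a + b) * theta ω (a - b) *
    (theta ω (c + d) * theta ω (c - d)) +
      theta ω (b + c) * theta ω (b - c) * (theta ω (a + d) * theta ω (a - d)) +
      theta ω (c + a) * theta ω (c - a) * (theta ω (b + d) * theta ω (b - d))) (g := fun _ => 0)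
      hdense (by fun_prop) (by fun_prop) ?_) b
  intro b hb
  simp only [Set.mem_compl_iff, Set.mem_union, not_or] at hb
  have h1 : theta ω (b - c) ≠ 0 := theta_ne_zero hω hb.1
  have h2 : theta ω (b + c) ≠ 0 := theta_ne_zero hω hb.2
  have hcb : theta ω (c - b) = -theta ω (b - c) := by rw [← theta_neg, neg_sub]
  have hord := (((isThetaOrder_theta_mul_theta hω b).const_mul (theta ω (c + d) * theta ω (c - d))).add
    ((isThetaOrder_theta_mul_theta hω d).const_mul (theta ω (b + c) * theta ω (b - c)))).add
    ((isThetaOrder_theta_mul_theta hω c).const_mul (-(theta ω (b + d) * theta ω (b - d))))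
  have := hord.eq_zero hω (by norm_num) (x := ![b, c]) ?_ ?_ ?_ a
  · have hca : theta ω (c - a) = -theta ω (a - c) := by rw [← theta_neg, neg_sub]
    simp only
    rw [hca, add_comm c a]
    linear_combination this
  · intro i j hij
    fin_cases i <;> fin_cases j <;> simp_all
  · simpa using h2
  · intro i
    fin_cases i
    · simp [theta_zero]; ring
    · simp [theta_zero, hcb]; rw [add_comm c b]; ring

/-- The function `e^{i y z} θ(z)`. -/
def twistTheta (ω : ℂ) (y : ℕ) (z : ℂ) : ℂ := exp (I * y * z) * theta ω z

theorem twistTheta_three_term (hω : 0 < ω.im) (y : ℕ) (a b c d : ℂ) :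
    theta ω (a + b) * theta ω (a - b) * (twistTheta ω y (d + c) * twistTheta ω y (d - c)) +
      theta ω (b + c) * theta ω (b - c) * (twistTheta ω y (d + a) * twistTheta ω y (d - a)) +
      theta ω (c + a) * theta ω (c - a) * (twistTheta ω y (d + b) * twistTheta ω y (d - b)) = 0 := by
  have h : ∀ a, twistTheta ω y (d + a) * twistTheta ω y (d - a) =
      -(exp (I * y * (2 * d)) * (theta ω (a + d) * theta ω (a - d))) := by
    intro a
    have h1 : theta ω (d - a) = -theta ω (a - d) := by rw [← theta_neg, neg_sub]
    have h2 : exp (I * y * (d + a)) * exp (I * y * (d - a)) = exp (I * y * (2 * d)) := by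
      rw [← exp_add]; congr 1; ring
    rw [twistTheta, twistTheta, h1, add_comm a d, ← h2]
    ring
  simp only [h]
  linear_combination -exp (I * y * (2 * d)) * theta_three_term hω a b c d

theorem twistTheta_add_pi_mul (y : ℕ) (z : ℂ) : twistTheta ω y (z + Real.pi * ω) =
    -exp (I * y * (Real.pi * ω) - 2 * I * z - I * Real.pi * ω) * twistTheta ω y z := by
  rw [twistTheta, twistTheta, theta_add_pi_mul]
  have : exp (I * y * (z + Real.pi * ω)) * exp (-2 * I * z - I * Real.pi * ω) =
      exp (I * y * (Real.pi * ω) - 2 * I * z - I * Real.pi * ω) * exp (I * y * z) := by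
    rw [← exp_add, ← exp_add]; congr 1; ring
  linear_combination -theta ω z * this

theorem twistTheta_add_pi (y : ℕ) (z : ℂ) : twistTheta ω y (z + Real.pi) =
    -(-1) ^ y * twistTheta ω y z := by
  rw [twistTheta, twistTheta, theta_add_pi, mul_add, exp_add,
    show I * y * Real.pi = (y : ℕ) * (Real.pi * I) by ring, exp_nat_mul, exp_pi_mul_I]
  ring

theorem twistTheta_reflect {x y : ℕ} (hx : x ≤ 1) (hy : y ≤ 1) (z : ℂ) :
    twistTheta ω y (x * (Real.pi : ℂ) + y * (Real.pi * ω) - z) =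
      -(-1) ^ (x + y + x * y) * twistTheta ω y z := by
  have h0 : ∀ z, twistTheta ω 0 (-z) = -twistTheta ω 0 z := by
    intro z; simp [twistTheta, theta_neg]
  have h1 : ∀ z, twistTheta ω 1 (Real.pi * ω + -z) = twistTheta ω 1 z := by
    intro z
    rw [add_comm, twistTheta_add_pi_mul, twistTheta, twistTheta, theta_neg]
    have : exp (I * (1 : ℕ) * (Real.pi * ω) - 2 * I * -z - I * Real.pi * ω) *
        exp (I * (1 : ℕ) * -z) = exp (I * (1 : ℕ) * z) := by
      rw [← exp_add]; congr 1; push_cast; ring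
    linear_combination theta ω z * this
  interval_cases x <;> interval_cases y
  · simp [h0]
  · simpa [sub_eq_add_neg] using h1 z
  · rw [show (1 : ℕ) * (Real.pi : ℂ) + (0 : ℕ) * (Real.pi * ω) - z = -z + Real.pi by
      push_cast; ring, twistTheta_add_pi, h0]
    norm_num
  · rw [show (1 : ℕ) * (Real.pi : ℂ) + (1 : ℕ) * (Real.pi * ω) - z = Real.pi * ω + -z + Real.pi by
      push_cast; ring, twistTheta_add_pi, h1]
    norm_num

end DynSixVertex

end

noncomputable section

namespace DynSixVertex

open Complex

/-! ### The dynamical Yang–Baxter equation -/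

theorem twistTheta_pairs {ω : ℂ} (hω : 0 < ω.im) (y : ℕ) (p₁ q₁ p₂ q₂ p₃ q₃ : ℂ)
    {x₁ x₂ x₃ x₄ x₅ x₆ : ℂ} (h₁₂ : p₁ + q₁ = p₂ + q₂ := by ring) (h₁₃ : p₁ + q₁ = p₃ + q₃ := by ring)
    (h₁ : x₁ = p₁ - q₂ := by ring) (h₂ : x₂ = p₁ - p₂ := by ring) (h₃ : x₃ = p₂ - q₃ := by ring) (h₄ : x₄ = p₂ - p₃ := by ring)
    (h₅ : x₅ = p₃ - q₁ := by ring) (h₆ : x₆ = p₃ - p₁ := by ring) :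
    theta ω x₁ * theta ω x₂ * (twistTheta ω y p₃ * twistTheta ω y q₃) +
      theta ω x₃ * theta ω x₄ * (twistTheta ω y p₁ * twistTheta ω y q₁) +
      theta ω x₅ * theta ω x₆ * (twistTheta ω y p₂ * twistTheta ω y q₂) = 0 := by
  have h := twistTheta_three_term hω y ((p₁ - q₁) / 2) ((p₂ - q₂) / 2) ((p₃ - q₃) / 2)
    ((p₁ + q₁) / 2)
  rw [show (p₁ - q₁) / 2 + (p₂ - q₂) / 2 = x₁ by linear_combination -h₁ - h₁₂ / 2,
    show (p₁ - q₁) / 2 - (p₂ - q₂) / 2 = x₂ by linear_combination -h₂ - h₁₂ / 2,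
    show (p₂ - q₂) / 2 + (p₃ - q₃) / 2 = x₃ by linear_combination -h₃ + (h₁₂ - h₁₃) / 2,
    show (p₂ - q₂) / 2 - (p₃ - q₃) / 2 = x₄ by linear_combination -h₄ + (h₁₂ - h₁₃) / 2,
    show (p₃ - q₃) / 2 + (p₁ - q₁) / 2 = x₅ by linear_combination -h₅ + h₁₃ / 2,
    show (p₃ - q₃) / 2 - (p₁ - q₁) / 2 = x₆ by linear_combination -h₆ + h₁₃ / 2,
    show (p₁ + q₁) / 2 + (p₃ - q₃) / 2 = p₃ by linear_combination h₁₃ / 2,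
    show (p₁ + q₁) / 2 - (p₃ - q₃) / 2 = q₃ by linear_combination h₁₃ / 2,
    show (p₁ + q₁) / 2 + (p₂ - q₂) / 2 = p₂ by linear_combination h₁₂ / 2,
    show (p₁ + q₁) / 2 - (p₂ - q₂) / 2 = q₂ by linear_combination h₁₂ / 2,
    show (p₁ + q₁) / 2 + (p₁ - q₁) / 2 = p₁ by ring,
    show (p₁ + q₁) / 2 - (p₁ - q₁) / 2 = q₁ by ring] at h
  exact h

theorem differentiable_twistTheta {ω : ℂ} (hω : 0 < ω.im) (y : ℕ) :
    Differentiable ℂ (twistTheta ω y) :=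
  Differentiable.mul (by fun_prop) (differentiable_theta hω)

theorem twistTheta_four_term {ω : ℂ} (hω : 0 < ω.im) (y : ℕ) (η t v w : ℂ) :
    theta ω v * theta ω (v + w + η) * theta ω w *
      (twistTheta ω y t ^ 3 * twistTheta ω y (t + η + η) -
        twistTheta ω y (t + η) ^ 3 * twistTheta ω y (t - η)) =
    theta ω η ^ 3 * (twistTheta ω y (t - w) * twistTheta ω y (t + η + (v + w)) *
        twistTheta ω y (t - v) * twistTheta ω y (t + η) -
      twistTheta ω y (t + η + v) * twistTheta ω y (t - (v + w)) * twistTheta ω y (t + η + w) *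
        twistTheta ω y t) := by
  have hθ := (differentiable_theta hω).continuous
  have hY := (differentiable_twistTheta hω y).continuous
  have hdense : Dense {w : ℂ | v + w + η ∈ lattice ω}ᶜ := by
    refine Set.Countable.dense_compl ℝ (countable_lattice.preimage_of_injOn ?_)
    exact fun a _ b _ h => by simpa using h
  refine congrFun (Continuous.ext_on (f := fun w => theta ω v * theta ω (v + w + η) * theta ω w *
      (twistTheta ω y t ^ 3 * twistTheta ω y (t + η + η) -
        twistTheta ω y (t + η) ^ 3 * twistTheta ω y (t - η))) (g := fun w =>
    theta ω η ^ 3 * (twistTheta ω y (t - w) * twistTheta ω y (t + η + (v + w)) *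
        twistTheta ω y (t - v) * twistTheta ω y (t + η) -
      twistTheta ω y (t + η + v) * twistTheta ω y (t - (v + w)) * twistTheta ω y (t + η + w) *
        twistTheta ω y t)) hdense (by fun_prop) (by fun_prop) ?_) w
  intro w hw
  have hne : theta ω (v + w + η) ≠ 0 := theta_ne_zero hω hw
  have h1 := twistTheta_pairs hω y (t - w) (t - v) (t - (v + w)) t (t + η) (t - (v + w) - η)
    (x₁ := -w) (x₂ := v) (x₃ := η) (x₄ := -(v + w + η)) (x₅ := η + v) (x₆ := η + w)
  have h2 := twistTheta_pairs hω y (t + η + v) (t + η + w) (t + η + (v + w)) (t + η)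
    t (t + η + (v + w) + η)
    (x₁ := v) (x₂ := -w) (x₃ := -η) (x₄ := v + w + η) (x₅ := -(η + w)) (x₆ := -(η + v))
  have h3 := twistTheta_pairs hω y (t + η + (v + w) + η) (t - (v + w)) (t + η + η) t (t + η) (t + η)
    (x₁ := η + (v + w) + η) (x₂ := v + w) (x₃ := η) (x₄ := η) (x₅ := v + w + η)
    (x₆ := -(v + w + η))
  have h4 := twistTheta_pairs hω y (t + η + (v + w)) (t - (v + w) - η) (t + η) (t - η) t t
    (x₁ := η + (v + w) + η) (x₂ := v + w) (x₃ := η) (x₄ := η) (x₅ := v + w + η)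
    (x₆ := -(v + w + η))
  simp only [theta_neg] at h1 h2 h3 h4
  refine mul_left_cancel₀ hne ?_
  simp only
  set θ := theta ω
  set Y := twistTheta ω y
  linear_combination (θ v * θ w) * (Y (t + η) ^ 2 * h4 - Y t ^ 2 * h3) +
    θ η ^ 2 * (Y (t + η + (v + w)) * Y (t + η) * h1 - Y (t - (v + w)) * Y t * h2)

theorem spinVal_zero : spinVal 0 = 1 := by simp [spinVal]

theorem spinVal_one : spinVal 1 = -1 := by norm_num [spinVal]

namespace Model

variable {N : ℕ} (p : Model N)

/-- The dynamical factor `e^{i y z} θ(z)`. -/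
def thY (z : ℂ) : ℂ := twistTheta p.ω p.y z

theorem th_neg (z : ℂ) : p.th (-z) = -p.th z := theta_neg z

theorem th_zero : p.th 0 = 0 := theta_zero

theorem div_thY (u t : ℂ) : Complex.exp (I * p.y * u) * (p.th (t + u) / p.th t) =
    p.thY (t + u) / p.thY t := by
  rw [thY, thY, twistTheta, twistTheta, mul_add, exp_add, mul_div_assoc', th, th,
    mul_assoc (exp (I * p.y * t)), mul_div_mul_left _ _ (exp_ne_zero _)]

theorem div_thY_neg (u t : ℂ) : Complex.exp (-(I * p.y * u)) * (p.th (-t + u) / p.th (-t)) =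
    p.thY (t - u) / p.thY t := by
  have := p.div_thY (-u) t
  rw [mul_neg, ← sub_eq_add_neg] at this
  rw [← this, p.th_neg t, show -t + u = -(t - u) by ring, p.th_neg, neg_div_neg_eq]

theorem R_apply (u t : ℂ) (i k j l : Fin 2) : p.R u t (i, k) (j, l) =
    if i = k then (if j = i ∧ l = i then p.th (u + p.η) else 0)
    else if j = l then 0
    else if i = j then p.th u * (p.thY (t + p.η * spinVal i) / p.thY t)
    else p.th p.η * (p.thY (t + u * spinVal i) / p.thY t) := by
  have h1 := p.div_thY p.η t
  have h2 := p.div_thY u t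
  have h3 := p.div_thY_neg p.η t
  have h4 := p.div_thY_neg u t
  fin_cases i <;> fin_cases k <;> fin_cases j <;> fin_cases l <;>
    simp [R, wa, wb, wc, spinVal_zero, spinVal_one, ← sub_eq_add_neg]
  · rw [← h1]; ring
  · rw [← h2]; ring
  · rw [← h4]; ring
  · rw [← h3]; ring

/-- The dynamical Yang–Baxter equation. -/
theorem dybe (hω : 0 < p.ω.im) {t : ℂ} (ht : p.thY t ≠ 0) (htp : p.thY (t + p.η) ≠ 0)
    (htm : p.thY (t - p.η) ≠ 0) (v w : ℂ) (i₁ i₂ q' l₁ l₂ q : Fin 2) :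
    ∑ k₁, ∑ k₂, ∑ r, p.R w (t + p.η * spinVal q') (i₁, i₂) (k₁, k₂) *
      (p.R (v + w) t (k₁, q') (l₁, r) * p.R v (t + p.η * spinVal l₁) (k₂, r) (l₂, q)) =
    ∑ k₁, ∑ k₂, ∑ r, p.R v t (i₂, q') (k₂, r) *
      (p.R (v + w) (t + p.η * spinVal k₂) (i₁, r) (k₁, q) * p.R w t (k₁, k₂) (l₁, l₂)) := by
  simp only [p.R_apply, Fin.sum_univ_two]
  fin_cases i₁ <;> fin_cases i₂ <;> fin_cases q' <;> fin_cases l₁ <;> fin_cases l₂ <;>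
    fin_cases q <;> simp [spinVal_zero, spinVal_one, ← sub_eq_add_neg, -neg_add_rev]
  all_goals
    simp only [th, thY] at ht htp htm ⊢
    set θ := theta p.ω
    set Y := twistTheta p.ω p.y
  · ring
  · ring
  · have h := twistTheta_pairs hω p.y (t + p.η + v) t (t + p.η + (v + w)) (t - w) (t + v) (t + p.η)
      (x₁ := v + w + p.η) (x₂ := -w) (x₃ := v + w) (x₄ := w + p.η) (x₅ := v) (x₆ := -p.η)
    simp only [theta_neg] at h
    linear_combination (norm := (field_simp; ring)) θ p.η / Y t ^ 2 * h
  · have h := twistTheta_pairs hω p.y (t + (v + w)) t (t + v) (t + w) (t + p.η + (v + w)) (t - p.η)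
      (x₁ := v) (x₂ := w) (x₃ := v + p.η) (x₄ := -(w + p.η)) (x₅ := v + w + p.η) (x₆ := p.η)
    simp only [theta_neg] at h
    linear_combination (norm := (field_simp; ring)) -θ p.η / Y t ^ 2 * h
  · have h := twistTheta_pairs hω p.y (t + p.η - v) t (t + p.η + w) (t - (v + w)) (t + p.η) (t - v)
      (x₁ := w + p.η) (x₂ := -(v + w)) (x₃ := v + w + p.η) (x₄ := w) (x₅ := p.η) (x₆ := v)
    simp only [theta_neg] at h
    linear_combination (norm := (field_simp; ring)) Y (t + p.η + p.η) * θ p.η / (Y (t + p.η) ^ 2 * Y t) * h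
  · have h := twistTheta_four_term hω p.y p.η t v w
    linear_combination (norm := (field_simp; ring))
      h / (Y t ^ 2 * Y (t + p.η) ^ 2)
  · have h := twistTheta_pairs hω p.y (t + p.η + w) t (t + p.η + (v + w)) (t - v) (t + w) (t + p.η)
      (x₁ := v + w + p.η) (x₂ := -v) (x₃ := v + w) (x₄ := v + p.η) (x₅ := w) (x₆ := -p.η)
    simp only [theta_neg] at h
    linear_combination (norm := (field_simp; ring)) θ p.η * Y (t - p.η) / (Y t ^ 2 * Y (t + p.η)) * h
  · ring
  · have h := twistTheta_pairs hω p.y (t + (v + w)) (t - p.η - v) t (t - p.η + w) (t + w) (t - p.η)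
      (x₁ := v + p.η) (x₂ := v + w) (x₃ := p.η) (x₄ := -w) (x₅ := v + w + p.η) (x₆ := -v)
    simp only [theta_neg] at h
    linear_combination (norm := (field_simp; ring)) -θ p.η / Y (t - p.η) ^ 2 * h
  · have h := twistTheta_pairs hω p.y (t - p.η + (v + w)) (t - p.η) (t - p.η + v) (t - p.η + w) (t + (v + w)) (t - p.η - p.η)
      (x₁ := v) (x₂ := w) (x₃ := v + p.η) (x₄ := -(w + p.η)) (x₅ := v + w + p.η) (x₆ := p.η)
    simp only [theta_neg] at h
    linear_combination (norm := (field_simp; ring)) θ p.η / Y (t - p.η) ^ 2 * h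
  · have h := twistTheta_pairs hω p.y (t + p.η - (v + w)) (t + p.η) (t + p.η - v) (t + p.η - w) (t - (v + w)) (t + p.η + p.η)
      (x₁ := -v) (x₂ := -w) (x₃ := -(v + p.η)) (x₄ := w + p.η) (x₅ := -(v + w + p.η)) (x₆ := -p.η)
    simp only [theta_neg] at h
    linear_combination (norm := (field_simp; ring)) θ p.η / Y (t + p.η) ^ 2 * h
  · have h := twistTheta_pairs hω p.y (t - (v + w)) (t + p.η + v) t (t + p.η - w) (t - w) (t + p.η)
      (x₁ := -(v + p.η)) (x₂ := -(v + w)) (x₃ := -p.η) (x₄ := w) (x₅ := -(v + w + p.η)) (x₆ := v)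
    simp only [theta_neg] at h
    linear_combination (norm := (field_simp; ring)) -θ p.η / Y (t + p.η) ^ 2 * h
  · ring
  · have h := twistTheta_pairs hω p.y (t - p.η - w) t (t - p.η - (v + w)) (t + v) (t - w) (t - p.η)
      (x₁ := -(v + w + p.η)) (x₂ := v) (x₃ := -(v + w)) (x₄ := -(v + p.η)) (x₅ := -w) (x₆ := p.η)
    simp only [theta_neg] at h
    linear_combination (norm := (field_simp; ring)) θ p.η * Y (t + p.η) / (Y t ^ 2 * Y (t - p.η)) * h
  · have h := twistTheta_four_term hω p.y p.η (t - p.η) v w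
    rw [sub_add_cancel] at h
    linear_combination (norm := (field_simp; ring))
      -h / (Y t ^ 2 * Y (t - p.η) ^ 2)
  · have h := twistTheta_pairs hω p.y (t - p.η + v) t (t - p.η - w) (t + (v + w)) (t - p.η) (t + v)
      (x₁ := -(w + p.η)) (x₂ := v + w) (x₃ := -(v + w + p.η)) (x₄ := -w) (x₅ := -p.η) (x₆ := -v)
    simp only [theta_neg] at h
    linear_combination (norm := (field_simp; ring)) θ p.η * Y (t - p.η - p.η) / (Y (t - p.η) ^ 2 * Y t) * h
  · have h := twistTheta_pairs hω p.y (t - (v + w)) t (t - v) (t - w) (t - p.η - (v + w)) (t + p.η)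
      (x₁ := -v) (x₂ := -w) (x₃ := -(v + p.η)) (x₄ := w + p.η) (x₅ := -(v + w + p.η)) (x₆ := -p.η)
    simp only [theta_neg] at h
    linear_combination (norm := (field_simp; ring)) -θ p.η / Y t ^ 2 * h
  · have h := twistTheta_pairs hω p.y (t - p.η - v) t (t - p.η - (v + w)) (t + w) (t - v) (t - p.η)
      (x₁ := -(v + w + p.η)) (x₂ := w) (x₃ := -(v + w)) (x₄ := -(w + p.η)) (x₅ := -v) (x₆ := p.η)
    simp only [theta_neg] at h
    linear_combination (norm := (field_simp; ring)) θ p.η / Y t ^ 2 * h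
  · ring
  · ring

end Model

/-! ### Operators on the space of kets -/

theorem diagOp_single {N : ℕ} (f : Spins N × ℤ → ℂ) (s : Spins N × ℤ) (x : ℂ) :
    diagOp f (Finsupp.single s x) = Finsupp.single s (x * f s) := by
  simp [diagOp, Finsupp.linearCombination_single]

theorem shiftOp_single {N : ℕ} (e : ℤ) (s : Spins N × ℤ) (x : ℂ) :
    shiftOp e (Finsupp.single s x) = Finsupp.single (s.1, s.2 + e) x := by
  simp [shiftOp, Finsupp.linearCombination_single]

theorem op_ext {N : ℕ} {X Y : Op N}
    (h : ∀ s : Spins N × ℤ, X (Finsupp.single s 1) = Y (Finsupp.single s 1)) : X = Y :=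
  Finsupp.lhom_ext' fun s => LinearMap.ext_ring (h s)

/-- `X` commutes with the family of operators `F` up to the translation by `δ`. -/
def Shifts {N : ℕ} {A : Type*} [Add A] (F : A → Op N) (δ : A) (X : Op N) : Prop :=
  ∀ c, X * F c = F (c + δ) * X

namespace Shifts

variable {N : ℕ} {A : Type*} [AddCommGroup A] {F : A → Op N} {δ ε : A} {X Y : Op N}

theorem mul (hX : Shifts F δ X) (hY : Shifts F ε Y) : Shifts F (ε + δ) (X * Y) := by
  intro c
  rw [mul_assoc, hY, ← mul_assoc, hX, mul_assoc, add_assoc]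

theorem zero : Shifts F δ 0 := fun c => by simp

theorem sum {ι : Type*} {s : Finset ι} {X : ι → Op N} (h : ∀ i ∈ s, Shifts F δ (X i)) :
    Shifts F δ (∑ i ∈ s, X i) := fun c => by
  rw [Finset.sum_mul, Finset.mul_sum]
  exact Finset.sum_congr rfl fun i hi => h i hi c

end Shifts

namespace Model

variable {N : ℕ} (p : Model N)

theorem spinVal_add_of_R_ne_zero {u t : ℂ} {i k j l : Fin 2} (h : p.R u t (i, k) (j, l) ≠ 0) :
    (i : ℕ) + k = (j : ℕ) + l := by
  revert h
  fin_cases i <;> fin_cases k <;> fin_cases j <;> fin_cases l <;> simp [R]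

theorem spinVal_eq_of_add_eq {i k j l : Fin 2} (h : (i : ℕ) + k = (j : ℕ) + l) :
    spinVal i + spinVal k = spinVal j + spinVal l := by
  have : ((i : ℕ) : ℂ) + (k : ℕ) = (j : ℕ) + (l : ℕ) := by exact_mod_cast h
  simp only [spinVal]
  linear_combination -2 * this

/-- The height `τ + η ∑_{m < k} σₘᶻ`. -/
def partialHeight (k : ℕ) (s : Spins N × ℤ) : ℂ :=
  p.height s.2 + p.η * ∑ m ∈ Finset.univ.filter (fun m : Fin N => m.val < k), spinVal (s.1 m)

theorem partialHeight_zero (s : Spins N × ℤ) : p.partialHeight 0 s = p.height s.2 := by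
  simp [partialHeight]

theorem partialHeight_succ (k : Fin N) (s : Spins N × ℤ) :
    p.partialHeight (k + 1) s = p.partialHeight k s + p.η * spinVal (s.1 k) := by
  have : Finset.univ.filter (fun m : Fin N => m.val < k + 1) =
      insert k (Finset.univ.filter (fun m : Fin N => m.val < k)) := by
    ext m
    simp [Fin.ext_iff]
    lia
  rw [partialHeight, this, Finset.sum_insert (by simp), partialHeight]
  ring

theorem partialHeight_update_of_le {k : ℕ} {n : Fin N} (h : k ≤ n) (s : Spins N) (a : ℤ)
    (q : Fin 2) : p.partialHeight k (Function.update s n q, a) = p.partialHeight k (s, a) := by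
  simp only [partialHeight]
  congr 2
  refine Finset.sum_congr rfl fun m hm => ?_
  rw [Function.update_of_ne]
  rintro rfl
  simp at hm
  lia

theorem partialHeight_update_of_lt {k : ℕ} {n : Fin N} (h : n < k) (s : Spins N) (a : ℤ)
    (q : Fin 2) : p.partialHeight k (Function.update s n q, a) =
      p.partialHeight k (s, a) + p.η * (spinVal q - spinVal (s n)) := by
  have hn : n ∈ Finset.univ.filter (fun m : Fin N => m.val < k) := by simpa using h
  simp only [partialHeight]
  rw [← Finset.add_sum_erase _ _ hn, ← Finset.add_sum_erase _ _ hn, Function.update_self]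
  rw [Finset.sum_congr rfl fun m hm => by rw [Function.update_of_ne (Finset.ne_of_mem_erase hm)]]
  ring

theorem height_add (a e : ℤ) : p.height (a + e) = p.height a - p.η * e := by
  simp only [height]; push_cast; ring

theorem partialHeight_add (k : ℕ) (s : Spins N) (a e : ℤ) :
    p.partialHeight k (s, a + e) = p.partialHeight k (s, a) - p.η * e := by
  simp only [partialHeight, height_add]; ring

theorem exists_partialHeight_eq (k : ℕ) (s : Spins N × ℤ) :
    ∃ m : ℤ, p.partialHeight k s = p.t0 + p.η * m := by
  refine ⟨-s.2 + ∑ m ∈ Finset.univ.filter (fun m : Fin N => m.val < k), (1 - 2 * ((s.1 m : ℕ) : ℤ)), ?_⟩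
  simp only [partialHeight, height, spinVal]
  push_cast
  ring

/-- The heights stay away from the zeros of the weights' denominators. -/
def IsRegular : Prop := ∀ m : ℤ, p.thY (p.t0 + p.η * m) ≠ 0

/-- The R-operator at site `n`, with the height shifted by `c`. -/
def laxAt (n : Fin N) (u c : ℂ) (i j : Fin 2) : Op N :=
  Finsupp.linearCombination ℂ fun s : Spins N × ℤ =>
    ∑ k : Fin 2, Finsupp.single (Function.update s.1 n k, s.2)
      (p.R (u - p.ξ n) (p.partialHeight n s + c) (i, k) (j, s.1 n))

theorem laxAt_single (n : Fin N) (u c : ℂ) (i j : Fin 2) (s : Spins N) (a : ℤ) (x : ℂ) :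
    p.laxAt n u c i j (Finsupp.single (s, a) x) =
      ∑ k : Fin 2, Finsupp.single (Function.update s n k, a)
        (x * p.R (u - p.ξ n) (p.partialHeight n (s, a) + c) (i, k) (j, s n)) := by
  simp [laxAt, Finsupp.linearCombination_single]

theorem lax_eq_laxAt (n : Fin N) (u : ℂ) : p.lax n u = p.laxAt n u 0 := by
  funext i j
  simp only [lax, laxAt, partialHeight, add_zero]
  rfl

/-- The diagonal operator with eigenvalues `g (H + c)`, where `H = τ + η ∑_{m < k} σₘᶻ`. -/
def heightOp (k : ℕ) (g : ℂ → ℂ) (c : ℂ) : Op N := diagOp fun s => g (p.partialHeight k s + c)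

theorem heightOp_single (k : ℕ) (g : ℂ → ℂ) (c : ℂ) (s : Spins N) (a : ℤ) (x : ℂ) :
    p.heightOp k g c (Finsupp.single (s, a) x) =
      Finsupp.single (s, a) (x * g (p.partialHeight k (s, a) + c)) := diagOp_single _ _ _

theorem lax_shifts_laxAt {m n : Fin N} (hmn : m < n) (u v : ℂ) (i j k l : Fin 2) :
    Shifts (fun c => p.laxAt n v c k l) (p.η * spinVal i - p.η * spinVal j) (p.lax m u i j) := by
  intro c
  rw [lax_eq_laxAt]
  refine op_ext fun ⟨s, a⟩ => ?_
  simp only [Module.End.mul_apply, laxAt_single, map_sum]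
  rw [Finset.sum_comm]
  refine Finset.sum_congr rfl fun r _ => Finset.sum_congr rfl fun q _ => ?_
  rw [Function.update_comm hmn.ne', p.partialHeight_update_of_le (Fin.le_def.1 hmn.le),
    p.partialHeight_update_of_lt (Fin.lt_def.1 hmn), Function.update_of_ne hmn.ne,
    Function.update_of_ne hmn.ne']
  congr 1
  by_cases h : p.R (u - p.ξ m) (p.partialHeight m (s, a) + 0) (i, r) (j, s m) = 0
  · rw [h]; ring
  · have := spinVal_eq_of_add_eq (p.spinVal_add_of_R_ne_zero h)
    rw [show p.partialHeight n (s, a) + p.η * (spinVal r - spinVal (s m)) +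
      (c + (p.η * spinVal i - p.η * spinVal j)) = p.partialHeight n (s, a) + c by
        linear_combination p.η * this]
    ring

theorem shiftOp_shifts_laxAt (n : Fin N) (v : ℂ) (k l : Fin 2) (e : ℤ) :
    Shifts (fun c => p.laxAt n v c k l) (p.η * e) (shiftOp e) := by
  intro c
  refine op_ext fun ⟨s, a⟩ => ?_
  simp only [Module.End.mul_apply, laxAt_single, map_sum, shiftOp_single, partialHeight_add]
  refine Finset.sum_congr rfl fun r _ => ?_
  congr 3
  ring

/-- The `RLL` relation at one site. -/
theorem lax_rll (hω : 0 < p.ω.im) (hreg : p.IsRegular) (n : Fin N) (u v : ℂ)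
    (i₁ i₂ l₁ l₂ : Fin 2) :
    ∑ k₁, ∑ k₂, p.heightOp (n + 1) (fun t => p.R (u - v) t (i₁, i₂) (k₁, k₂)) 0 *
      (p.laxAt n u 0 k₁ l₁ * p.laxAt n v (p.η * spinVal l₁) k₂ l₂) =
    ∑ k₁, ∑ k₂, p.laxAt n v 0 i₂ k₂ * (p.laxAt n u (p.η * spinVal k₂) i₁ k₁ *
      p.heightOp n (fun t => p.R (u - v) t (k₁, k₂) (l₁, l₂)) 0) := by
  refine op_ext fun ⟨s, a⟩ => ?_
  simp only [LinearMap.sum_apply, Module.End.mul_apply, heightOp_single, laxAt_single, map_sum,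
    p.partialHeight_update_of_le le_rfl, partialHeight_succ, Function.update_self,
    Function.update_idem, add_zero]
  have hsum : ∀ f : Fin 2 → Fin 2 → Fin 2 → Fin 2 → ℂ,
      ∑ k₁, ∑ k₂, ∑ r, ∑ q', Finsupp.single (Function.update s n q', a) (f k₁ k₂ r q') =
      ∑ q', Finsupp.single (Function.update s n q', a) (∑ k₁, ∑ k₂, ∑ r, f k₁ k₂ r q') := by
    intro f
    simp only [Fin.sum_univ_two, Finsupp.single_add]
    abel
  rw [hsum, hsum]
  refine Finset.sum_congr rfl fun q' _ => ?_
  congr 1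
  obtain ⟨m, hm⟩ := p.exists_partialHeight_eq n (s, a)
  have h := p.dybe hω (t := p.partialHeight n (s, a)) (by rw [hm]; exact hreg m)
    (by rw [hm, show p.t0 + p.η * m + p.η = p.t0 + p.η * ((m + 1 : ℤ) : ℂ) by push_cast; ring]
        exact hreg _)
    (by rw [hm, show p.t0 + p.η * m - p.η = p.t0 + p.η * ((m - 1 : ℤ) : ℂ) by push_cast; ring]
        exact hreg _) (v - p.ξ n) (u - v) i₁ i₂ q' l₁ l₂ (s n)
  rw [show v - p.ξ n + (u - v) = u - p.ξ n by ring] at h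
  refine Eq.trans (Finset.sum_congr rfl fun k₁ _ => Finset.sum_congr rfl fun k₂ _ =>
    Finset.sum_congr rfl fun r _ => ?_) (h.trans (Finset.sum_congr rfl fun k₁ _ =>
      Finset.sum_congr rfl fun k₂ _ => Finset.sum_congr rfl fun r _ => ?_))
  · ring
  · ring

/-! ### The monodromy matrix of the first `k` sites -/

/-- The product of the R-operators of the first `k` sites. -/
def partialMonodromy (k : ℕ) (u : ℂ) : Matrix (Fin 2) (Fin 2) (Op N) :=
  (((List.finRange N).take k).map fun n => p.lax n u).reverse.prod

theorem partialMonodromy_zero (u : ℂ) : p.partialMonodromy 0 u = 1 := by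
  simp [partialMonodromy]

theorem partialMonodromy_succ (k : Fin N) (u : ℂ) :
    p.partialMonodromy (k + 1) u = p.lax k u * p.partialMonodromy k u := by
  have : (List.finRange N).take (k + 1) = (List.finRange N).take k ++ [k] := by
    rw [List.take_succ_eq_append_getElem (by simp)]
    simp
  rw [partialMonodromy, this]
  simp [partialMonodromy]

theorem partialMonodromy_last (u : ℂ) : p.partialMonodromy N u = p.monodromy u := by
  rw [partialMonodromy, List.take_of_length_le (by simp), monodromy]

/-- The matrix `diag (T_τ, T_τ⁻¹)`. -/
def shiftMatrix (N : ℕ) : Matrix (Fin 2) (Fin 2) (Op N) :=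
  Matrix.diagonal ![shiftOp 1, shiftOp (-1)]

/-- The monodromy matrix of the first `k` sites, with dynamical shifts. -/
def partialDyn (k : ℕ) (u : ℂ) : Matrix (Fin 2) (Fin 2) (Op N) :=
  p.partialMonodromy k u * shiftMatrix N

theorem partialDyn_zero (u : ℂ) : p.partialDyn 0 u = shiftMatrix N := by
  rw [partialDyn, partialMonodromy_zero, one_mul]

theorem partialDyn_succ (k : Fin N) (u : ℂ) (i j : Fin 2) :
    p.partialDyn (k + 1) u i j = ∑ l, p.laxAt k u 0 i l * p.partialDyn k u l j := by
  rw [partialDyn, partialMonodromy_succ, mul_assoc, Matrix.mul_apply, lax_eq_laxAt]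
  rfl

theorem partialDyn_last (u : ℂ) : p.partialDyn N u = p.dynMonodromy u := by
  rw [partialDyn, partialMonodromy_last]
  rfl

theorem partialDyn_shifts {A : Type*} [AddCommGroup A] {F : A → Op N} (e f : Fin 2 → A) (u : ℂ)
    (hT : ∀ j, Shifts F (f j) (shiftMatrix N j j)) {k : ℕ} (hk : k ≤ N)
    (hL : ∀ m : Fin N, m.val < k → ∀ i j, Shifts F (e i - e j) (p.lax m u i j)) (i j : Fin 2) :
    Shifts F (e i - e j + f j) (p.partialDyn k u i j) := by
  induction k generalizing i with
  | zero =>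
    rw [partialDyn_zero]
    by_cases h : i = j
    · subst h
      rw [sub_self, zero_add]
      exact hT i
    · rw [shiftMatrix, Matrix.diagonal_apply_ne _ h]
      exact Shifts.zero
  | succ k ih =>
    rw [p.partialDyn_succ ⟨k, hk⟩]
    refine Shifts.sum fun l _ => ?_
    have h1 := hL ⟨k, hk⟩ (Nat.lt_succ_self k) i l
    rw [lax_eq_laxAt] at h1
    have := h1.mul (ih (by lia) (fun m hm => hL m (by lia)) l)
    rwa [show e l - e j + f j + (e i - e l) = e i - e j + f j by abel] at this

theorem shiftMatrix_apply_self (j : Fin 2) :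
    shiftMatrix N j j = shiftOp (1 - 2 * ((j : ℕ) : ℤ)) := by
  fin_cases j <;> simp [shiftMatrix]

theorem spinVal_eq_intCast (j : Fin 2) : spinVal j = ((1 - 2 * ((j : ℕ) : ℤ) : ℤ) : ℂ) := by
  simp [spinVal]

theorem partialDyn_shifts_laxAt (n : Fin N) (u v : ℂ) (i j k l : Fin 2) :
    Shifts (fun c => p.laxAt n v c k l) (p.η * spinVal i) (p.partialDyn n u i j) := by
  have := p.partialDyn_shifts (F := fun c => p.laxAt n v c k l) (fun i => p.η * spinVal i)
    (fun j => p.η * spinVal j) u (fun j => by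
      rw [shiftMatrix_apply_self, spinVal_eq_intCast]
      exact p.shiftOp_shifts_laxAt n v k l _) n.isLt.le
      (fun m hm i j => p.lax_shifts_laxAt hm u v i j k l) i j
  simpa using this

/-- Two adjacent monodromy matrices, factored at the last site. -/
theorem partialDyn_mul_succ (k : Fin N) (u v : ℂ) (i₁ i₂ j₁ j₂ : Fin 2) :
    p.partialDyn (k + 1) u i₁ j₁ * p.partialDyn (k + 1) v i₂ j₂ =
      ∑ l₁, ∑ l₂, p.laxAt k u 0 i₁ l₁ * p.laxAt k v (p.η * spinVal l₁) i₂ l₂ *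
        (p.partialDyn k u l₁ j₁ * p.partialDyn k v l₂ j₂) := by
  rw [partialDyn_succ, partialDyn_succ, Finset.sum_mul_sum]
  refine Finset.sum_congr rfl fun l₁ _ => Finset.sum_congr rfl fun l₂ _ => ?_
  have := p.partialDyn_shifts_laxAt k u v l₁ j₁ i₂ l₂ 0
  simp only [zero_add] at this
  rw [mul_assoc, ← mul_assoc (p.partialDyn k u l₁ j₁), this]
  simp only [mul_assoc]

theorem shiftMatrix_apply (i j : Fin 2) :
    shiftMatrix N i j = if i = j then shiftOp (1 - 2 * ((j : ℕ) : ℤ)) else 0 := by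
  split_ifs with h
  · rw [h, shiftMatrix_apply_self]
  · rw [shiftMatrix, Matrix.diagonal_apply_ne _ h]

theorem shiftMatrix_rtt (u v : ℂ) (i₁ i₂ j₁ j₂ : Fin 2) :
    ∑ k₁, ∑ k₂, p.heightOp 0 (fun t => p.R (u - v) t (i₁, i₂) (k₁, k₂)) 0 *
      (shiftMatrix N k₁ j₁ * shiftMatrix N k₂ j₂) =
    ∑ k₁, ∑ k₂, shiftMatrix N i₂ k₂ * shiftMatrix N i₁ k₁ *
      p.heightOp 0 (fun t => p.R (u - v) t (k₁, k₂) (j₁, j₂)) 0 := by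
  rw [Finset.sum_eq_single j₁ (fun k _ hk => Finset.sum_eq_zero fun l _ => by
      rw [shiftMatrix_apply, if_neg hk, zero_mul, mul_zero]) (by simp),
    Finset.sum_eq_single j₂ (fun k _ hk => by
      rw [shiftMatrix_apply k, if_neg hk, mul_zero, mul_zero]) (by simp),
    Finset.sum_eq_single i₁ (fun k _ hk => Finset.sum_eq_zero fun l _ => by
      rw [shiftMatrix_apply i₁, if_neg hk.symm, mul_zero, zero_mul]) (by simp),
    Finset.sum_eq_single i₂ (fun k _ hk => by
      rw [shiftMatrix_apply i₂, if_neg hk.symm, zero_mul, zero_mul]) (by simp)]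
  simp only [shiftMatrix_apply_self]
  refine op_ext fun ⟨s, a⟩ => ?_
  simp only [Module.End.mul_apply, heightOp_single, shiftOp_single, partialHeight_zero, add_zero,
    one_mul]
  by_cases h : (i₁ : ℕ) + i₂ = (j₁ : ℕ) + j₂
  · have hz : a + (1 - 2 * ((j₂ : ℕ) : ℤ)) + (1 - 2 * ((j₁ : ℕ) : ℤ)) =
        a + (1 - 2 * ((i₁ : ℕ) : ℤ)) + (1 - 2 * ((i₂ : ℕ) : ℤ)) := by lia
    rw [hz]
    congr 1
    by_cases hi : i₁ = i₂
    · rw [R_apply, R_apply, if_pos hi, if_pos hi]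
    · congr 2
      have : (i₁ : ℕ) + i₂ = 1 := by lia
      lia
  · have hR : ∀ t, p.R (u - v) t (i₁, i₂) (j₁, j₂) = 0 := fun t => by
      by_contra hne
      exact h (p.spinVal_add_of_R_ne_zero hne)
    rw [hR, hR, Finsupp.single_zero, Finsupp.single_zero]

/-- The `RTT` relation. -/
theorem partialDyn_rtt (hω : 0 < p.ω.im) (hreg : p.IsRegular) {k : ℕ} (hk : k ≤ N) (u v : ℂ)
    (i₁ i₂ j₁ j₂ : Fin 2) :
    ∑ k₁, ∑ k₂, p.heightOp k (fun t => p.R (u - v) t (i₁, i₂) (k₁, k₂)) 0 *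
      (p.partialDyn k u k₁ j₁ * p.partialDyn k v k₂ j₂) =
    ∑ k₁, ∑ k₂, p.partialDyn k v i₂ k₂ * p.partialDyn k u i₁ k₁ *
      p.heightOp 0 (fun t => p.R (u - v) t (k₁, k₂) (j₁, j₂)) 0 := by
  induction k generalizing i₁ i₂ with
  | zero =>
    simpa only [partialDyn_zero] using p.shiftMatrix_rtt u v i₁ i₂ j₁ j₂
  | succ k ih =>
    obtain ⟨n, rfl⟩ : ∃ n : Fin N, n.val = k := ⟨⟨k, hk⟩, rfl⟩
    have h1 := p.partialDyn_mul_succ n u v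
    have h2 := p.partialDyn_mul_succ n v u
    have h3 := p.lax_rll hω hreg n u v i₁ i₂
    have ih' := fun i₁ i₂ => ih (by lia) i₁ i₂
    calc _ = ∑ l₁, ∑ l₂, (∑ k₁, ∑ k₂,
          p.heightOp (n + 1) (fun t => p.R (u - v) t (i₁, i₂) (k₁, k₂)) 0 *
            (p.laxAt n u 0 k₁ l₁ * p.laxAt n v (p.η * spinVal l₁) k₂ l₂)) *
            (p.partialDyn n u l₁ j₁ * p.partialDyn n v l₂ j₂) := by
          simp only [h1, Fin.sum_univ_two, mul_add, add_mul, mul_assoc]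
          abel
      _ = ∑ k₁, ∑ k₂, p.laxAt n v 0 i₂ k₂ * (p.laxAt n u (p.η * spinVal k₂) i₁ k₁ *
            (∑ l₁, ∑ l₂, p.heightOp n (fun t => p.R (u - v) t (k₁, k₂) (l₁, l₂)) 0 *
              (p.partialDyn n u l₁ j₁ * p.partialDyn n v l₂ j₂))) := by
          simp only [h3]
          simp only [Fin.sum_univ_two, mul_add, add_mul, mul_assoc]
          abel
      _ = _ := by
          simp only [ih', h2]
          simp only [Fin.sum_univ_two, mul_add, add_mul, mul_assoc]
          abel

/-! ### Fusion -/

theorem IsRegular.partialHeight_ne_zero {p : Model N} (hreg : p.IsRegular) (k : ℕ)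
    (s : Spins N × ℤ) : p.thY (p.partialHeight k s) ≠ 0 := by
  obtain ⟨m, hm⟩ := p.exists_partialHeight_eq k s
  rw [hm]
  exact hreg m

theorem IsRegular.partialHeight_add_ne_zero {p : Model N} (hreg : p.IsRegular) (k : ℕ)
    (s : Spins N × ℤ) (i : Fin 2) : p.thY (p.partialHeight k s + p.η * spinVal i) ≠ 0 := by
  obtain ⟨m, hm⟩ := p.exists_partialHeight_eq k s
  rw [hm, spinVal_eq_intCast, add_assoc, ← mul_add, ← Int.cast_add]
  exact hreg _

theorem R_neg_eta (t : ℂ) (i k : Fin 2) (x : Fin 2 × Fin 2) :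
    p.R (-p.η) t (i, k) x = -p.R (-p.η) t (k, i) x := by
  obtain ⟨j, l⟩ := x
  rw [R_apply, R_apply]
  fin_cases i <;> fin_cases k <;> fin_cases j <;> fin_cases l <;>
    simp [spinVal_zero, spinVal_one, th_neg, th_zero]

theorem R_zero {t : ℂ} (ht : p.thY t ≠ 0) (i k j l : Fin 2) :
    p.R 0 t (i, k) (j, l) = if i = l ∧ k = j then p.th p.η else 0 := by
  rw [R_apply]
  fin_cases i <;> fin_cases k <;> fin_cases j <;> fin_cases l <;> simp [th_zero, ht]

theorem op_eq_zero_of_eq_neg_smul {X : Op N} (h : X = (-1 : ℂ) • X) : X = 0 := by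
  refine LinearMap.ext fun v => ?_
  have h1 : X v = -X v := by
    conv_lhs => rw [h]
    rw [LinearMap.smul_apply, neg_one_smul]
  have h2 : (2 : ℂ) • X v = 0 := by
    rw [two_smul]
    nth_rewrite 2 [h1]
    exact add_neg_cancel _
  exact (smul_eq_zero.1 h2).resolve_left two_ne_zero

theorem laxAt_fusion (hreg : p.IsRegular) (n : Fin N) (i₁ i₂ l₁ l₂ : Fin 2) :
    p.laxAt n (p.ξ n) 0 i₂ l₂ * p.laxAt n (p.ξ n - p.η) (p.η * spinVal l₂) i₁ l₁ =
      (-1 : ℂ) • (p.laxAt n (p.ξ n) 0 i₁ l₂ * p.laxAt n (p.ξ n - p.η) (p.η * spinVal l₂) i₂ l₁) := by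
  refine op_ext fun ⟨s, a⟩ => ?_
  simp only [Module.End.mul_apply, laxAt_single, map_sum, LinearMap.smul_apply, sub_self,
    p.partialHeight_update_of_le le_rfl, Function.update_self, Function.update_idem, add_zero,
    show p.ξ n - p.η - p.ξ n = -p.η by ring, p.R_zero (hreg.partialHeight_ne_zero _ _)]
  have hsum : ∀ i₁ i₂ : Fin 2, (∑ r, ∑ q', Finsupp.single (Function.update s n q', a)
      (1 * p.R (-p.η) (p.partialHeight n (s, a) + p.η * spinVal l₂) (i₁, r) (l₁, s n) *
        if i₂ = r ∧ q' = l₂ then p.th p.η else 0)) = Finsupp.single (Function.update s n l₂, a)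
      (p.R (-p.η) (p.partialHeight n (s, a) + p.η * spinVal l₂) (i₁, i₂) (l₁, s n) *
        p.th p.η) := by
    intro i₁ i₂
    rw [Finset.sum_eq_single i₂ (fun r _ hr => Finset.sum_eq_zero fun q' _ => by
        rw [if_neg (fun h => hr h.1.symm), mul_zero, Finsupp.single_zero]) (by simp),
      Finset.sum_eq_single l₂ (fun q' _ hq => by
        rw [if_neg (fun h => hq h.2), mul_zero, Finsupp.single_zero]) (by simp)]
    simp
  rw [hsum, hsum, p.R_neg_eta, Finsupp.smul_single, smul_eq_mul]
  congr 1
  ring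

theorem partialDyn_fusion (hω : 0 < p.ω.im) (hη : p.th p.η ≠ 0) (hreg : p.IsRegular) (n : Fin N)
    {k : ℕ} (hnk : n < k) (hk : k ≤ N) (i₁ i₂ j₁ j₂ : Fin 2) :
    p.partialDyn k (p.ξ n) i₂ j₂ * p.partialDyn k (p.ξ n - p.η) i₁ j₁ =
      (-1 : ℂ) • (p.partialDyn k (p.ξ n) i₁ j₂ * p.partialDyn k (p.ξ n - p.η) i₂ j₁) := by
  induction k, hnk using Nat.le_induction generalizing i₁ i₂ with
  | base =>
    rw [Nat.succ_eq_add_one, partialDyn_mul_succ, partialDyn_mul_succ]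
    simp only [p.laxAt_fusion hreg n i₁ i₂, smul_mul_assoc, Fin.sum_univ_two, smul_add]
  | succ k hnk ih =>
    have ih := ih (by lia)
    obtain ⟨m, rfl⟩ : ∃ m : Fin N, m.val = k := ⟨⟨k, hk⟩, rfl⟩
    set u := p.ξ n - p.η
    set v := p.ξ n
    set X := fun i₂ i₁ => p.partialDyn m v i₂ j₂ * p.partialDyn m u i₁ j₁
    have h0 : X 0 0 = 0 := op_eq_zero_of_eq_neg_smul (ih 0 0)
    have h1 : X 1 1 = 0 := op_eq_zero_of_eq_neg_smul (ih 1 1)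
    have h01 : X 0 1 = (-1 : ℂ) • X 1 0 := ih 1 0
    have hm := p.partialDyn_mul_succ m v u
    have hexp : ∀ i₂ i₁, p.partialDyn (m + 1) v i₂ j₂ * p.partialDyn (m + 1) u i₁ j₁ =
        (p.laxAt m v 0 i₂ 1 * p.laxAt m u (p.η * spinVal 1) i₁ 0 + (-1 : ℂ) •
          (p.laxAt m v 0 i₂ 0 * p.laxAt m u (p.η * spinVal 0) i₁ 1)) * X 1 0 := by
      intro i₂ i₁
      rw [hm]
      change ∑ l₁, ∑ l₂, p.laxAt m v 0 i₂ l₁ * p.laxAt m u (p.η * spinVal l₁) i₁ l₂ * X l₁ l₂ = _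
      simp only [Fin.sum_univ_two, h0, h1, h01, mul_zero, zero_add, add_zero, add_mul,
        smul_mul_assoc, mul_smul_comm]
      abel
    have huv : u - v = -p.η := by simp [u, v]
    have hrll : ∀ i₁ i₂, (p.laxAt m v 0 i₂ 1 * p.laxAt m u (p.η * spinVal 1) i₁ 0 + (-1 : ℂ) •
        (p.laxAt m v 0 i₂ 0 * p.laxAt m u (p.η * spinVal 0) i₁ 1)) *
          p.heightOp m (fun t => p.R (-p.η) t (0, 1) (0, 1)) 0 =
        ∑ k₁, ∑ k₂, p.heightOp (m + 1) (fun t => p.R (-p.η) t (i₁, i₂) (k₁, k₂)) 0 *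
          (p.laxAt m u 0 k₁ 0 * p.laxAt m v (p.η * spinVal 0) k₂ 1) := by
      intro i₁ i₂
      have h := p.lax_rll hω hreg m u v i₁ i₂ 0 1
      rw [huv] at h
      rw [h]
      have e0 : (fun t => p.R (-p.η) t (0, 0) (0, 1)) = fun _ => 0 := by
        funext t; simp [R_apply]
      have e1 : (fun t => p.R (-p.η) t (1, 1) (0, 1)) = fun _ => 0 := by
        funext t; simp [R_apply]
      have e2 : (fun t => p.R (-p.η) t (1, 0) (0, 1)) =
          fun t => -p.R (-p.η) t (0, 1) (0, 1) := by
        funext t; rw [R_neg_eta]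
      have z : p.heightOp m (fun _ => 0) 0 = 0 := by
        refine op_ext fun ⟨s, a⟩ => ?_
        simp [heightOp_single]
      have ng : p.heightOp m (fun t => -p.R (-p.η) t (0, 1) (0, 1)) 0 =
          (-1 : ℂ) • p.heightOp m (fun t => p.R (-p.η) t (0, 1) (0, 1)) 0 := by
        refine op_ext fun ⟨s, a⟩ => ?_
        rw [LinearMap.smul_apply, heightOp_single, heightOp_single, Finsupp.smul_single]
        congr 1
        rw [smul_eq_mul]
        ring
      simp only [Fin.sum_univ_two, e0, e1, e2, z, ng, mul_zero, zero_add, add_zero, add_mul,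
        smul_mul_assoc, mul_smul_comm, mul_assoc]
    have hinv : p.heightOp m (fun t => p.R (-p.η) t (0, 1) (0, 1)) 0 *
        p.heightOp m (fun t => (p.R (-p.η) t (0, 1) (0, 1))⁻¹) 0 = 1 := by
      refine op_ext fun ⟨s, a⟩ => ?_
      have h1 := hreg.partialHeight_ne_zero m (s, a)
      have h2 := hreg.partialHeight_add_ne_zero m (s, a) 0
      have : p.R (-p.η) (p.partialHeight m (s, a)) (0, 1) (0, 1) ≠ 0 := by
        rw [R_apply]
        simp [th_neg, h1, hη, h2]
      simp only [Module.End.mul_apply, heightOp_single, add_zero, Module.End.one_apply]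
      rw [one_mul, inv_mul_cancel₀ this]
    have hanti : ∀ i₁ i₂, (∑ k₁, ∑ k₂,
        p.heightOp (m + 1) (fun t => p.R (-p.η) t (i₁, i₂) (k₁, k₂)) 0 *
          (p.laxAt m u 0 k₁ 0 * p.laxAt m v (p.η * spinVal 0) k₂ 1)) = (-1 : ℂ) • (∑ k₁, ∑ k₂,
        p.heightOp (m + 1) (fun t => p.R (-p.η) t (i₂, i₁) (k₁, k₂)) 0 *
          (p.laxAt m u 0 k₁ 0 * p.laxAt m v (p.η * spinVal 0) k₂ 1)) := by
      intro i₁ i₂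
      have h : ∀ x, p.heightOp (m + 1) (fun t => p.R (-p.η) t (i₁, i₂) x) 0 =
          (-1 : ℂ) • p.heightOp (m + 1) (fun t => p.R (-p.η) t (i₂, i₁) x) 0 := by
        intro x
        refine op_ext fun ⟨s, a⟩ => ?_
        rw [LinearMap.smul_apply, heightOp_single, heightOp_single, Finsupp.smul_single]
        congr 1
        rw [p.R_neg_eta, smul_eq_mul]
        ring
      simp only [h, smul_mul_assoc, Fin.sum_univ_two, smul_add]
    have hN : ∀ i₁ i₂, p.partialDyn (m + 1) v i₂ j₂ * p.partialDyn (m + 1) u i₁ j₁ =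
        (∑ k₁, ∑ k₂, p.heightOp (m + 1) (fun t => p.R (-p.η) t (i₁, i₂) (k₁, k₂)) 0 *
          (p.laxAt m u 0 k₁ 0 * p.laxAt m v (p.η * spinVal 0) k₂ 1)) *
          (p.heightOp m (fun t => (p.R (-p.η) t (0, 1) (0, 1))⁻¹) 0 * X 1 0) := by
      intro i₁ i₂
      rw [hexp, ← hrll, mul_assoc, ← mul_assoc (p.heightOp _ _ _), hinv, one_mul]
    rw [hN, hN, hanti, smul_mul_assoc]

theorem opC_mul_opC_eq_zero (hω : 0 < p.ω.im) (hη : p.th p.η ≠ 0) (hreg : p.IsRegular)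
    (n : Fin N) : p.opC (p.ξ n) * p.opC (p.ξ n - p.η) = 0 := by
  have := p.partialDyn_fusion hω hη hreg n n.isLt le_rfl 1 1 0 0
  rw [partialDyn_last, partialDyn_last] at this
  exact op_eq_zero_of_eq_neg_smul this

end Model

/-! ### Sectors of fixed spin and height -/

/-- The number of down spins. -/
def weight {N : ℕ} (h : Spins N) : ℤ := ∑ k, ((h k : ℕ) : ℤ)

theorem weight_update {N : ℕ} (h : Spins N) (n : Fin N) (q : Fin 2) :
    weight (Function.update h n q) = weight h + (q : ℕ) - (h n : ℕ) := by
  simp only [weight]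
  rw [← Finset.add_sum_erase _ _ (Finset.mem_univ n), ← Finset.add_sum_erase _ _ (Finset.mem_univ n),
    Function.update_self,
    Finset.sum_congr rfl fun m hm => by rw [Function.update_of_ne (Finset.ne_of_mem_erase hm)]]
  ring

/-- Kets with `m` down spins and height index `a`. -/
def sector (N : ℕ) (m a : ℤ) : Submodule ℂ (Ket N) :=
  Finsupp.supported ℂ ℂ {s : Spins N × ℤ | weight s.1 = m ∧ s.2 = a}

theorem single_mem_sector {N : ℕ} (s : Spins N × ℤ) (x : ℂ) :
    Finsupp.single s x ∈ sector N (weight s.1) s.2 :=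
  Finsupp.single_mem_supported ℂ x (by exact ⟨rfl, rfl⟩)

theorem sector_le {N : ℕ} {m a : ℤ} {W : Submodule ℂ (Ket N)}
    (h : ∀ s : Spins N × ℤ, weight s.1 = m → s.2 = a → Finsupp.single s 1 ∈ W) :
    sector N m a ≤ W := by
  rw [sector, Finsupp.supported_eq_span_single, Submodule.span_le]
  rintro _ ⟨s, ⟨h1, h2⟩, rfl⟩
  exact h s h1 h2

/-- Covectors with `m` down spins and height index `a`. -/
def braSector (N : ℕ) (m a : ℤ) : Submodule ℂ (Bra N) where
  carrier := {φ | ∀ s : Spins N × ℤ, ¬(weight s.1 = m ∧ s.2 = a) → φ (Finsupp.single s 1) = 0}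
  add_mem' h1 h2 s hs := by rw [LinearMap.add_apply, h1 s hs, h2 s hs, add_zero]
  zero_mem' s _ := rfl
  smul_mem' c φ h s hs := by rw [LinearMap.smul_apply, h s hs, smul_zero]

theorem braSector_apply_eq_zero {N : ℕ} {m a m' a' : ℤ} {φ : Bra N} (hφ : φ ∈ braSector N m a)
    {v : Ket N} (hv : v ∈ sector N m' a') (h : ¬(m' = m ∧ a' = a)) : φ v = 0 := by
  have : sector N m' a' ≤ LinearMap.ker φ := by
    refine sector_le fun s h1 h2 => hφ s ?_
    rwa [h1, h2]
  exact this hv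

theorem bra_ext {N : ℕ} {φ ψ : Bra N}
    (h : ∀ s : Spins N × ℤ, φ (Finsupp.single s 1) = ψ (Finsupp.single s 1)) : φ = ψ :=
  Finsupp.lhom_ext' fun s => LinearMap.ext_ring (h s)

namespace Model

variable {N : ℕ} (p : Model N)

theorem laxAt_mem_sector (n : Fin N) (u c : ℂ) (i j : Fin 2) {m a : ℤ} {v : Ket N}
    (hv : v ∈ sector N m a) : p.laxAt n u c i j v ∈ sector N (m + (j : ℕ) - (i : ℕ)) a := by
  have : sector N m a ≤ (sector N (m + (j : ℕ) - (i : ℕ)) a).comap (p.laxAt n u c i j) := by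
    refine sector_le fun ⟨s, b⟩ h1 h2 => ?_
    rw [Submodule.mem_comap, laxAt_single]
    refine Submodule.sum_mem _ fun k _ => ?_
    by_cases h : p.R (u - p.ξ n) (p.partialHeight n (s, b) + c) (i, k) (j, s n) = 0
    · rw [h, mul_zero, Finsupp.single_zero]
      exact Submodule.zero_mem _
    · have := p.spinVal_add_of_R_ne_zero h
      refine Finsupp.single_mem_supported ℂ _ ⟨?_, h2⟩
      rw [weight_update]
      simp only at h1
      lia
  exact this hv

theorem partialDyn_mem_sector {k : ℕ} (hk : k ≤ N) (u : ℂ) (i j : Fin 2) {m a : ℤ} {v : Ket N}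
    (hv : v ∈ sector N m a) :
    p.partialDyn k u i j v ∈ sector N (m + (j : ℕ) - (i : ℕ)) (a + (1 - 2 * ((j : ℕ) : ℤ))) := by
  induction k generalizing i with
  | zero =>
    rw [partialDyn_zero, shiftMatrix_apply]
    split_ifs with h
    · subst h
      have : sector N m a ≤ (sector N (m + (i : ℕ) - (i : ℕ)) (a + (1 - 2 * ((i : ℕ) : ℤ)))).comap
          (shiftOp (1 - 2 * ((i : ℕ) : ℤ))) := by
        refine sector_le fun ⟨s, b⟩ h1 h2 => ?_
        rw [Submodule.mem_comap, shiftOp_single]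
        exact Finsupp.single_mem_supported ℂ _ ⟨by rw [h1]; ring, by rw [← h2]⟩
      exact this hv
    · exact Submodule.zero_mem _
  | succ k ih =>
    obtain ⟨n, rfl⟩ : ∃ n : Fin N, n.val = k := ⟨⟨k, hk⟩, rfl⟩
    rw [partialDyn_succ, LinearMap.sum_apply]
    refine Submodule.sum_mem _ fun l _ => ?_
    have := p.laxAt_mem_sector n u 0 i l (ih (by lia) l)
    rwa [show m + ((j : ℕ) : ℤ) - ((l : ℕ) : ℤ) + ((l : ℕ) : ℤ) - ((i : ℕ) : ℤ) =
      m + ((j : ℕ) : ℤ) - ((i : ℕ) : ℤ) by ring] at this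

theorem dynMonodromy_mem_sector (u : ℂ) (i j : Fin 2) {m a : ℤ} {v : Ket N}
    (hv : v ∈ sector N m a) :
    p.dynMonodromy u i j v ∈ sector N (m + (j : ℕ) - (i : ℕ)) (a + (1 - 2 * ((j : ℕ) : ℤ))) := by
  rw [← partialDyn_last]
  exact p.partialDyn_mem_sector le_rfl u i j hv

theorem dynMonodromy_mem_braSector (u : ℂ) (i j : Fin 2) {m a : ℤ} {φ : Bra N}
    (hφ : φ ∈ braSector N m a) : (p.dynMonodromy u i j).dualMap φ ∈
      braSector N (m + (i : ℕ) - (j : ℕ)) (a - (1 - 2 * ((j : ℕ) : ℤ))) := by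
  intro s hs
  rw [LinearMap.dualMap_apply]
  refine braSector_apply_eq_zero hφ (p.dynMonodromy_mem_sector u i j (single_mem_sector s 1)) ?_
  contrapose! hs
  lia

theorem partialHeight_last (s : Spins N × ℤ) :
    p.partialHeight N s = p.height s.2 + p.η * (N - 2 * weight s.1) := by
  have : Finset.univ.filter (fun m : Fin N => m.val < N) = Finset.univ := by
    ext m; simp
  rw [partialHeight, this, weight]
  simp only [spinVal, Finset.sum_sub_distrib, ← Finset.mul_sum]
  push_cast
  simp

theorem heightOp_zero_apply (g : ℂ → ℂ) {m a : ℤ} {v : Ket N} (hv : v ∈ sector N m a) :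
    p.heightOp 0 g 0 v = g (p.height a) • v := by
  have : sector N m a ≤ LinearMap.eqLocus (p.heightOp 0 g 0) (g (p.height a) • LinearMap.id) := by
    refine sector_le fun ⟨s, b⟩ h1 h2 => ?_
    simp only at h2
    subst h2
    rw [LinearMap.mem_eqLocus, heightOp_single, partialHeight_zero, LinearMap.smul_apply,
      LinearMap.id_apply, Finsupp.smul_single, add_zero, smul_eq_mul, mul_comm]
  exact this hv

theorem heightOp_last_apply (g : ℂ → ℂ) {m a : ℤ} {v : Ket N} (hv : v ∈ sector N m a) :
    p.heightOp N g 0 v = g (p.height a + p.η * (N - 2 * m)) • v := by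
  have : sector N m a ≤ LinearMap.eqLocus (p.heightOp N g 0)
      (g (p.height a + p.η * (N - 2 * m)) • LinearMap.id) := by
    refine sector_le fun ⟨s, b⟩ h1 h2 => ?_
    simp only at h1 h2
    subst h1 h2
    rw [LinearMap.mem_eqLocus, heightOp_single, partialHeight_last, LinearMap.smul_apply,
      LinearMap.id_apply, Finsupp.smul_single, add_zero, smul_eq_mul, mul_comm]
  exact this hv

theorem heightOp_zero_dualMap (g : ℂ → ℂ) {m a : ℤ} {φ : Bra N} (hφ : φ ∈ braSector N m a) :
    (p.heightOp 0 g 0).dualMap φ = g (p.height a) • φ := by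
  refine bra_ext fun s => ?_
  rw [LinearMap.dualMap_apply, p.heightOp_zero_apply g (single_mem_sector s 1), map_smul,
    LinearMap.smul_apply]
  by_cases h : weight s.1 = m ∧ s.2 = a
  · rw [h.2]
  · rw [hφ s h, smul_zero, smul_zero]

theorem heightOp_last_dualMap (g : ℂ → ℂ) {m a : ℤ} {φ : Bra N} (hφ : φ ∈ braSector N m a) :
    (p.heightOp N g 0).dualMap φ = g (p.height a + p.η * (N - 2 * m)) • φ := by
  refine bra_ext fun s => ?_
  rw [LinearMap.dualMap_apply, p.heightOp_last_apply g (single_mem_sector s 1), map_smul,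
    LinearMap.smul_apply]
  by_cases h : weight s.1 = m ∧ s.2 = a
  · rw [h.1, h.2]
  · rw [hφ s h, smul_zero, smul_zero]

theorem rtt_ket (hω : 0 < p.ω.im) (hreg : p.IsRegular) (u v : ℂ) (i₁ i₂ j₁ j₂ : Fin 2)
    {m a : ℤ} {ψ : Ket N} (hψ : ψ ∈ sector N m a) :
    ∑ k₁, ∑ k₂, p.R (u - v) (p.height a + p.η * (N - 2 * m) - p.η * (spinVal i₁ + spinVal i₂))
        (i₁, i₂) (k₁, k₂) • p.dynMonodromy u k₁ j₁ (p.dynMonodromy v k₂ j₂ ψ) =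
      ∑ k₁, ∑ k₂, p.R (u - v) (p.height a) (k₁, k₂) (j₁, j₂) •
        p.dynMonodromy v i₂ k₂ (p.dynMonodromy u i₁ k₁ ψ) := by
  have h := congrArg (fun X : Op N => X ψ) (p.partialDyn_rtt hω hreg le_rfl u v i₁ i₂ j₁ j₂)
  simp only [partialDyn_last, LinearMap.sum_apply, Module.End.mul_apply] at h
  refine Eq.trans (Finset.sum_congr rfl fun k₁ _ => Finset.sum_congr rfl fun k₂ _ => ?_)
    (h.trans (Finset.sum_congr rfl fun k₁ _ => Finset.sum_congr rfl fun k₂ _ => ?_))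
  · rw [p.heightOp_last_apply _ (p.dynMonodromy_mem_sector u k₁ j₁
      (p.dynMonodromy_mem_sector v k₂ j₂ hψ))]
    congr 1
    by_cases hk : (i₁ : ℕ) + i₂ = (k₁ : ℕ) + k₂
    · congr 1
      simp only [height_add]
      rw [spinVal_eq_of_add_eq hk]
      simp only [spinVal]
      push_cast
      ring
    · have hR : ∀ t, p.R (u - v) t (i₁, i₂) (k₁, k₂) = 0 := fun t => by
        by_contra hne
        exact hk (p.spinVal_add_of_R_ne_zero hne)
      rw [hR, hR]
  · rw [p.heightOp_zero_apply _ hψ, map_smul, map_smul]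

theorem rtt_bra (hω : 0 < p.ω.im) (hreg : p.IsRegular) (u v : ℂ) (i₁ i₂ j₁ j₂ : Fin 2)
    {m a : ℤ} {φ : Bra N} (hφ : φ ∈ braSector N m a) :
    ∑ k₁, ∑ k₂, p.R (u - v) (p.height a + p.η * (N - 2 * m)) (i₁, i₂) (k₁, k₂) •
        (p.dynMonodromy v k₂ j₂).dualMap ((p.dynMonodromy u k₁ j₁).dualMap φ) =
      ∑ k₁, ∑ k₂, p.R (u - v) (p.height a + p.η * (spinVal j₁ + spinVal j₂)) (k₁, k₂) (j₁, j₂) •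
        (p.dynMonodromy u i₁ k₁).dualMap ((p.dynMonodromy v i₂ k₂).dualMap φ) := by
  have h := congrArg (fun X : Op N => X.dualMap φ)
    (p.partialDyn_rtt hω hreg le_rfl u v i₁ i₂ j₁ j₂)
  simp only [partialDyn_last] at h
  have e : ∀ f : Fin 2 → Fin 2 → Op N, (∑ k₁, ∑ k₂, f k₁ k₂).dualMap φ =
      ∑ k₁, ∑ k₂, (f k₁ k₂).dualMap φ := by
    intro f
    ext x
    simp
  have e2 : ∀ X Y : Op N, (X * Y).dualMap φ = Y.dualMap (X.dualMap φ) := fun _ _ => rfl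
  simp only [e, e2] at h
  refine Eq.trans (Finset.sum_congr rfl fun k₁ _ => Finset.sum_congr rfl fun k₂ _ => ?_)
    (h.trans (Finset.sum_congr rfl fun k₁ _ => Finset.sum_congr rfl fun k₂ _ => ?_))
  · rw [p.heightOp_last_dualMap _ hφ, map_smul]
    rfl
  · rw [p.heightOp_zero_dualMap _ (p.dynMonodromy_mem_braSector u i₁ k₁
      (p.dynMonodromy_mem_braSector v i₂ k₂ hφ))]
    congr 1
    by_cases hk : (k₁ : ℕ) + k₂ = (j₁ : ℕ) + j₂
    · congr 1
      rw [← spinVal_eq_of_add_eq hk]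
      simp only [spinVal, height]
      push_cast
      ring
    · have hR : ∀ t, p.R (u - v) t (k₁, k₂) (j₁, j₂) = 0 := fun t => by
        by_contra hne
        exact hk (p.spinVal_add_of_R_ne_zero hne)
      rw [hR, hR]

/-! ### Regularity of the heights -/

theorem IsGeneric.th_ne_zero {p : Model N} (hη : p.IsGeneric) (hω : 0 < p.ω.im) : p.th p.η ≠ 0 := by
  have := hη 1 one_ne_zero
  rw [Int.cast_one, one_mul] at this
  exact theta_ne_zero hω this

theorem IsGeneric.eta_ne_zero {p : Model N} (hη : p.IsGeneric) : p.η ≠ 0 := by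
  intro h
  refine hη 1 one_ne_zero ⟨0, 0, ?_⟩
  simp [h]

theorem isRegular (hω : 0 < p.ω.im) (hη : p.IsGeneric) (hx : p.x ≤ 1) (hy : p.y ≤ 1)
    (hxy : Even N → ¬ (p.x = 0 ∧ p.y = 0)) : p.IsRegular := by
  intro m
  refine mul_ne_zero (exp_ne_zero _) (theta_ne_zero hω ?_)
  rintro ⟨a, b, h⟩
  rw [t0, halfPeriod] at h
  by_cases hm : 2 * m - N = 0
  · have hm' : (2 * m : ℂ) - N = 0 := by exact_mod_cast hm
    have hP : (p.x : ℂ) * (Real.pi / 2) + p.y * (Real.pi / 2 * p.ω) =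
        a * Real.pi + b * (Real.pi * p.ω) := by
      rw [← h]; linear_combination -(p.η / 2) * hm'
    have him := congrArg Complex.im hP
    have hre := congrArg Complex.re hP
    simp at him hre
    have hb : (p.y : ℝ) = 2 * b := by
      have h1 : (Real.pi * p.ω.im) * ((p.y : ℝ) - 2 * b) = 0 := by linarith
      have := (mul_eq_zero.1 h1).resolve_left (by positivity)
      linarith
    rw [hb] at hre
    have ha : (p.x : ℝ) = 2 * a := by
      have h1 : Real.pi * ((p.x : ℝ) - 2 * a) = 0 := by linarith
      have := (mul_eq_zero.1 h1).resolve_left (by positivity)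
      linarith
    have hb' : (p.y : ℤ) = 2 * b := by exact_mod_cast hb
    have ha' : (p.x : ℤ) = 2 * a := by exact_mod_cast ha
    have hN : Even N := by
      rw [← Int.even_coe_nat]
      exact ⟨m, by lia⟩
    exact hxy hN ⟨by lia, by lia⟩
  · refine hη _ hm ⟨2 * a - p.x, 2 * b - p.y, ?_⟩
    push_cast
    linear_combination 2 * h

theorem thY_reflect (hx : p.x ≤ 1) (hy : p.y ≤ 1) (z : ℂ) :
    p.thY (2 * p.halfPeriod - z) = -(-1) ^ (p.x + p.y + p.x * p.y) * p.thY z := by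
  rw [thY, thY, ← twistTheta_reflect hx hy]
  congr 1
  rw [halfPeriod]; ring

/-! ### Quadratic relations on the balanced sectors -/

/-- The entry `A(u)` of the monodromy matrix with dynamical shifts. -/
def opA (u : ℂ) : Op N := p.dynMonodromy u 0 0

/-- The entry `D(u)` of the monodromy matrix with dynamical shifts. -/
def opD (u : ℂ) : Op N := p.dynMonodromy u 1 1

theorem height_flip (m : ℤ) :
    p.height (-m) + p.η * (N - 2 * m) = 2 * p.halfPeriod - p.height (-m) := by
  simp only [height, t0]; push_cast; ring

theorem R_flip (hx : p.x ≤ 1) (hy : p.y ≤ 1) (u t : ℂ) (i k j l : Fin 2) :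
    p.R u (2 * p.halfPeriod - t) (i, k) (j, l) = p.R u t (1 - i, 1 - k) (1 - j, 1 - l) := by
  have e : ((-1 : ℂ)) ^ (p.x + p.y + p.x * p.y) ≠ 0 := pow_ne_zero _ (by norm_num)
  have h : ∀ z, p.thY (2 * p.halfPeriod - t + z) / p.thY (2 * p.halfPeriod - t) =
      p.thY (t - z) / p.thY t := fun z => by
    rw [show 2 * p.halfPeriod - t + z = 2 * p.halfPeriod - (t - z) by ring, p.thY_reflect hx hy,
      p.thY_reflect hx hy, mul_div_mul_left _ _ (neg_ne_zero.2 e)]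
  have hs : ∀ i : Fin 2, spinVal (1 - i) = -spinVal i := by
    intro i; fin_cases i <;> simp [spinVal_zero, spinVal_one]
  rw [R_apply, R_apply, h, h, hs]
  simp only [mul_neg, ← sub_eq_add_neg, sub_right_inj]

variable {p}

theorem opC_comm (hω : 0 < p.ω.im) (hη : p.IsGeneric) (hreg : p.IsRegular) (u v : ℂ) :
    p.opC u * p.opC v = p.opC v * p.opC u := by
  have key : ∀ u v, p.th (u - v + p.η) ≠ 0 → p.opC u * p.opC v = p.opC v * p.opC u := by
    intro u v h
    refine op_ext fun s => ?_
    have := p.rtt_ket hω hreg u v 1 1 0 0 (single_mem_sector s 1)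
    simp [R_apply, Fin.sum_univ_two, h] at this
    exact this
  by_cases h : p.th (u - v + p.η) = 0
  · refine (key v u fun h2 => ?_).symm
    have m1 : u - v + p.η ∈ lattice p.ω := by
      by_contra hc; exact theta_ne_zero hω hc h
    have m2 : v - u + p.η ∈ lattice p.ω := by
      by_contra hc; exact theta_ne_zero hω hc h2
    obtain ⟨a, b, h1⟩ := m1
    obtain ⟨c, d, h2⟩ := m2
    refine hη 2 two_ne_zero ⟨a + c, b + d, ?_⟩
    push_cast
    linear_combination h1 + h2
  · exact key u v h

theorem opB_comm (hω : 0 < p.ω.im) (hη : p.IsGeneric) (hreg : p.IsRegular) (u v : ℂ) :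
    p.opB u * p.opB v = p.opB v * p.opB u := by
  have key : ∀ u v, p.th (u - v + p.η) ≠ 0 → p.opB u * p.opB v = p.opB v * p.opB u := by
    intro u v h
    refine op_ext fun s => ?_
    have := p.rtt_ket hω hreg u v 0 0 1 1 (single_mem_sector s 1)
    simp [R_apply, Fin.sum_univ_two, h] at this
    exact this
  by_cases h : p.th (u - v + p.η) = 0
  · refine (key v u fun h2 => ?_).symm
    have m1 : u - v + p.η ∈ lattice p.ω := by
      by_contra hc; exact theta_ne_zero hω hc h
    have m2 : v - u + p.η ∈ lattice p.ω := by
      by_contra hc; exact theta_ne_zero hω hc h2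
    obtain ⟨a, b, h1⟩ := m1
    obtain ⟨c, d, h2⟩ := m2
    refine hη 2 two_ne_zero ⟨a + c, b + d, ?_⟩
    push_cast
    linear_combination h1 + h2
  · exact key u v h

theorem opD_opC_apply (hω : 0 < p.ω.im) (hreg : p.IsRegular) (u v : ℂ) {m a : ℤ} {ψ : Ket N}
    (hψ : ψ ∈ sector N m a) :
    (p.th (u - v) * (p.thY (p.height a + p.η) / p.thY (p.height a))) • p.opD v (p.opC u ψ) +
      (p.th p.η * (p.thY (p.height a + (v - u)) / p.thY (p.height a))) • p.opC v (p.opD u ψ) =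
    p.th (u - v + p.η) • p.opC u (p.opD v ψ) := by
  have := p.rtt_ket hω hreg u v 1 1 0 1 hψ
  simp [R_apply, Fin.sum_univ_two, spinVal_zero, spinVal_one] at this
  exact this.symm

theorem opB_opC_apply (hω : 0 < p.ω.im) (hreg : p.IsRegular) (hx : p.x ≤ 1) (hy : p.y ≤ 1)
    (u v : ℂ) {m : ℤ} {ψ : Ket N} (hψ : ψ ∈ sector N m (-m)) :
    (p.th p.η * (p.thY (p.height (-m) + (u - v)) / p.thY (p.height (-m)))) •
        p.opA u (p.opD v ψ) +
      (p.th (u - v) * (p.thY (p.height (-m) + p.η) / p.thY (p.height (-m)))) •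
        p.opC u (p.opB v ψ) =
    (p.th (u - v) * (p.thY (p.height (-m) + p.η) / p.thY (p.height (-m)))) •
        p.opB v (p.opC u ψ) +
      (p.th p.η * (p.thY (p.height (-m) + (v - u)) / p.thY (p.height (-m)))) •
        p.opA v (p.opD u ψ) := by
  have := p.rtt_ket hω hreg u v 1 0 0 1 hψ
  rw [spinVal_one, spinVal_zero, neg_add_cancel, mul_zero, sub_zero, height_flip] at this
  simp only [Fin.sum_univ_two, p.R_flip hx hy] at this
  simp [R_apply, spinVal_zero, spinVal_one] at this
  exact this

theorem height_ne_zero (hreg : p.IsRegular) (a : ℤ) : p.thY (p.height a) ≠ 0 := by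
  have := hreg (-a)
  rwa [show p.t0 + p.η * ((-a : ℤ) : ℂ) = p.height a by simp only [height]; push_cast; ring] at this

theorem height_add_eta_ne_zero (hreg : p.IsRegular) (a : ℤ) : p.thY (p.height a + p.η) ≠ 0 := by
  have := height_ne_zero hreg (a - 1)
  rwa [show p.height (a - 1) = p.height a + p.η by simp only [height]; push_cast; ring] at this

theorem height_sub_eta_ne_zero (hreg : p.IsRegular) (a : ℤ) : p.thY (p.height a - p.η) ≠ 0 := by
  have := height_ne_zero hreg (a + 1)
  rwa [show p.height (a + 1) = p.height a - p.η by simp only [height]; push_cast; ring] at this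

theorem transfer_comm_apply (hω : 0 < p.ω.im) (hη : p.IsGeneric) (hreg : p.IsRegular)
    (hx : p.x ≤ 1) (hy : p.y ≤ 1) (κ : ℂ) {u v : ℂ} (huv : p.th (u - v) ≠ 0) {m : ℤ}
    {ψ : Ket N} (hψ : ψ ∈ sector N m (-m)) :
    p.transfer κ u (p.transfer κ v ψ) = p.transfer κ v (p.transfer κ u ψ) := by
  have h1 := opB_opC_apply hω hreg hx hy u v hψ
  have h2 := opB_opC_apply hω hreg hx hy v u hψ
  have hB : p.opB u (p.opB v ψ) = p.opB v (p.opB u ψ) :=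
    congrArg (fun X : Op N => X ψ) (opB_comm hω hη hreg u v)
  have hC : p.opC u (p.opC v ψ) = p.opC v (p.opC u ψ) :=
    congrArg (fun X : Op N => X ψ) (opC_comm hω hη hreg u v)
  rw [show v - u = -(u - v) by ring, p.th_neg] at h2
  rw [show v - u = -(u - v) by ring] at h1
  have h3 : p.opC u (p.opB v ψ) + p.opB u (p.opC v ψ) =
      p.opC v (p.opB u ψ) + p.opB v (p.opC u ψ) := by
    have hβ : p.th (u - v) * (p.thY (p.height (-m) + p.η) / p.thY (p.height (-m))) ≠ 0 :=
      mul_ne_zero huv (div_ne_zero (height_add_eta_ne_zero hreg _) (height_ne_zero hreg _))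
    refine smul_right_injective _ hβ ?_
    simp only
    linear_combination (norm := module) h1 + h2
  simp only [transfer, LinearMap.add_apply, LinearMap.smul_apply, map_add, map_smul, hB, hC]
  linear_combination (norm := module) (κ⁻¹ * κ) • h3

theorem opD_opC_dual (hω : 0 < p.ω.im) (hreg : p.IsRegular) (u v : ℂ) {m a : ℤ} {φ : Bra N}
    (hφ : φ ∈ braSector N m a) :
    p.th (u - v + p.η) • (p.opC v).dualMap ((p.opD u).dualMap φ) =
      (p.th p.η * (p.thY (p.height a + (u - v)) / p.thY (p.height a))) •
        (p.opC u).dualMap ((p.opD v).dualMap φ) +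
      (p.th (u - v) * (p.thY (p.height a - p.η) / p.thY (p.height a))) •
        (p.opD u).dualMap ((p.opC v).dualMap φ) := by
  have := p.rtt_bra hω hreg u v 1 1 1 0 hφ
  simp [R_apply, Fin.sum_univ_two, spinVal_zero, spinVal_one] at this
  exact this

theorem opB_opC_dual (hω : 0 < p.ω.im) (hreg : p.IsRegular) (hx : p.x ≤ 1) (hy : p.y ≤ 1)
    (u v : ℂ) {m : ℤ} {φ : Bra N} (hφ : φ ∈ braSector N m (-m)) :
    (p.th (u - v) * (p.thY (p.height (-m) - p.η) / p.thY (p.height (-m)))) •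
        (p.opC v).dualMap ((p.opB u).dualMap φ) +
      (p.th p.η * (p.thY (p.height (-m) + (v - u)) / p.thY (p.height (-m)))) •
        (p.opA v).dualMap ((p.opD u).dualMap φ) =
    (p.th p.η * (p.thY (p.height (-m) + (u - v)) / p.thY (p.height (-m)))) •
        (p.opA u).dualMap ((p.opD v).dualMap φ) +
    (p.th (u - v) * (p.thY (p.height (-m) - p.η) / p.thY (p.height (-m)))) •
        (p.opB u).dualMap ((p.opC v).dualMap φ) := by
  have := p.rtt_bra hω hreg u v 0 1 1 0 hφ
  rw [spinVal_one, spinVal_zero, neg_add_cancel, mul_zero, add_zero, height_flip] at this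
  simp only [Fin.sum_univ_two, p.R_flip hx hy] at this
  simp [R_apply, spinVal_zero, spinVal_one] at this
  exact this

theorem transfer_comm_dual (hω : 0 < p.ω.im) (hη : p.IsGeneric) (hreg : p.IsRegular)
    (hx : p.x ≤ 1) (hy : p.y ≤ 1) (κ : ℂ) {u v : ℂ} (huv : p.th (u - v) ≠ 0) {m : ℤ}
    {φ : Bra N} (hφ : φ ∈ braSector N m (-m)) :
    (p.transfer κ u).dualMap ((p.transfer κ v).dualMap φ) =
      (p.transfer κ v).dualMap ((p.transfer κ u).dualMap φ) := by
  have h1 := opB_opC_dual hω hreg hx hy u v hφ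
  have h2 := opB_opC_dual hω hreg hx hy v u hφ
  have hB : (p.opB u).dualMap ((p.opB v).dualMap φ) = (p.opB v).dualMap ((p.opB u).dualMap φ) :=
    congrArg (fun X : Op N => X.dualMap φ) (opB_comm hω hη hreg v u)
  have hC : (p.opC u).dualMap ((p.opC v).dualMap φ) = (p.opC v).dualMap ((p.opC u).dualMap φ) :=
    congrArg (fun X : Op N => X.dualMap φ) (opC_comm hω hη hreg v u)
  rw [show v - u = -(u - v) by ring, p.th_neg] at h2
  rw [show v - u = -(u - v) by ring] at h1
  have h3 : (p.opC v).dualMap ((p.opB u).dualMap φ) + (p.opB v).dualMap ((p.opC u).dualMap φ) =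
      (p.opB u).dualMap ((p.opC v).dualMap φ) + (p.opC u).dualMap ((p.opB v).dualMap φ) := by
    have hβ : p.th (u - v) * (p.thY (p.height (-m) - p.η) / p.thY (p.height (-m))) ≠ 0 :=
      mul_ne_zero huv (div_ne_zero (height_sub_eta_ne_zero hreg _) (height_ne_zero hreg _))
    refine smul_right_injective _ hβ ?_
    simp only
    linear_combination (norm := module) h1 + h2
  have hT : ∀ (w : ℂ) (χ : Bra N), (p.transfer κ w).dualMap χ =
      κ⁻¹ • (p.opB w).dualMap χ + κ • (p.opC w).dualMap χ := fun w χ => by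
    ext x; simp [transfer]
  simp only [hT, map_add, map_smul, hB, hC]
  linear_combination (norm := module) -(κ⁻¹ * κ) • h3

end Model

theorem basisBra_single {N : ℕ} (h : Spins N) (a : ℤ) (s : Spins N × ℤ) (x : ℂ) :
    basisBra h a (Finsupp.single s x) = if s = (h, a) then x else 0 := by
  rw [basisBra, Finsupp.lapply_apply, Finsupp.single_apply]

theorem dualMap_shiftOp_basisBra {N : ℕ} (e : ℤ) (h : Spins N) (a : ℤ) :
    (shiftOp e).dualMap (basisBra h a) = basisBra h (a - e) := by
  refine bra_ext fun ⟨s, b⟩ => ?_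
  rw [LinearMap.dualMap_apply, shiftOp_single, basisBra_single, basisBra_single]
  simp only [Prod.mk.injEq, eq_sub_iff_add_eq]

theorem dualMap_sum_mul {N : ℕ} (X Y : Fin 2 → Op N) (φ : Bra N) :
    (∑ l, X l * Y l).dualMap φ = ∑ l, (Y l).dualMap ((X l).dualMap φ) := by
  ext x
  simp

theorem filter_lt_succ {N : ℕ} (k : Fin N) :
    Finset.univ.filter (fun m : Fin N => m.val < k + 1) =
      insert k (Finset.univ.filter (fun m : Fin N => m.val < k)) := by
  ext m
  simp [Fin.ext_iff]
  lia

theorem prod_filter_lt_succ {N : ℕ} (k : Fin N) (f : Fin N → ℂ) :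
    ∏ m ∈ Finset.univ.filter (fun m : Fin N => m.val < k + 1), f m =
      f k * ∏ m ∈ Finset.univ.filter (fun m : Fin N => m.val < k), f m := by
  rw [filter_lt_succ, Finset.prod_insert (by simp)]

theorem prod_filter_lt_last {N : ℕ} (f : Fin N → ℂ) :
    ∏ m ∈ Finset.univ.filter (fun m : Fin N => m.val < N), f m = ∏ m, f m := by
  congr 1; ext m; simp

theorem list_prod_update {M ι : Type*} [Monoid M] {f g : ι → M} {X : M} {n : ι} {l : List ι}
    (hl : l.Nodup) (hn : n ∈ l) (hfg : ∀ m, m ≠ n → g m = f m) (hf : f n = 1) (hg : g n = X)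
    (hc : ∀ m, Commute X (f m)) : (l.map g).prod = X * (l.map f).prod := by
  induction l with
  | nil => simp at hn
  | cons a l ih =>
    rw [List.nodup_cons] at hl
    rw [List.map_cons, List.map_cons, List.prod_cons, List.prod_cons]
    by_cases ha : a = n
    · subst ha
      have : l.map g = l.map f := List.map_congr_left fun m hm => hfg m fun h => hl.1 (h ▸ hm)
      rw [this, hf, hg, one_mul]
    · rw [ih hl.2 ((List.mem_cons.1 hn).resolve_left (Ne.symm ha)), hfg a ha, ← mul_assoc,
        ← mul_assoc, (hc a).eq]

namespace Model

variable {N : ℕ} {p : Model N}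

/-! ### The monodromy matrix on basis covectors -/

theorem dualMap_laxAt_basisBra (n : Fin N) (u c : ℂ) (i l : Fin 2) (h : Spins N) (a : ℤ) :
    (p.laxAt n u c i l).dualMap (basisBra h a) =
      ∑ q, p.R (u - p.ξ n) (p.partialHeight n (h, a) + c) (i, h n) (l, q) •
        basisBra (Function.update h n q) a := by
  refine bra_ext fun ⟨s, b⟩ => ?_
  rw [LinearMap.dualMap_apply, laxAt_single, map_sum]
  simp only [LinearMap.sum_apply, LinearMap.smul_apply, basisBra_single, Prod.mk.injEq, smul_eq_mul]
  by_cases hs : ∃ q, s = Function.update h n q ∧ b = a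
  · obtain ⟨q, rfl, rfl⟩ := hs
    rw [Finset.sum_eq_single (h n), Finset.sum_eq_single q]
    · simp [p.partialHeight_update_of_le le_rfl]
    · intro q' _ hq
      rw [if_neg, mul_zero]
      rintro ⟨h1, -⟩
      exact hq (Function.update_injective _ _ h1).symm
    · simp
    · intro q' _ hq
      rw [if_neg]
      rintro ⟨h1, -⟩
      apply hq
      rw [← h1]; simp
    · simp
  · rw [Finset.sum_eq_zero, Finset.sum_eq_zero]
    · intro q _
      rw [if_neg (fun hh => hs ⟨q, hh⟩), mul_zero]
    · intro k _
      rw [if_neg]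
      rintro ⟨h1, h2⟩
      refine hs ⟨s n, ?_, h2⟩
      rw [← h1]; simp

theorem dualMap_partialDyn_same (u : ℂ) (h : Spins N) (a : ℤ) (r j : Fin 2) {k : ℕ} (hk : k ≤ N)
    (hr : ∀ m : Fin N, m.val < k → h m = r) :
    (p.partialDyn k u r j).dualMap (basisBra h a) = if j = r then
      (∏ m ∈ Finset.univ.filter (fun m : Fin N => m.val < k), p.wa (u - p.ξ m)) •
        basisBra h (a - (1 - 2 * ((r : ℕ) : ℤ))) else 0 := by
  induction k with
  | zero =>
    rw [partialDyn_zero, shiftMatrix_apply]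
    by_cases hj : j = r
    · rw [if_pos hj.symm, if_pos hj, dualMap_shiftOp_basisBra, hj]; simp
    · rw [if_neg (Ne.symm hj), if_neg hj]; rfl
  | succ k ih =>
    obtain ⟨n, rfl⟩ : ∃ n : Fin N, n.val = k := ⟨⟨k, hk⟩, rfl⟩
    have hn : h n = r := hr n (Nat.lt_succ_self _)
    have := ih n.isLt.le fun m hm => hr m (by lia)
    rw [partialDyn_succ, dualMap_sum_mul, Finset.sum_eq_single r, dualMap_laxAt_basisBra,
      Finset.sum_eq_single r]
    · rw [hn, ← hn, Function.update_eq_self, hn, map_smul, this, prod_filter_lt_succ, R_apply]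
      simp [wa, smul_smul]
    · intro q _ hq
      rw [R_apply]; simp [hn, hq]
    · simp
    · intro l _ hl
      rw [dualMap_laxAt_basisBra]
      simp [R_apply, hn, hl]
    · simp

theorem dualMap_partialDyn_opposite (hreg : p.IsRegular) (u : ℂ) (h : Spins N) (a : ℤ)
    {r r' : Fin 2} (hrr : r' ≠ r) {k : ℕ} (hk : k ≤ N) (hr : ∀ m : Fin N, m.val < k → h m = r) :
    (p.partialDyn k u r' r').dualMap (basisBra h a) =
      ((∏ m ∈ Finset.univ.filter (fun m : Fin N => m.val < k), p.th (u - p.ξ m)) *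
        (p.thY (p.height a - p.η * spinVal r) /
          p.thY (p.height a + p.η * spinVal r * k - p.η * spinVal r))) •
        basisBra h (a - (1 - 2 * ((r' : ℕ) : ℤ))) := by
  have hs : spinVal r' = -spinVal r := by
    fin_cases r <;> fin_cases r' <;> simp_all [spinVal_zero, spinVal_one]
  induction k with
  | zero =>
    rw [partialDyn_zero, shiftMatrix_apply, if_pos rfl, dualMap_shiftOp_basisBra]
    have : p.thY (p.height a - p.η * spinVal r) ≠ 0 := by
      rw [sub_eq_add_neg, ← mul_neg, ← hs, ← p.partialHeight_zero (h, a)]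
      exact hreg.partialHeight_add_ne_zero _ _ _
    simp [div_self this]
  | succ k ih =>
    obtain ⟨n, rfl⟩ : ∃ n : Fin N, n.val = k := ⟨⟨k, hk⟩, rfl⟩
    have hn : h n = r := hr n (Nat.lt_succ_self _)
    have hph : p.partialHeight n (h, a) = p.height a + p.η * spinVal r * n := by
      have : ∑ m ∈ Finset.univ.filter (fun m : Fin N => m.val < n), spinVal (h m) =
          n * spinVal r := by
        rw [Finset.sum_congr rfl (g := fun _ => spinVal r) fun m hm => by
          rw [hr m ((Finset.mem_filter.1 hm).2.trans (Nat.lt_succ_self _))]]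
        have hc : Finset.univ.filter (fun m : Fin N => m < n) = Finset.Iio n := by ext; simp
        simp [hc]
      rw [partialHeight, this]
      ring
    have h0 : p.thY (p.height a + p.η * spinVal r * n - p.η * spinVal r) ≠ 0 := by
      rw [← hph, sub_eq_add_neg, ← mul_neg, ← hs]
      exact hreg.partialHeight_add_ne_zero _ _ _
    have := ih n.isLt.le fun m hm => hr m (by lia)
    rw [partialDyn_succ, dualMap_sum_mul, Finset.sum_eq_single r', dualMap_laxAt_basisBra,
      Finset.sum_eq_single r]
    · nth_rewrite 2 [← hn]
      rw [Function.update_eq_self, map_smul, this, prod_filter_lt_succ, R_apply, hn, if_neg hrr,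
        if_neg hrr, if_pos rfl, smul_smul, add_zero, hs, hph]
      congr 1
      push_cast
      rw [show p.height a + p.η * spinVal r * n + p.η * -spinVal r =
        p.height a + p.η * spinVal r * n - p.η * spinVal r by ring,
        show p.height a + p.η * spinVal r * (n + 1) - p.η * spinVal r =
          p.height a + p.η * spinVal r * n by ring]
      field_simp
    · intro q _ hq
      have hq' : r' = q := by
        fin_cases r <;> fin_cases r' <;> fin_cases q <;> simp_all
      rw [R_apply, hn, if_neg hrr, if_pos hq', zero_smul]
    · simp
    · intro l _ hl
      have hl' : l = r := by
        fin_cases r <;> fin_cases r' <;> fin_cases l <;> simp_all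
      rw [dualMap_laxAt_basisBra, map_sum]
      refine Finset.sum_eq_zero fun q _ => ?_
      rw [map_smul, hl', dualMap_partialDyn_same u _ a r r' n.isLt.le, if_neg hrr, smul_zero]
      intro m hm
      rw [Function.update_of_ne (by rintro rfl; exact lt_irrefl _ hm)]
      exact hr m (by lia)
    · simp

theorem dualMap_partialDyn_flip (hreg : p.IsRegular) (n : Fin N) (h : Spins N) (a : ℤ) {k : ℕ}
    (hnk : n < k) (hk : k ≤ N) (h0 : ∀ m : Fin N, m ≤ n → h m = 0)
    (h1 : ∀ m : Fin N, n < m → m.val < k → h m = 1) :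
    (p.partialDyn k (p.ξ n) 1 0).dualMap (basisBra h a) =
      (∏ m ∈ Finset.univ.filter (fun m : Fin N => m.val < k), p.wa (p.ξ n - p.ξ m)) •
        basisBra (Function.update h n 1) (a - 1) := by
  induction k, hnk using Nat.le_induction with
  | base =>
    have hn : h n = 0 := h0 n le_rfl
    rw [Nat.succ_eq_add_one, partialDyn_succ, dualMap_sum_mul, Fin.sum_univ_two,
      dualMap_laxAt_basisBra, dualMap_laxAt_basisBra]
    simp only [Fin.sum_univ_two, R_apply, hn, sub_self]
    simp only [one_ne_zero, if_false, th_zero, zero_mul, zero_smul, add_zero, zero_add, if_true,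
      map_smul, zero_ne_one, map_zero]
    rw [dualMap_partialDyn_same _ _ a 0 0 n.isLt.le, if_pos rfl, prod_filter_lt_succ,
      div_self (hreg.partialHeight_ne_zero _ _), wa, sub_self, zero_add, mul_one, smul_smul]
    · simp
    · intro m hm
      rw [Function.update_of_ne (by rintro rfl; exact lt_irrefl _ hm)]
      exact h0 m (Fin.le_def.2 (by lia))
  | succ k hnk ih =>
    obtain ⟨m, rfl⟩ : ∃ m : Fin N, m.val = k := ⟨⟨k, hk⟩, rfl⟩
    have hm : h m = 1 := h1 m (Fin.lt_def.2 (by lia)) (by lia)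
    rw [partialDyn_succ, dualMap_sum_mul, Fin.sum_univ_two, dualMap_laxAt_basisBra,
      dualMap_laxAt_basisBra]
    simp only [Fin.sum_univ_two, R_apply, hm]
    simp only [zero_ne_one, if_true, if_false, false_and, and_false, true_and, zero_smul, add_zero,
      zero_add, map_zero, map_smul]
    have hu : Function.update h m 1 = h := by rw [← hm, Function.update_eq_self]
    rw [hu, ih m.isLt.le fun q hq hq' => h1 q hq (by lia),
      prod_filter_lt_succ, smul_smul, wa]

end Model

/-! ### Induction on spin configurations -/

theorem Spins.induction_lower {N : ℕ} {P : Spins N → Prop} (h1 : P fun _ => 1)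
    (hs : ∀ h n, h n = 1 → P h → P (Function.update h n 0)) (h : Spins N) : P h := by
  obtain ⟨k, hk⟩ : ∃ k, (Finset.univ.filter fun n => h n = 0).card = k := ⟨_, rfl⟩
  induction k generalizing h with
  | zero =>
    have : h = fun _ => 1 := by
      funext n
      have : h n ≠ 0 := fun hn => by
        rw [Finset.card_eq_zero, Finset.filter_eq_empty_iff] at hk
        exact hk (Finset.mem_univ n) hn
      lia
    rwa [this]
  | succ k ih =>
    obtain ⟨n, hn⟩ := Finset.card_pos.1 (by rw [hk]; exact Nat.succ_pos k : 0 < (Finset.univ.filter fun n => h n = 0).card)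
    have hn0 : h n = 0 := by simpa using hn
    have h2 := hs (Function.update h n 1) n (by simp) (ih _ ?_)
    · rwa [Function.update_idem, ← hn0, Function.update_eq_self] at h2
    · have : (Finset.univ.filter fun m => Function.update h n 1 m = 0) =
          (Finset.univ.filter fun m => h m = 0).erase n := by
        ext m
        by_cases hm : m = n
        · subst hm; simp
        · simp [hm]
      rw [this, Finset.card_erase_of_mem hn, hk, Nat.add_sub_cancel]

theorem Spins.induction_raise {N : ℕ} {P : Spins N → Prop} (h0 : P fun _ => 0)
    (hs : ∀ h n, h n = 0 → P h → P (Function.update h n 1)) (h : Spins N) : P h := by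
  have key := Spins.induction_lower (P := fun h => P fun n => 1 - h n) (by simpa using h0)
    (fun h n hn hP => by
      have := hs _ n (by simp [hn]) hP
      convert this using 1
      funext m
      by_cases hm : m = n
      · subst hm; simp
      · simp [hm]) fun n => 1 - h n
  simpa using key

namespace Model

variable {N : ℕ} {p : Model N}

theorem th_xi_sub_ne_zero (hω : 0 < p.ω.im) (hξ : p.InhomogeneityCondition) {a b : Fin N}
    (hab : a ≠ b) : p.th (p.ξ a - p.ξ b) ≠ 0 := by
  have := hξ a b hab 0 (by simp)
  rw [Int.cast_zero, zero_mul, add_zero] at this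
  exact theta_ne_zero hω this

theorem th_xi_sub_add_ne_zero (hω : 0 < p.ω.im) (hξ : p.InhomogeneityCondition) {a b : Fin N}
    (hab : a ≠ b) : p.th (p.ξ a - p.ξ b + p.η) ≠ 0 := by
  have := hξ a b hab 1 (by simp)
  rw [Int.cast_one, one_mul] at this
  exact theta_ne_zero hω this

theorem th_xi_sub_sub_ne_zero (hω : 0 < p.ω.im) (hξ : p.InhomogeneityCondition) {a b : Fin N}
    (hab : a ≠ b) : p.th (p.ξ a - p.ξ b - p.η) ≠ 0 := by
  have := hξ a b hab (-1) (by simp)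
  rw [Int.cast_neg, Int.cast_one, neg_one_mul, ← sub_eq_add_neg] at this
  exact theta_ne_zero hω this

theorem aFun_xi_ne_zero (hω : 0 < p.ω.im) (hη : p.IsGeneric) (hξ : p.InhomogeneityCondition)
    (n : Fin N) : p.aFun (p.ξ n) ≠ 0 := by
  rw [aFun, Finset.prod_ne_zero_iff]
  intro m _
  by_cases h : n = m
  · rw [h, wa, sub_self, zero_add]; exact hη.th_ne_zero hω
  · exact th_xi_sub_add_ne_zero hω hξ h

theorem dFun_apply (u : ℂ) : p.dFun u = ∏ n, p.th (u - p.ξ n) := by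
  rw [dFun, aFun]
  refine Finset.prod_congr rfl fun n _ => ?_
  rw [wa]; congr 1; ring

theorem dFun_xi (n : Fin N) : p.dFun (p.ξ n) = 0 := by
  rw [dFun_apply]
  exact Finset.prod_eq_zero (Finset.mem_univ n) (by rw [sub_self, th_zero])

theorem aFun_xi_sub (n : Fin N) : p.aFun (p.ξ n - p.η) = 0 := dFun_xi n

theorem dFun_xi_sub_ne_zero (hω : 0 < p.ω.im) (hη : p.IsGeneric) (hξ : p.InhomogeneityCondition)
    (n : Fin N) : p.dFun (p.ξ n - p.η) ≠ 0 := by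
  rw [dFun_apply, Finset.prod_ne_zero_iff]
  intro m _
  by_cases h : n = m
  · rw [h, sub_right_comm, sub_self, zero_sub, th_neg, neg_ne_zero]; exact hη.th_ne_zero hω
  · rw [sub_right_comm]; exact th_xi_sub_sub_ne_zero hω hξ h

/-! ### The separate basis of kets -/

theorem smul_opC_commute (hω : 0 < p.ω.im) (hη : p.IsGeneric) (hreg : p.IsRegular) (u v c d : ℂ)
    (i : ℕ) : Commute (c • p.opC u) ((d • p.opC v) ^ i) := by
  refine Commute.pow_right ?_ i
  exact ((show Commute (p.opC u) (p.opC v) from opC_comm hω hη hreg u v).smul_left c).smul_right d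

theorem sovKet_update (hω : 0 < p.ω.im) (hη : p.IsGeneric) (hreg : p.IsRegular) (nrm : ℂ)
    {h : Spins N} {n : Fin N} (hn : h n = 1) : p.sovKet nrm 0 (Function.update h n 0) =
      (p.dFun (p.ξ n - p.η))⁻¹ • p.opC (p.ξ n - p.η) (p.sovKet nrm 0 h) := by
  rw [sovKet, sovKet, list_prod_update (List.nodup_finRange N) (List.mem_finRange n)
    (f := fun m => ((p.dFun (p.ξ m - p.η))⁻¹ • p.opC (p.ξ m - p.η)) ^ (1 - (h m : ℕ)))
    (X := (p.dFun (p.ξ n - p.η))⁻¹ • p.opC (p.ξ n - p.η))]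
  · rfl
  · intro m hm; rw [Function.update_of_ne hm]
  · simp [hn]
  · simp
  · intro m; exact smul_opC_commute hω hη hreg _ _ _ _ _

theorem sovKet_one (nrm : ℂ) : p.sovKet nrm 0 (fun _ => 1) =
    nrm⁻¹ • basisKet (fun _ => 1) (-(N : ℤ)) := by
  have : ((List.finRange N).map fun n => ((p.dFun (p.ξ n - p.η))⁻¹ • p.opC (p.ξ n - p.η)) ^
      (1 - ((1 : Fin 2) : ℕ))).prod = 1 := by
    simp
  rw [sovKet, this]
  simp [heightIndex]

theorem weight_one : weight (fun _ : Fin N => (1 : Fin 2)) = N := by simp [weight]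

theorem weight_zero : weight (fun _ : Fin N => (0 : Fin 2)) = 0 := by simp [weight]

theorem opC_mem_sector (u : ℂ) {m : ℤ} {ψ : Ket N} (hψ : ψ ∈ sector N m (-m)) :
    p.opC u ψ ∈ sector N (m - 1) (-(m - 1)) := by
  have := p.dynMonodromy_mem_sector u 1 0 hψ
  rw [opC, show m - 1 = m + ((0 : Fin 2) : ℕ) - ((1 : Fin 2) : ℕ) by simp]
  convert this using 1
  simp
  ring_nf

theorem opB_mem_sector (u : ℂ) {m : ℤ} {ψ : Ket N} (hψ : ψ ∈ sector N m (-m)) :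
    p.opB u ψ ∈ sector N (m + 1) (-(m + 1)) := by
  have := p.dynMonodromy_mem_sector u 0 1 hψ
  rw [opB, show m + 1 = m + ((1 : Fin 2) : ℕ) - ((0 : Fin 2) : ℕ) by simp]
  convert this using 1
  simp
  ring_nf

theorem weight_update_zero {h : Spins N} {n : Fin N} (hn : h n = 1) :
    weight (Function.update h n 0) = weight h - 1 := by
  rw [weight_update, hn]; simp

theorem weight_update_one {h : Spins N} {n : Fin N} (hn : h n = 0) :
    weight (Function.update h n 1) = weight h + 1 := by
  rw [weight_update, hn]; simp

theorem sovKet_mem_sector (hω : 0 < p.ω.im) (hη : p.IsGeneric) (hreg : p.IsRegular) (nrm : ℂ)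
    (h : Spins N) : p.sovKet nrm 0 h ∈ sector N (weight h) (-weight h) := by
  induction h using Spins.induction_lower with
  | h1 =>
    rw [sovKet_one, weight_one]
    refine Submodule.smul_mem _ _ ?_
    have := single_mem_sector (N := N) (fun _ => 1, -(N : ℤ)) 1
    rwa [weight_one] at this
  | hs h n hn ih =>
    rw [sovKet_update hω hη hreg nrm hn, weight_update_zero hn]
    exact Submodule.smul_mem _ _ (opC_mem_sector _ ih)

theorem sector_eq_span {s : Spins N × ℤ} {m a : ℤ} (h : ∀ t : Spins N, weight t = m → t = s.1)
    (ha : a = s.2) {v : Ket N} (hv : v ∈ sector N m a) : v = v s • Finsupp.single s 1 := by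
  ext t
  simp only [Finsupp.smul_apply, Finsupp.single_apply, smul_eq_mul]
  split_ifs with hst
  · rw [hst, mul_one]
  · rw [mul_zero]
    by_contra hne
    have := hv (Finsupp.mem_support_iff.2 hne)
    exact hst (Prod.ext (h _ this.1).symm (by rw [this.2, ha]))

theorem weight_le (h : Spins N) : weight h ≤ N := by
  have : weight h ≤ ∑ _k : Fin N, (1 : ℤ) := Finset.sum_le_sum fun k _ => by
    have := (h k).isLt
    lia
  simpa using this

theorem weight_nonneg (h : Spins N) : 0 ≤ weight h := Finset.sum_nonneg fun k _ => by lia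

theorem eq_one_of_weight (h : Spins N) (hw : weight h = N) : h = fun _ => 1 := by
  funext n
  by_contra hn
  have hn : h n = 0 := by lia
  have := weight_le (Function.update h n 1)
  rw [weight_update_one hn] at this
  lia

theorem eq_zero_of_mem_sector {m a : ℤ} (hm : m < 0 ∨ N < m) {v : Ket N} (hv : v ∈ sector N m a) :
    v = 0 := by
  ext t
  by_contra hne
  have := (hv (Finsupp.mem_support_iff.2 hne)).1
  have h1 := weight_le t.1
  have h2 := weight_nonneg t.1
  lia

theorem eq_zero_of_mem_braSector {m a : ℤ} (hm : m < 0 ∨ N < m) {φ : Bra N}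
    (hφ : φ ∈ braSector N m a) : φ = 0 := by
  refine bra_ext fun s => hφ s fun h => ?_
  have h1 := weight_le s.1
  have h2 := weight_nonneg s.1
  lia

theorem basisBra_dynMonodromy (u : ℂ) (i j : Fin 2) (h : Spins N) (a : ℤ) (v : Ket N) :
    p.dynMonodromy u i j v (h, a) = (p.partialDyn N u i j).dualMap (basisBra h a) v := by
  rw [partialDyn_last]; rfl

theorem opD_basisKet_one (u : ℂ) (a : ℤ) :
    p.opD u (basisKet (fun _ => 1) a) = p.aFun u • basisKet (fun _ => 1) (a - 1) := by
  have hm := p.dynMonodromy_mem_sector u 1 1 (single_mem_sector (N := N) (fun _ => 1, a) 1)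
  rw [weight_one] at hm
  have := sector_eq_span (s := (fun _ => 1, a - 1)) (fun t ht => eq_one_of_weight t (by simpa using ht))
    (by simp; ring) hm
  rw [opD, basisKet, this, basisBra_dynMonodromy, dualMap_partialDyn_same _ _ _ _ _ le_rfl
    (fun _ _ => rfl), if_pos rfl, prod_filter_lt_last, LinearMap.smul_apply, basisBra_single]
  simp [aFun, basisKet, sub_eq_add_neg]

theorem opA_basisKet_one (hreg : p.IsRegular) (hx : p.x ≤ 1) (hy : p.y ≤ 1) (u : ℂ) :
    p.opA u (basisKet (fun _ => 1) (-(N : ℤ))) =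
      (-(-1) ^ (p.x + p.y + p.x * p.y) * p.dFun u) • basisKet (fun _ => 1) (-(N : ℤ) + 1) := by
  have hm := p.dynMonodromy_mem_sector u 0 0 (single_mem_sector (N := N) (fun _ => 1, -(N : ℤ)) 1)
  rw [weight_one] at hm
  have := sector_eq_span (s := (fun _ => 1, -(N : ℤ) + 1))
    (fun t ht => eq_one_of_weight t (by simpa using ht)) (by simp) hm
  have ht0 : p.thY p.t0 ≠ 0 := by simpa using hreg 0
  have e : p.thY (p.t0 + p.η * N) = -(-1) ^ (p.x + p.y + p.x * p.y) * p.thY p.t0 := by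
    rw [← p.thY_reflect hx hy, t0]; congr 1; ring
  rw [opA, basisKet, this, basisBra_dynMonodromy, dualMap_partialDyn_opposite hreg _ _ _ (r := 1)
    (r' := 0) zero_ne_one le_rfl (fun _ _ => rfl), prod_filter_lt_last, LinearMap.smul_apply,
    basisBra_single, basisKet, if_pos (by simp), dFun_apply, spinVal_one]
  congr 1
  rw [show p.height (-(N : ℤ) + 1) - p.η * -1 = p.t0 + p.η * N by
      simp only [height]; push_cast; ring,
    show p.height (-(N : ℤ) + 1) + p.η * -1 * N - p.η * -1 = p.t0 by
      simp only [height]; push_cast; ring, e, smul_eq_mul, mul_one]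
  field_simp

theorem dualMap_opA_basisBra_zero (u : ℂ) (a : ℤ) :
    (p.opA u).dualMap (basisBra (fun _ => 0) a) = p.aFun u • basisBra (fun _ => 0) (a - 1) := by
  rw [opA, ← partialDyn_last, dualMap_partialDyn_same _ _ _ _ _ le_rfl
    (fun _ _ => rfl), if_pos rfl, prod_filter_lt_last]
  simp [aFun]

theorem dualMap_opD_basisBra_zero (hreg : p.IsRegular) (u : ℂ) (a : ℤ) :
    (p.opD u).dualMap (basisBra (fun _ => 0) a) = (p.dFun u * (p.thY (p.height a - p.η) /
      p.thY (p.height a + p.η * N - p.η))) • basisBra (fun _ => 0) (a + 1) := by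
  rw [opD, ← partialDyn_last, dualMap_partialDyn_opposite hreg _ _ _ (r := 0)
    (r' := 1) one_ne_zero le_rfl (fun _ _ => rfl), prod_filter_lt_last, dFun_apply, spinVal_zero]
  simp

/-! ### The action of the transfer matrix on the separate kets -/

theorem transfer_apply (κ u : ℂ) (ψ : Ket N) :
    p.transfer κ u ψ = κ⁻¹ • p.opB u ψ + κ • p.opC u ψ := rfl

theorem transfer_dual (κ u : ℂ) (φ : Bra N) : (p.transfer κ u).dualMap φ =
    κ⁻¹ • (p.opB u).dualMap φ + κ • (p.opC u).dualMap φ := by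
  ext x; simp [transfer]

theorem opD_sovKet (hω : 0 < p.ω.im) (hη : p.IsGeneric) (hreg : p.IsRegular)
    (hξ : p.InhomogeneityCondition) (nrm : ℂ) (h : Spins N) :
    ∀ n, h n = 1 → p.opD (p.ξ n - p.η) (p.sovKet nrm 0 h) = 0 := by
  induction h using Spins.induction_lower with
  | h1 =>
    intro n _
    rw [sovKet_one, map_smul, opD_basisKet_one, aFun_xi_sub, zero_smul, smul_zero]
  | hs h m hm ih =>
    intro n hn
    have hnm : m ≠ n := by
      rintro rfl
      rw [Function.update_self] at hn
      exact zero_ne_one hn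
    rw [Function.update_of_ne (Ne.symm hnm)] at hn
    have hrel := opD_opC_apply hω hreg (p.ξ m - p.η) (p.ξ n - p.η)
      (sovKet_mem_sector hω hη hreg nrm h)
    rw [ih n hn, ih m hm, map_zero, map_zero, smul_zero, smul_zero, add_zero] at hrel
    rw [sovKet_update hω hη hreg nrm hm, map_smul, (smul_eq_zero.1 hrel).resolve_left, smul_zero]
    refine mul_ne_zero ?_ (div_ne_zero (height_add_eta_ne_zero hreg _) (height_ne_zero hreg _))
    rw [sub_sub_sub_cancel_right]
    exact th_xi_sub_ne_zero hω hξ hnm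

theorem opB_sovKet (hω : 0 < p.ω.im) (hη : p.IsGeneric) (hreg : p.IsRegular)
    (hx : p.x ≤ 1) (hy : p.y ≤ 1) (hξ : p.InhomogeneityCondition) (nrm : ℂ) (h : Spins N) :
    ∀ n, h n = 1 → p.opB (p.ξ n - p.η) (p.sovKet nrm 0 h) = 0 := by
  induction h using Spins.induction_lower with
  | h1 =>
    intro n _
    have := opB_mem_sector (p := p) (p.ξ n - p.η) (sovKet_mem_sector hω hη hreg nrm fun _ => 1)
    exact eq_zero_of_mem_sector (by rw [weight_one]; right; lia) this
  | hs h m hm ih =>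
    intro n hn
    have hnm : m ≠ n := by
      rintro rfl
      rw [Function.update_self] at hn
      exact zero_ne_one hn
    rw [Function.update_of_ne (Ne.symm hnm)] at hn
    have hrel := opB_opC_apply hω hreg hx hy (p.ξ m - p.η) (p.ξ n - p.η)
      (sovKet_mem_sector hω hη hreg nrm h)
    rw [ih n hn, opD_sovKet hω hη hreg hξ nrm h n hn, opD_sovKet hω hη hreg hξ nrm h m hm,
      map_zero, map_zero, map_zero, smul_zero, smul_zero, smul_zero, add_zero, add_zero] at hrel
    rw [sovKet_update hω hη hreg nrm hm, map_smul, (smul_eq_zero.1 hrel.symm).resolve_left, smul_zero]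
    refine mul_ne_zero ?_ (div_ne_zero (height_add_eta_ne_zero hreg _) (height_ne_zero hreg _))
    rw [sub_sub_sub_cancel_right]
    exact th_xi_sub_ne_zero hω hξ hnm

theorem transfer_sovKet_one (hω : 0 < p.ω.im) (hη : p.IsGeneric) (hreg : p.IsRegular)
    (hx : p.x ≤ 1) (hy : p.y ≤ 1) (hξ : p.InhomogeneityCondition) (κ nrm : ℂ)
    {h : Spins N} {n : Fin N} (hn : h n = 1) :
    p.transfer κ (p.ξ n - p.η) (p.sovKet nrm 0 h) =
      (κ * p.dFun (p.ξ n - p.η)) • p.sovKet nrm 0 (Function.update h n 0) := by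
  rw [transfer_apply, opB_sovKet hω hη hreg hx hy hξ nrm h n hn, smul_zero, zero_add,
    sovKet_update hω hη hreg nrm hn, smul_smul, mul_assoc,
    mul_inv_cancel₀ (dFun_xi_sub_ne_zero hω hη hξ n), mul_one]

theorem transfer_transfer_sovKet (hω : 0 < p.ω.im) (hη : p.IsGeneric) (hreg : p.IsRegular)
    (hx : p.x ≤ 1) (hy : p.y ≤ 1) (hξ : p.InhomogeneityCondition) {κ : ℂ} (hκ : κ ≠ 0) (nrm : ℂ)
    (h : Spins N) : ∀ n, h n = 1 →
    p.transfer κ (p.ξ n) (p.transfer κ (p.ξ n - p.η) (p.sovKet nrm 0 h)) =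
      (p.aXY (p.ξ n) * p.dFun (p.ξ n - p.η)) • p.sovKet nrm 0 h := by
  induction h using Spins.induction_lower with
  | h1 =>
    intro n _
    have hB := opB_sovKet hω hη hreg hx hy hξ nrm (fun _ => 1) n rfl
    have hC : p.opC (p.ξ n) (p.opC (p.ξ n - p.η) (p.sovKet nrm 0 fun _ => 1)) = 0 :=
      congrArg (fun X : Op N => X (p.sovKet nrm 0 fun _ => 1))
        (opC_mul_opC_eq_zero p hω (hη.th_ne_zero hω) hreg n)
    have hBC : p.opB (p.ξ n) (p.opC (p.ξ n - p.η) (p.sovKet nrm 0 fun _ => 1)) =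
        (-1 : ℂ) • p.opD (p.ξ n) (p.opA (p.ξ n - p.η) (p.sovKet nrm 0 fun _ => 1)) := by
      have := p.partialDyn_fusion hω (hη.th_ne_zero hω) hreg n n.isLt le_rfl 1 0 0 1
      simp only [partialDyn_last] at this
      exact congrArg (fun X : Op N => X (p.sovKet nrm 0 fun _ => 1)) this
    rw [transfer_apply κ (p.ξ n - p.η), hB, smul_zero, zero_add, map_smul, transfer_apply, hC,
      smul_zero, add_zero, hBC, sovKet_one, map_smul, opA_basisKet_one hreg hx hy, map_smul,
      map_smul, opD_basisKet_one, aXY]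
    simp only [smul_smul]
    rw [add_sub_cancel_right]
    congr 1
    field_simp
  | hs h m hm ih =>
    intro n hn
    have hnm : n ≠ m := by
      rintro rfl
      rw [Function.update_self] at hn
      exact zero_ne_one hn
    rw [Function.update_of_ne hnm] at hn
    have hd := dFun_xi_sub_ne_zero hω hη hξ m
    have hS := sovKet_mem_sector hω hη hreg nrm h
    have h1 := transfer_sovKet_one hω hη hreg hx hy hξ κ nrm hm
    have hu : p.sovKet nrm 0 (Function.update h m 0) =
        (κ * p.dFun (p.ξ m - p.η))⁻¹ • p.transfer κ (p.ξ m - p.η) (p.sovKet nrm 0 h) := by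
      rw [h1, smul_smul, inv_mul_cancel₀ (mul_ne_zero hκ hd), one_smul]
    have c1 := transfer_comm_apply hω hη hreg hx hy κ (u := p.ξ n - p.η) (v := p.ξ m - p.η)
      (by rw [sub_sub_sub_cancel_right]; exact th_xi_sub_ne_zero hω hξ hnm) hS
    have c2 : p.transfer κ (p.ξ n) (p.transfer κ (p.ξ m - p.η)
          (p.transfer κ (p.ξ n - p.η) (p.sovKet nrm 0 h))) =
        p.transfer κ (p.ξ m - p.η) (p.transfer κ (p.ξ n)
          (p.transfer κ (p.ξ n - p.η) (p.sovKet nrm 0 h))) := by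
      rw [transfer_sovKet_one hω hη hreg hx hy hξ κ nrm hn]
      simp only [map_smul]
      rw [transfer_comm_apply hω hη hreg hx hy κ _ (sovKet_mem_sector hω hη hreg nrm _)]
      rw [sub_sub_eq_add_sub, add_sub_right_comm]
      exact th_xi_sub_add_ne_zero hω hξ hnm
    rw [hu, map_smul, map_smul, c1, c2, ih n hn, map_smul, smul_comm]

theorem transfer_sovKet_zero (hω : 0 < p.ω.im) (hη : p.IsGeneric) (hreg : p.IsRegular)
    (hx : p.x ≤ 1) (hy : p.y ≤ 1) (hξ : p.InhomogeneityCondition) {κ : ℂ} (hκ : κ ≠ 0) (nrm : ℂ)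
    {h : Spins N} {n : Fin N} (hn : h n = 0) :
    p.transfer κ (p.ξ n) (p.sovKet nrm 0 h) =
      (κ⁻¹ * p.aXY (p.ξ n)) • p.sovKet nrm 0 (Function.update h n 1) := by
  have hd := dFun_xi_sub_ne_zero hω hη hξ n
  have h1 := transfer_transfer_sovKet hω hη hreg hx hy hξ hκ nrm (Function.update h n 1) n (by simp)
  rw [transfer_sovKet_one hω hη hreg hx hy hξ κ nrm (by simp), Function.update_idem,
    show Function.update h n 0 = h by rw [← hn, Function.update_eq_self], map_smul] at h1
  refine smul_right_injective _ (mul_ne_zero hκ hd) ?_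
  simp only
  rw [h1, smul_smul]
  congr 1
  field_simp

/-! ### The action of the transfer matrix on the separate bras -/

theorem sovBra_update (hω : 0 < p.ω.im) (hη : p.IsGeneric) (hreg : p.IsRegular) (nrm : ℂ)
    {h : Spins N} {n : Fin N} (hn : h n = 0) : p.sovBra nrm 0 (Function.update h n 1) =
      (p.dFun (p.ξ n - p.η))⁻¹ • (p.opC (p.ξ n)).dualMap (p.sovBra nrm 0 h) := by
  have hc : ∀ m, Commute ((p.dFun (p.ξ n - p.η))⁻¹ • p.opC (p.ξ n))
      (((p.dFun (p.ξ m - p.η))⁻¹ • p.opC (p.ξ m)) ^ (h m : ℕ)) := fun m =>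
    smul_opC_commute hω hη hreg _ _ _ _ _
  rw [sovBra, sovBra, list_prod_update (List.nodup_finRange N) (List.mem_finRange n)
    (f := fun m => ((p.dFun (p.ξ m - p.η))⁻¹ • p.opC (p.ξ m)) ^ (h m : ℕ))
    (X := (p.dFun (p.ξ n - p.η))⁻¹ • p.opC (p.ξ n)) _ _ _ hc,
    (Commute.list_prod_right _ _ fun x hx' => ?_ : Commute _ _).eq]
  · refine LinearMap.ext fun v => ?_
    simp only [LinearMap.dualMap_apply, LinearMap.smul_apply, Module.End.mul_apply, map_smul]
    exact smul_comm _ _ _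
  · obtain ⟨m, -, rfl⟩ := List.mem_map.1 hx'
    exact hc m
  · intro m hm; rw [Function.update_of_ne hm]
  · simp [hn]
  · simp

theorem sovBra_zero (nrm : ℂ) : p.sovBra nrm 0 (fun _ => 0) = nrm⁻¹ • basisBra (fun _ => 0) 0 := by
  have : ((List.finRange N).map fun n => ((p.dFun (p.ξ n - p.η))⁻¹ • p.opC (p.ξ n)) ^
      ((0 : Fin 2) : ℕ)).prod = 1 := by
    simp
  rw [sovBra, this]
  simp only [heightIndex]
  ext v
  simp [LinearMap.dualMap_apply]

theorem opC_mem_braSector (u : ℂ) {m : ℤ} {φ : Bra N} (hφ : φ ∈ braSector N m (-m)) :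
    (p.opC u).dualMap φ ∈ braSector N (m + 1) (-(m + 1)) := by
  have := p.dynMonodromy_mem_braSector u 1 0 hφ
  rw [opC, show m + 1 = m + ((1 : Fin 2) : ℕ) - ((0 : Fin 2) : ℕ) by simp]
  convert this using 1
  simp
  ring_nf

theorem opB_mem_braSector (u : ℂ) {m : ℤ} {φ : Bra N} (hφ : φ ∈ braSector N m (-m)) :
    (p.opB u).dualMap φ ∈ braSector N (m - 1) (-(m - 1)) := by
  have := p.dynMonodromy_mem_braSector u 0 1 hφ
  rw [opB, show m - 1 = m + ((0 : Fin 2) : ℕ) - ((1 : Fin 2) : ℕ) by simp]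
  convert this using 1
  simp
  ring_nf

theorem basisBra_mem_braSector (h : Spins N) (a : ℤ) : basisBra h a ∈ braSector N (weight h) a := by
  intro s hs
  rw [basisBra_single, if_neg]
  rintro rfl
  exact hs ⟨rfl, rfl⟩

theorem sovBra_mem_braSector (hω : 0 < p.ω.im) (hη : p.IsGeneric) (hreg : p.IsRegular) (nrm : ℂ)
    (h : Spins N) : p.sovBra nrm 0 h ∈ braSector N (weight h) (-weight h) := by
  induction h using Spins.induction_raise with
  | h0 =>
    rw [sovBra_zero, weight_zero]
    refine Submodule.smul_mem _ _ ?_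
    have := basisBra_mem_braSector (N := N) (fun _ => 0) 0
    rwa [weight_zero] at this
  | hs h n hn ih =>
    rw [sovBra_update hω hη hreg nrm hn, weight_update_one hn]
    exact Submodule.smul_mem _ _ (opC_mem_braSector _ ih)

theorem opD_sovBra (hω : 0 < p.ω.im) (hη : p.IsGeneric) (hreg : p.IsRegular)
    (hξ : p.InhomogeneityCondition) (nrm : ℂ) (h : Spins N) :
    ∀ n, h n = 0 → (p.opD (p.ξ n)).dualMap (p.sovBra nrm 0 h) = 0 := by
  induction h using Spins.induction_raise with
  | h0 =>
    intro n _
    rw [sovBra_zero, map_smul, dualMap_opD_basisBra_zero hreg, dFun_xi, zero_mul, zero_smul,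
      smul_zero]
  | hs h m hm ih =>
    intro n hn
    have hnm : n ≠ m := by
      rintro rfl
      rw [Function.update_self] at hn
      exact one_ne_zero hn
    rw [Function.update_of_ne hnm] at hn
    have hrel := opD_opC_dual hω hreg (p.ξ n) (p.ξ m) (sovBra_mem_braSector hω hη hreg nrm h)
    rw [ih n hn, ih m hm, map_zero, map_zero, smul_zero, smul_zero, zero_add] at hrel
    rw [sovBra_update hω hη hreg nrm hm, map_smul, (smul_eq_zero.1 hrel.symm).resolve_left, smul_zero]
    exact mul_ne_zero (th_xi_sub_ne_zero hω hξ hnm)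
      (div_ne_zero (height_sub_eta_ne_zero hreg _) (height_ne_zero hreg _))

theorem opB_sovBra (hω : 0 < p.ω.im) (hη : p.IsGeneric) (hreg : p.IsRegular)
    (hx : p.x ≤ 1) (hy : p.y ≤ 1) (hξ : p.InhomogeneityCondition) (nrm : ℂ) (h : Spins N) :
    ∀ n, h n = 0 → (p.opB (p.ξ n)).dualMap (p.sovBra nrm 0 h) = 0 := by
  induction h using Spins.induction_raise with
  | h0 =>
    intro n _
    have := opB_mem_braSector (p := p) (p.ξ n) (sovBra_mem_braSector hω hη hreg nrm fun _ => 0)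
    exact eq_zero_of_mem_braSector (by rw [weight_zero]; left; lia) this
  | hs h m hm ih =>
    intro n hn
    have hnm : n ≠ m := by
      rintro rfl
      rw [Function.update_self] at hn
      exact one_ne_zero hn
    rw [Function.update_of_ne hnm] at hn
    have hrel := opB_opC_dual hω hreg hx hy (p.ξ n) (p.ξ m)
      (sovBra_mem_braSector hω hη hreg nrm h)
    rw [ih n hn, opD_sovBra hω hη hreg hξ nrm h n hn, opD_sovBra hω hη hreg hξ nrm h m hm,
      map_zero, map_zero, map_zero, smul_zero, smul_zero, smul_zero, zero_add, zero_add] at hrel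
    rw [sovBra_update hω hη hreg nrm hm, map_smul, (smul_eq_zero.1 hrel.symm).resolve_left, smul_zero]
    exact mul_ne_zero (th_xi_sub_ne_zero hω hξ hnm)
      (div_ne_zero (height_sub_eta_ne_zero hreg _) (height_ne_zero hreg _))

theorem transfer_sovBra_zero (hω : 0 < p.ω.im) (hη : p.IsGeneric) (hreg : p.IsRegular)
    (hx : p.x ≤ 1) (hy : p.y ≤ 1) (hξ : p.InhomogeneityCondition) (κ nrm : ℂ)
    {h : Spins N} {n : Fin N} (hn : h n = 0) :
    (p.transfer κ (p.ξ n)).dualMap (p.sovBra nrm 0 h) =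
      (κ * p.dFun (p.ξ n - p.η)) • p.sovBra nrm 0 (Function.update h n 1) := by
  rw [transfer_dual, opB_sovBra hω hη hreg hx hy hξ nrm h n hn, smul_zero, zero_add,
    sovBra_update hω hη hreg nrm hn, smul_smul, mul_assoc,
    mul_inv_cancel₀ (dFun_xi_sub_ne_zero hω hη hξ n), mul_one]

theorem transfer_transfer_sovBra (hω : 0 < p.ω.im) (hη : p.IsGeneric) (hreg : p.IsRegular)
    (hx : p.x ≤ 1) (hy : p.y ≤ 1) (hξ : p.InhomogeneityCondition) {κ : ℂ} (hκ : κ ≠ 0) (nrm : ℂ)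
    (h : Spins N) : ∀ n, h n = 0 →
    (p.transfer κ (p.ξ n - p.η)).dualMap ((p.transfer κ (p.ξ n)).dualMap (p.sovBra nrm 0 h)) =
      (p.aXY (p.ξ n) * p.dFun (p.ξ n - p.η)) • p.sovBra nrm 0 h := by
  induction h using Spins.induction_raise with
  | h0 =>
    intro n _
    have hB := opB_sovBra hω hη hreg hx hy hξ nrm (fun _ => 0) n rfl
    have hC : (p.opC (p.ξ n - p.η)).dualMap ((p.opC (p.ξ n)).dualMap
        (p.sovBra nrm 0 fun _ => 0)) = 0 :=
      (congrArg (fun X : Op N => X.dualMap (p.sovBra nrm 0 fun _ => 0))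
        (opC_mul_opC_eq_zero p hω (hη.th_ne_zero hω) hreg n)).trans
          (LinearMap.ext fun v => by simp)
    have hCB : (p.opB (p.ξ n - p.η)).dualMap ((p.opC (p.ξ n)).dualMap
        (p.sovBra nrm 0 fun _ => 0)) = (-1 : ℂ) • (p.opD (p.ξ n - p.η)).dualMap
          ((p.opA (p.ξ n)).dualMap (p.sovBra nrm 0 fun _ => 0)) := by
      have := p.partialDyn_fusion hω (hη.th_ne_zero hω) hreg n n.isLt le_rfl 0 1 1 0
      simp only [partialDyn_last] at this
      have := congrArg (fun X : Op N => X.dualMap (p.sovBra nrm 0 fun _ => 0)) this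
      refine this.trans ?_
      refine LinearMap.ext fun v => ?_
      exact map_smul (p.sovBra nrm 0 fun _ => 0) (-1 : ℂ) _
    have ht0 : p.thY p.t0 ≠ 0 := by simpa using hreg 0
    have e : p.thY (p.t0 + p.η * N) = -(-1) ^ (p.x + p.y + p.x * p.y) * p.thY p.t0 := by
      rw [← p.thY_reflect hx hy, t0]; congr 1; ring
    have e2 : ((-1 : ℂ) ^ (p.x + p.y + p.x * p.y)) * (-1) ^ (p.x + p.y + p.x * p.y) = 1 := by
      rw [← mul_pow]; simp
    have e0 : ((-1 : ℂ) ^ (p.x + p.y + p.x * p.y)) ≠ 0 := pow_ne_zero _ (by norm_num)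
    rw [transfer_dual κ (p.ξ n), hB, smul_zero, zero_add, map_smul, transfer_dual, hC,
      smul_zero, add_zero, hCB, sovBra_zero, map_smul, dualMap_opA_basisBra_zero, map_smul,
      map_smul, dualMap_opD_basisBra_zero hreg, aXY,
      show p.height (0 - 1) - p.η = p.t0 by simp only [height]; push_cast; ring,
      show p.height (0 - 1) + p.η * N - p.η = p.t0 + p.η * N by simp only [height]; push_cast; ring,
      e]
    simp only [smul_smul]
    rw [sub_add_cancel]
    congr 1
    field_simp
    linear_combination -(p.aFun (p.ξ n) * p.dFun (p.ξ n - p.η) * nrm⁻¹) * e2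
  | hs h m hm ih =>
    intro n hn
    have hnm : n ≠ m := by
      rintro rfl
      rw [Function.update_self] at hn
      exact one_ne_zero hn
    rw [Function.update_of_ne hnm] at hn
    have hd := dFun_xi_sub_ne_zero hω hη hξ m
    have hS := sovBra_mem_braSector hω hη hreg nrm h
    have h1 := transfer_sovBra_zero hω hη hreg hx hy hξ κ nrm hm
    have hu : p.sovBra nrm 0 (Function.update h m 1) =
        (κ * p.dFun (p.ξ m - p.η))⁻¹ • (p.transfer κ (p.ξ m)).dualMap (p.sovBra nrm 0 h) := by
      rw [h1, smul_smul, inv_mul_cancel₀ (mul_ne_zero hκ hd), one_smul]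
    have c1 := transfer_comm_dual hω hη hreg hx hy κ (u := p.ξ n) (v := p.ξ m)
      (th_xi_sub_ne_zero hω hξ hnm) hS
    have c2 : (p.transfer κ (p.ξ n - p.η)).dualMap ((p.transfer κ (p.ξ m)).dualMap
          ((p.transfer κ (p.ξ n)).dualMap (p.sovBra nrm 0 h))) =
        (p.transfer κ (p.ξ m)).dualMap ((p.transfer κ (p.ξ n - p.η)).dualMap
          ((p.transfer κ (p.ξ n)).dualMap (p.sovBra nrm 0 h))) := by
      rw [transfer_sovBra_zero hω hη hreg hx hy hξ κ nrm hn]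
      simp only [map_smul]
      rw [transfer_comm_dual hω hη hreg hx hy κ _ (sovBra_mem_braSector hω hη hreg nrm _)]
      rw [sub_right_comm]
      exact th_xi_sub_sub_ne_zero hω hξ hnm
    rw [hu, map_smul, map_smul, c1, c2, ih n hn, map_smul, smul_comm]

theorem transfer_sovBra_one (hω : 0 < p.ω.im) (hη : p.IsGeneric) (hreg : p.IsRegular)
    (hx : p.x ≤ 1) (hy : p.y ≤ 1) (hξ : p.InhomogeneityCondition) {κ : ℂ} (hκ : κ ≠ 0) (nrm : ℂ)
    {h : Spins N} {n : Fin N} (hn : h n = 1) :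
    (p.transfer κ (p.ξ n - p.η)).dualMap (p.sovBra nrm 0 h) =
      (κ⁻¹ * p.aXY (p.ξ n)) • p.sovBra nrm 0 (Function.update h n 0) := by
  have hd := dFun_xi_sub_ne_zero hω hη hξ n
  have h1 := transfer_transfer_sovBra hω hη hreg hx hy hξ hκ nrm (Function.update h n 0) n (by simp)
  rw [transfer_sovBra_zero hω hη hreg hx hy hξ κ nrm (by simp), Function.update_idem,
    show Function.update h n 1 = h by rw [← hn, Function.update_eq_self], map_smul] at h1
  refine smul_right_injective _ (mul_ne_zero hκ hd) ?_
  simp only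
  rw [h1, smul_smul]
  congr 1
  field_simp

/-! ### The pairing of the separate bases -/

theorem dualMap_opC_basisBra (hreg : p.IsRegular) (n : Fin N) (h : Spins N) (a : ℤ)
    (h0 : ∀ m : Fin N, m ≤ n → h m = 0) (h1 : ∀ m : Fin N, n < m → h m = 1) :
    (p.opC (p.ξ n)).dualMap (basisBra h a) =
      p.aFun (p.ξ n) • basisBra (Function.update h n 1) (a - 1) := by
  rw [opC, ← partialDyn_last, dualMap_partialDyn_flip hreg n h a n.isLt le_rfl h0
    (fun m hm _ => h1 m hm), prod_filter_lt_last, aFun]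

theorem exists_sovBra_one_eq (hω : 0 < p.ω.im) (hη : p.IsGeneric) (hreg : p.IsRegular)
    (hξ : p.InhomogeneityCondition) {nrm : ℂ} (hnrm : nrm ≠ 0) {k : ℕ} (hk : k ≤ N) :
    ∃ c : ℂ, c ≠ 0 ∧ p.sovBra nrm 0 (fun m => if N ≤ m.val + k then 1 else 0) =
      c • basisBra (fun m => if N ≤ m.val + k then 1 else 0) (-(k : ℤ)) := by
  induction k with
  | zero =>
    refine ⟨nrm⁻¹, inv_ne_zero hnrm, ?_⟩
    have : (fun m : Fin N => if N ≤ m.val + 0 then (1 : Fin 2) else 0) = fun _ => 0 := by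
      funext m
      rw [if_neg]
      have := m.isLt
      lia
    rw [this, sovBra_zero]
    simp
  | succ k ih =>
    obtain ⟨c, hc, h⟩ := ih (by lia)
    obtain ⟨n, hn⟩ : ∃ n : Fin N, n.val + (k + 1) = N := ⟨⟨N - (k + 1), by lia⟩, by simp; lia⟩
    have hu : (fun m : Fin N => if N ≤ m.val + (k + 1) then (1 : Fin 2) else 0) =
        Function.update (fun m => if N ≤ m.val + k then (1 : Fin 2) else 0) n 1 := by
      funext m
      by_cases hm : m = n
      · subst hm
        rw [Function.update_self, if_pos (by lia)]
      · rw [Function.update_of_ne hm]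
        have : m.val ≠ n.val := fun h => hm (Fin.ext h)
        congr 1
        simp only [eq_iff_iff]
        lia
    refine ⟨(p.dFun (p.ξ n - p.η))⁻¹ * (c * p.aFun (p.ξ n)), mul_ne_zero
      (inv_ne_zero (dFun_xi_sub_ne_zero hω hη hξ n)) (mul_ne_zero hc (aFun_xi_ne_zero hω hη hξ n)), ?_⟩
    rw [hu, sovBra_update hω hη hreg nrm (by rw [if_neg]; lia), h, map_smul,
      dualMap_opC_basisBra hreg]
    · simp only [smul_smul]
      congr 2
      push_cast
      ring
    · intro m hm
      rw [if_neg]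
      have : m.val ≤ n.val := hm
      lia
    · intro m hm
      rw [if_pos]
      have : n.val < m.val := hm
      lia

theorem sovBra_one_apply_ne_zero (hω : 0 < p.ω.im) (hη : p.IsGeneric) (hreg : p.IsRegular)
    (hξ : p.InhomogeneityCondition) {nrm : ℂ} (hnrm : nrm ≠ 0) :
    p.sovBra nrm 0 (fun _ => 1) (p.sovKet nrm 0 fun _ => 1) ≠ 0 := by
  obtain ⟨c, hc, h⟩ := exists_sovBra_one_eq hω hη hreg hξ hnrm (le_refl N)
  have : (fun m : Fin N => if N ≤ m.val + N then (1 : Fin 2) else 0) = fun _ => 1 := by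
    funext m
    rw [if_pos (by lia)]
  rw [this] at h
  rw [h, sovKet_one, LinearMap.smul_apply, map_smul, basisKet, basisBra_single, if_pos rfl]
  simpa using ⟨hc, hnrm⟩

theorem sovBra_apply_eq_zero (hω : 0 < p.ω.im) (hη : p.IsGeneric) (hreg : p.IsRegular) (nrm : ℂ)
    {h h' : Spins N} (hh : h ≠ h') : p.sovBra nrm 0 h (p.sovKet nrm 0 h') = 0 := by
  by_cases hw : weight h' = weight h
  · obtain ⟨n, hn, hn'⟩ : ∃ n, h n = 1 ∧ h' n = 0 := by
      by_contra! hc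
      have hle : ∀ n ∈ Finset.univ, ((h n : ℕ) : ℤ) ≤ ((h' n : ℕ) : ℤ) := by
        intro n _
        by_cases h1 : h n = 1
        · have := hc n h1
          have h2 : h' n = 1 := by lia
          rw [h1, h2]
        · have h0 : h n = 0 := by lia
          rw [h0]
          simp
      have := (Finset.sum_eq_sum_iff_of_le hle).1 hw.symm
      refine hh (funext fun n => Fin.ext ?_)
      exact_mod_cast this n (Finset.mem_univ n)
    have e1 : h = Function.update (Function.update h n 0) n 1 := by
      rw [Function.update_idem, ← hn, Function.update_eq_self]
    have e2 : h' = Function.update (Function.update h' n 1) n 0 := by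
      rw [Function.update_idem, ← hn', Function.update_eq_self]
    rw [e1, e2, sovBra_update hω hη hreg nrm (by simp), sovKet_update hω hη hreg nrm (by simp),
      map_smul, LinearMap.smul_apply, LinearMap.dualMap_apply]
    have hC := congrArg (fun X : Op N => X (p.sovKet nrm 0 (Function.update h' n 1)))
        (opC_mul_opC_eq_zero p hω (hη.th_ne_zero hω) hreg n)
    simp only [Module.End.mul_apply, LinearMap.zero_apply] at hC
    rw [hC, map_zero, smul_zero, smul_zero]
  · exact braSector_apply_eq_zero (sovBra_mem_braSector hω hη hreg nrm h)
      (sovKet_mem_sector hω hη hreg nrm h') fun hc => hw hc.1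

/-! ### Quasi-periodicity of the transfer matrix on the balanced sectors -/

variable (p) in
/-- The matrix elements of the monodromy matrix of the first `k` sites. -/
def entry (k : ℕ) (u : ℂ) (i j : Fin 2) (s' s : Spins N × ℤ) : ℂ :=
  (p.partialDyn k u i j).dualMap (basisBra s'.1 s'.2) (Finsupp.single s 1)

theorem entry_eq (k : ℕ) (u : ℂ) (i j : Fin 2) (s' s : Spins N × ℤ) :
    p.entry k u i j s' s = p.partialDyn k u i j (Finsupp.single s 1) s' := rfl

theorem entry_zero (u : ℂ) (i j : Fin 2) (s' s : Spins N × ℤ) : p.entry 0 u i j s' s =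
    if i = j ∧ s' = (s.1, s.2 + (1 - 2 * ((j : ℕ) : ℤ))) then 1 else 0 := by
  rw [entry_eq, partialDyn_zero, shiftMatrix_apply]
  by_cases hij : i = j
  · rw [if_pos hij, shiftOp_single, Finsupp.single_apply]
    simp [hij, eq_comm]
  · simp [hij]

theorem entry_succ (k : Fin N) (u : ℂ) (i j : Fin 2) (s' s : Spins N × ℤ) :
    p.entry (k + 1) u i j s' s = ∑ l, ∑ q,
      p.R (u - p.ξ k) (p.partialHeight k s') (i, s'.1 k) (l, q) *
        p.entry k u l j (Function.update s'.1 k q, s'.2) s := by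
  rw [entry, partialDyn_succ, dualMap_sum_mul, LinearMap.sum_apply]
  refine Finset.sum_congr rfl fun l _ => ?_
  rw [dualMap_laxAt_basisBra, map_sum, LinearMap.sum_apply]
  refine Finset.sum_congr rfl fun q _ => ?_
  rw [map_smul, LinearMap.smul_apply, add_zero]
  rfl

theorem differentiable_thY (hω : 0 < p.ω.im) : Differentiable ℂ p.thY :=
  differentiable_twistTheta hω p.y

theorem differentiable_th (hω : 0 < p.ω.im) : Differentiable ℂ p.th :=
  differentiable_theta hω

theorem differentiable_R (hω : 0 < p.ω.im) (t : ℂ) (i k j l : Fin 2) :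
    Differentiable ℂ fun u => p.R u t (i, k) (j, l) := by
  simp only [R_apply]
  have h1 := differentiable_th hω
  have h2 := differentiable_thY hω
  split_ifs
  · exact h1.comp (by fun_prop : Differentiable ℂ fun u : ℂ => u + p.η)
  · fun_prop
  · fun_prop
  · exact h1.mul_const _
  · exact ((h2.comp (by fun_prop : Differentiable ℂ fun u : ℂ => t + u * spinVal i)).div_const
      _).const_mul _

theorem differentiable_entry (hω : 0 < p.ω.im) {k : ℕ} (hk : k ≤ N) (i j : Fin 2)
    (s' s : Spins N × ℤ) : Differentiable ℂ fun u => p.entry k u i j s' s := by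
  induction k generalizing i s' with
  | zero => simp only [entry_zero]; fun_prop
  | succ k ih =>
    obtain ⟨n, rfl⟩ : ∃ n : Fin N, n.val = k := ⟨⟨k, hk⟩, rfl⟩
    simp only [entry_succ]
    refine Differentiable.fun_sum fun l _ => Differentiable.fun_sum fun q _ => ?_
    exact ((differentiable_R hω _ _ _ _ _).comp
      (by fun_prop : Differentiable ℂ fun u : ℂ => u - p.ξ n)).mul (ih n.isLt.le _ _)

theorem th_add_pi (z : ℂ) : p.th (z + Real.pi) = -p.th z := theta_add_pi z

theorem th_add_pi_mul (z : ℂ) : p.th (z + Real.pi * p.ω) =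
    -exp (-2 * I * z - I * Real.pi * p.ω) * p.th z := theta_add_pi_mul z

theorem thY_add_pi (z : ℂ) : p.thY (z + Real.pi) = -(-1) ^ p.y * p.thY z := twistTheta_add_pi _ z

theorem thY_sub_pi (z : ℂ) : p.thY (z - Real.pi) = -(-1) ^ p.y * p.thY z := by
  have := p.thY_add_pi (z - Real.pi)
  rw [sub_add_cancel] at this
  have e2 : ((-1 : ℂ) ^ p.y) * (-1) ^ p.y = 1 := by rw [← mul_pow]; simp
  rw [this]
  linear_combination -p.thY (z - Real.pi) * e2

theorem thY_add_pi_mul (z : ℂ) : p.thY (z + Real.pi * p.ω) =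
    -exp (I * p.y * (Real.pi * p.ω) - 2 * I * z - I * Real.pi * p.ω) * p.thY z :=
  twistTheta_add_pi_mul _ z

theorem thY_sub_pi_mul (z : ℂ) : p.thY (z - Real.pi * p.ω) =
    -exp (-(I * p.y * (Real.pi * p.ω)) + 2 * I * z - I * Real.pi * p.ω) * p.thY z := by
  have := p.thY_add_pi_mul (z - Real.pi * p.ω)
  rw [sub_add_cancel] at this
  rw [this, ← mul_assoc, neg_mul_neg, ← exp_add]
  ring_nf
  simp

theorem R_add_pi (u t : ℂ) (i k j l : Fin 2) : p.R (u + Real.pi) t (i, k) (j, l) =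
    -(if i = j then 1 else (-1) ^ p.y) * p.R u t (i, k) (j, l) := by
  rw [R_apply, R_apply]
  by_cases h1 : i = k
  · rw [if_pos h1, if_pos h1]
    by_cases h2 : j = i ∧ l = i
    · rw [if_pos h2, if_pos h2, if_pos h2.1.symm, add_right_comm, th_add_pi]; ring
    · rw [if_neg h2, if_neg h2, mul_zero]
  rw [if_neg h1, if_neg h1]
  by_cases h3 : j = l
  · rw [if_pos h3, if_pos h3, mul_zero]
  rw [if_neg h3, if_neg h3]
  by_cases h4 : i = j
  · rw [if_pos h4, if_pos h4, if_pos h4, th_add_pi]; ring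
  · have : p.thY (t + (u + Real.pi) * spinVal i) = -(-1) ^ p.y * p.thY (t + u * spinVal i) := by
      obtain rfl | rfl : i = 0 ∨ i = 1 := by lia
      · rw [spinVal_zero, mul_one, mul_one, ← add_assoc, thY_add_pi]
      · rw [spinVal_one, ← thY_sub_pi]; ring_nf
    rw [if_neg h4, if_neg h4, if_neg h4, this]; ring

theorem spinVal_of_ne {i k : Fin 2} (h : i ≠ k) : spinVal k = -spinVal i := by
  fin_cases i <;> fin_cases k <;> simp_all [spinVal_zero, spinVal_one]

variable (p) in
/-- The exponent of the gauge factor in the quasi-periodicity of the R-matrix. -/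
def gaugeExp (i : Fin 2) (H : ℂ) : ℂ := I * spinVal i * (p.y * (Real.pi * p.ω) / 2 - H)

theorem R_add_pi_mul (u t : ℂ) (i k j l : Fin 2) : p.R (u + Real.pi * p.ω) t (i, k) (j, l) =
    -exp (-2 * I * u - I * Real.pi * p.ω - I * p.η) *
      exp (p.gaugeExp i (t + p.η * spinVal k) - p.gaugeExp j t) * p.R u t (i, k) (j, l) := by
  rw [neg_mul, ← exp_add, R_apply, R_apply]
  have hs : spinVal i * spinVal i = 1 := by
    obtain rfl | rfl : i = 0 ∨ i = 1 := by lia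
    · rw [spinVal_zero]; ring
    · rw [spinVal_one]; ring
  simp only [gaugeExp]
  split_ifs with h1 h2 h3 h4
  · rw [add_right_comm, th_add_pi_mul, h2.1, ← h1]
    congr 3
    linear_combination I * p.η * hs
  · ring
  · ring
  · rw [th_add_pi_mul, ← h4, spinVal_of_ne h1, ← mul_assoc]
    congr 4
    linear_combination -I * p.η * hs
  · rw [spinVal_of_ne h1, spinVal_of_ne h4]
    have : p.thY (t + (u + Real.pi * p.ω) * spinVal i) =
        -exp (I * p.y * (Real.pi * p.ω) * spinVal i - 2 * I * u - 2 * I * t * spinVal i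
          - I * Real.pi * p.ω) * p.thY (t + u * spinVal i) := by
      obtain rfl | rfl : i = 0 ∨ i = 1 := by lia
      · rw [spinVal_zero, mul_one, mul_one, ← add_assoc, thY_add_pi_mul]; ring_nf
      · rw [spinVal_one, show t + (u + Real.pi * p.ω) * -1 = t + u * -1 - Real.pi * p.ω by ring,
          thY_sub_pi_mul]; ring_nf
    rw [this, show I * p.y * (Real.pi * p.ω) * spinVal i - 2 * I * u - 2 * I * t * spinVal i
        - I * Real.pi * p.ω = -2 * I * u - I * Real.pi * p.ω - I * p.η +
      (I * spinVal i * (p.y * (Real.pi * p.ω) / 2 - (t + p.η * -spinVal i)) -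
        I * -spinVal i * (p.y * (Real.pi * p.ω) / 2 - t)) by
          linear_combination -I * p.η * hs]
    ring

theorem entry_add_pi (u : ℂ) {k : ℕ} (hk : k ≤ N) (i j : Fin 2) (s' s : Spins N × ℤ) :
    p.entry k (u + Real.pi) i j s' s =
      (-1) ^ k * (if i = j then 1 else (-1) ^ p.y) * p.entry k u i j s' s := by
  have e2 : ((-1 : ℂ) ^ p.y) * (-1) ^ p.y = 1 := by rw [← mul_pow]; simp
  induction k generalizing i s' with
  | zero =>
    simp only [entry_zero]
    split_ifs with h1 h2
    · ring
    · exact absurd h1.1 h2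
    · ring
    · ring
  | succ k ih =>
    obtain ⟨n, rfl⟩ : ∃ n : Fin N, n.val = k := ⟨⟨k, hk⟩, rfl⟩
    rw [entry_succ, entry_succ, Finset.mul_sum]
    refine Finset.sum_congr rfl fun l _ => ?_
    rw [Finset.mul_sum]
    refine Finset.sum_congr rfl fun q _ => ?_
    rw [add_sub_right_comm, R_add_pi, ih n.isLt.le, pow_succ]
    have : ((if i = l then 1 else (-1) ^ p.y) * (if l = j then 1 else (-1) ^ p.y) : ℂ) =
        if i = j then 1 else (-1) ^ p.y := by
      split_ifs <;> simp_all
      lia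
    rw [← this]
    ring

theorem entry_add_pi_mul (u : ℂ) {k : ℕ} (hk : k ≤ N) (i j : Fin 2) (s' s : Spins N × ℤ) :
    p.entry k (u + Real.pi * p.ω) i j s' s =
      (∏ m ∈ Finset.univ.filter (fun m : Fin N => m.val < k),
        -exp (-2 * I * (u - p.ξ m) - I * Real.pi * p.ω - I * p.η)) *
      exp (p.gaugeExp i (p.partialHeight k s') -
        p.gaugeExp j (p.height s.2 - p.η * spinVal j)) * p.entry k u i j s' s := by
  induction k generalizing i s' with
  | zero =>
    simp only [entry_zero]
    split_ifs with h1
    · obtain ⟨rfl, rfl⟩ := h1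
      rw [partialHeight_zero, height_add, spinVal_eq_intCast]
      simp
    · ring
  | succ k ih =>
    obtain ⟨n, rfl⟩ : ∃ n : Fin N, n.val = k := ⟨⟨k, hk⟩, rfl⟩
    rw [entry_succ, entry_succ, Finset.mul_sum]
    refine Finset.sum_congr rfl fun l _ => ?_
    rw [Finset.mul_sum]
    refine Finset.sum_congr rfl fun q _ => ?_
    rw [add_sub_right_comm, R_add_pi_mul, ih n.isLt.le, prod_filter_lt_succ, partialHeight_succ,
      p.partialHeight_update_of_le le_rfl]
    have : exp (p.gaugeExp i (p.partialHeight n s' + p.η * spinVal (s'.1 n)) -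
        p.gaugeExp j (p.height s.2 - p.η * spinVal j)) =
      exp (p.gaugeExp i (p.partialHeight n s' + p.η * spinVal (s'.1 n)) -
        p.gaugeExp l (p.partialHeight n s')) * exp (p.gaugeExp l (p.partialHeight n s') -
          p.gaugeExp j (p.height s.2 - p.η * spinVal j)) := by
      rw [← exp_add]; congr 1; ring
    rw [this]
    ring

variable (p) in
/-- The norm of the theta functions which describe the transfer matrix. -/
def thetaNorm : ℂ := ∑ k, p.ξ k + p.tVal 0 fun _ => 0

theorem isThetaOrder_entry (hω : 0 < p.ω.im) {i j : Fin 2} (hij : i ≠ j) (s' : Spins N × ℤ)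
    {s : Spins N × ℤ} (hs : s.2 = -weight s.1) :
    IsThetaOrder p.ω N p.thetaNorm fun u => exp (I * p.y * u) * p.entry N u i j s' s where
  differentiable := Differentiable.mul (by fun_prop) (differentiable_entry hω le_rfl i j s' s)
  add_pi u := by
    have e2 : ((-1 : ℂ) ^ p.y) * (-1) ^ p.y = 1 := by rw [← mul_pow]; simp
    rw [entry_add_pi u le_rfl, if_neg hij, mul_add, exp_add,
      show I * p.y * Real.pi = (p.y : ℕ) * (Real.pi * I) by ring, exp_nat_mul, exp_pi_mul_I]
    linear_combination exp (I * p.y * u) * (-1) ^ N * p.entry N u i j s' s * e2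
  add_pi_mul u := by
    by_cases h : weight s'.1 = weight s.1 + (j : ℕ) - (i : ℕ) ∧
        s'.2 = s.2 + (1 - 2 * ((j : ℕ) : ℤ))
    · have hprod : (∏ m : Fin N, -exp (-2 * I * (u - p.ξ m) - I * Real.pi * p.ω - I * p.η)) =
          (-exp (-2 * I * u - I * Real.pi * p.ω)) ^ N * exp (2 * I * ∑ m, p.ξ m - I * N * p.η) := by
        have : ∀ m : Fin N, -exp (-2 * I * (u - p.ξ m) - I * Real.pi * p.ω - I * p.η) =
            -exp (-2 * I * u - I * Real.pi * p.ω) * exp (2 * I * p.ξ m - I * p.η) := fun m => by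
          rw [neg_mul (exp _), ← exp_add]; congr 2; ring
        simp only [this]
        rw [Finset.prod_mul_distrib, ← exp_sum, Finset.sum_sub_distrib, ← Finset.mul_sum]
        simp
        ring_nf
      have hg : exp (p.gaugeExp i (p.partialHeight N s') -
          p.gaugeExp j (p.height s.2 - p.η * spinVal j)) = exp (I * Real.pi * p.x) := by
        rw [partialHeight_last, h.1, h.2, height_add, hs]
        simp only [gaugeExp, height, t0, halfPeriod]
        obtain ⟨rfl, rfl⟩ | ⟨rfl, rfl⟩ : (i = 0 ∧ j = 1) ∨ (i = 1 ∧ j = 0) := by lia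
        · rw [exp_eq_exp_iff_exists_int]
          refine ⟨-p.x, ?_⟩
          rw [spinVal_zero, spinVal_one]
          push_cast
          simp
          ring
        · congr 1
          rw [spinVal_zero, spinVal_one]
          push_cast
          simp
          ring
      rw [entry_add_pi_mul u le_rfl, prod_filter_lt_last, hprod, hg, mul_add, exp_add]
      have : exp (2 * I * p.thetaNorm) = exp (I * p.y * (Real.pi * p.ω)) *
          exp (2 * I * ∑ m, p.ξ m - I * N * p.η) * exp (I * Real.pi * p.x) := by
        rw [← exp_add, ← exp_add]
        congr 1
        simp only [thetaNorm, tVal, spinVal_zero, halfPeriod]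
        simp
        ring
      rw [this]
      ring
    · have h0 : ∀ u, p.entry N u i j s' s = 0 := fun u => by
        rw [entry_eq]
        by_contra hne
        have := p.partialDyn_mem_sector le_rfl u i j (single_mem_sector s 1)
          (Finsupp.mem_support_iff.2 hne)
        exact h this
      rw [h0, h0, mul_zero, mul_zero, mul_zero]

/-! ### Interpolation of theta functions at the separated points -/

theorem vartheta_eq (j : Fin N) (u : ℂ) :
    p.vartheta j u = ∑' n, thetaTerm p.ω N (1 / 2 - ((j : ℕ) : ℂ) / N) u n := by
  simp only [vartheta, thetaTerm, add_sub_assoc]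

theorem xiBar_zero : p.xiBar 0 = p.thetaNorm / N := rfl

theorem tVal_zero (h : Spins N) : p.tVal 0 h = (p.tVal 0 fun _ => 0) + p.η * weight h := by
  simp only [tVal, weight, spinVal, Finset.sum_sub_distrib, ← Finset.mul_sum]
  push_cast
  simp
  ring

theorem det_thetaMatrix_ne_zero (hω : 0 < p.ω.im) (hN : 1 ≤ N) (hreg : p.IsRegular)
    (hξ : p.InhomogeneityCondition) (h : Spins N) : (p.thetaMatrix 0 h).det ≠ 0 := by
  have : p.thetaMatrix 0 h = Matrix.of fun i j : Fin N => ∑' n, thetaTerm p.ω N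
      (1 / 2 - ((j : ℕ) : ℂ) / N) (p.xiShift i (h i) - p.thetaNorm / N) n := by
    ext i j
    rw [thetaMatrix, vartheta_eq, xiBar_zero]
    rfl
  rw [this]
  refine det_thetaTerm_ne_zero hω hN (fun i j hij => ?_) ?_
  · simp only [xiShift]
    obtain hi | hi : h i = 0 ∨ h i = 1 := by lia
    all_goals obtain hj | hj : h j = 0 ∨ h j = 1 := by lia
    all_goals rw [hi, hj]
    all_goals change p.th _ ≠ 0
    · convert th_xi_sub_ne_zero hω hξ hij using 2; simp
    · convert th_xi_sub_add_ne_zero hω hξ hij using 2; simp; ring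
    · convert th_xi_sub_sub_ne_zero hω hξ hij using 2; simp; ring
    · convert th_xi_sub_ne_zero hω hξ hij using 2; simp
  · have h1 : ∑ i, p.xiShift i (h i) - p.thetaNorm = -p.height (heightIndex 0 h) := by
      rw [height_heightIndex, tVal_zero]
      simp only [xiShift, thetaNorm, weight, Finset.sum_sub_distrib, ← Finset.mul_sum]
      push_cast
      ring
    have h2 := right_ne_zero_of_mul (height_ne_zero hreg (heightIndex 0 h))
    rw [h1, theta_neg]
    exact neg_ne_zero.2 h2

theorem _root_.DynSixVertex.IsThetaOrder.mul_det_thetaMatrix (hω : 0 < p.ω.im) (hN : 1 ≤ N)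
    {f : ℂ → ℂ} (hf : IsThetaOrder p.ω N p.thetaNorm f) (h : Spins N) (u : ℂ) :
    f u * (p.thetaMatrix 0 h).det = ∑ n, f (p.xiShift n (h n)) *
      ((p.thetaMatrix 0 h).updateRow n fun j => p.vartheta j (u - p.xiBar 0)).det := by
  obtain ⟨A, hA⟩ := hf.exists_coeff hω hN
  have hA' : ∀ u, f u = ∑ j, A j * p.vartheta j (u - p.xiBar 0) := fun u => by
    rw [hA u]; simp only [vartheta_eq, xiBar_zero]
  have hc := Matrix.mulVec_cramer (p.thetaMatrix 0 h).transpose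
    fun j => p.vartheta j (u - p.xiBar 0)
  have hc' : ∀ j, ∑ n, p.vartheta j (p.xiShift n (h n) - p.xiBar 0) *
      ((p.thetaMatrix 0 h).updateRow n fun j => p.vartheta j (u - p.xiBar 0)).det =
      (p.thetaMatrix 0 h).det * p.vartheta j (u - p.xiBar 0) := fun j => by
    have := congrFun hc j
    simp only [Matrix.mulVec, dotProduct, Matrix.cramer_transpose_apply, Matrix.transpose_apply,
      Matrix.det_transpose, Pi.smul_apply, smul_eq_mul] at this
    exact this
  simp only [hA', Finset.sum_mul]
  rw [Finset.sum_comm]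
  refine Finset.sum_congr rfl fun j _ => ?_
  simp only [mul_assoc]
  rw [← Finset.mul_sum, hc']
  ring

/-- The configuration `h` with the spin at site `n` reversed. -/
def flip (h : Spins N) (n : Fin N) : Spins N := Function.update h n (1 - h n)

theorem flip_flip (h : Spins N) (n : Fin N) : flip (flip h n) n = h := by
  simp [flip]

theorem flip_apply_self (h : Spins N) (n : Fin N) : flip h n n = 1 - h n := by simp [flip]

theorem flip_apply_of_ne (h : Spins N) {m n : Fin N} (hmn : m ≠ n) : flip h n m = h m := by
  simp [flip, hmn]

theorem updateRow_thetaMatrix_flip (h : Spins N) (n : Fin N) (r : Fin N → ℂ) :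
    (p.thetaMatrix 0 (flip h n)).updateRow n r = (p.thetaMatrix 0 h).updateRow n r := by
  ext i j
  by_cases hi : i = n
  · subst hi; simp
  · rw [Matrix.updateRow_ne hi, Matrix.updateRow_ne hi, thetaMatrix, thetaMatrix,
      flip_apply_of_ne h hi]

/-- The determinant of `Θ ^ (0, h)` with row `n` replaced by its value at `u`. -/
def rowDet (p : Model N) (h : Spins N) (n : Fin N) (u : ℂ) : ℂ :=
  ((p.thetaMatrix 0 h).updateRow n fun j => p.vartheta j (u - p.xiBar 0)).det

theorem transfer_expansion (hω : 0 < p.ω.im) (hN : 1 ≤ N) (κ u : ℂ) (h : Spins N) {m : ℤ}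
    {ψ : Ket N} (hψ : ψ ∈ sector N m (-m)) :
    (exp (I * p.y * u) * (p.thetaMatrix 0 h).det) • p.transfer κ u ψ =
      ∑ n, (exp (I * p.y * p.xiShift n (h n)) * p.rowDet h n u) •
        p.transfer κ (p.xiShift n (h n)) ψ := by
  have : sector N m (-m) ≤ LinearMap.eqLocus
      ((exp (I * p.y * u) * (p.thetaMatrix 0 h).det) • p.transfer κ u)
      (∑ n, (exp (I * p.y * p.xiShift n (h n)) * p.rowDet h n u) •
        p.transfer κ (p.xiShift n (h n))) := by
    refine sector_le fun s h1 h2 => ?_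
    rw [LinearMap.mem_eqLocus, LinearMap.sum_apply]
    simp only [LinearMap.smul_apply]
    ext s'
    have hs : s.2 = -weight s.1 := by rw [h1, h2]
    have hf := (((isThetaOrder_entry hω zero_ne_one s' hs).const_mul κ⁻¹).add
      ((isThetaOrder_entry hω one_ne_zero s' hs).const_mul κ)).mul_det_thetaMatrix hω hN h u
    have hT : ∀ u, p.transfer κ u (Finsupp.single s 1) s' =
        κ⁻¹ * p.entry N u 0 1 s' s + κ * p.entry N u 1 0 s' s := fun u => by
      rw [entry_eq, entry_eq, partialDyn_last]; rfl
    rw [Finsupp.finsetSum_apply]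
    simp only [Finsupp.smul_apply, smul_eq_mul, hT]
    simp only [rowDet]
    refine Eq.trans ?_ (hf.trans (Finset.sum_congr rfl fun n _ => ?_)) <;> ring
  have := this hψ
  rw [LinearMap.mem_eqLocus, LinearMap.sum_apply] at this
  exact this

theorem transfer_dual_expansion (hω : 0 < p.ω.im) (hN : 1 ≤ N) (κ u : ℂ) (h : Spins N) {m : ℤ}
    {φ : Bra N} (hφ : φ ∈ braSector N m (-m)) :
    (exp (I * p.y * u) * (p.thetaMatrix 0 h).det) • (p.transfer κ u).dualMap φ =
      ∑ n, (exp (I * p.y * p.xiShift n (h n)) * p.rowDet h n u) •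
        (p.transfer κ (p.xiShift n (h n))).dualMap φ := by
  refine bra_ext fun s => ?_
  rw [LinearMap.sum_apply]
  simp only [LinearMap.smul_apply, LinearMap.dualMap_apply]
  by_cases hs : s.2 = -weight s.1
  · have hm := single_mem_sector s 1
    rw [hs] at hm
    have := congrArg φ (transfer_expansion hω hN κ u h hm)
    rw [map_sum] at this
    simpa only [map_smul] using this
  · have h0 : ∀ u, φ (p.transfer κ u (Finsupp.single s 1)) = 0 := fun u => by
      rw [transfer_apply, map_add, map_smul, map_smul, opB, opC,
        braSector_apply_eq_zero hφ (p.dynMonodromy_mem_sector u 0 1 (single_mem_sector s 1)),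
        braSector_apply_eq_zero hφ (p.dynMonodromy_mem_sector u 1 0 (single_mem_sector s 1)),
        smul_zero, smul_zero, add_zero]
      all_goals
        simp
        lia
    simp only [h0, smul_zero, Finset.sum_const_zero]

/-! ### Non-degeneracy of the pairing -/

theorem aXY_xi_ne_zero (hω : 0 < p.ω.im) (hη : p.IsGeneric) (hξ : p.InhomogeneityCondition)
    (n : Fin N) : p.aXY (p.ξ n) ≠ 0 :=
  mul_ne_zero (pow_ne_zero _ (by norm_num)) (aFun_xi_ne_zero hω hη hξ n)

variable (p) in
/-- The coefficient in the action of the transfer matrix on the separate kets. -/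
def ketCoeff (κ : ℂ) (n : Fin N) (r : Fin 2) : ℂ :=
  if r = 0 then κ⁻¹ * p.aXY (p.ξ n) else κ * p.dFun (p.ξ n - p.η)

variable (p) in
/-- The coefficient in the action of the transfer matrix on the separate bras. -/
def braCoeff (κ : ℂ) (n : Fin N) (r : Fin 2) : ℂ :=
  if r = 0 then κ * p.dFun (p.ξ n - p.η) else κ⁻¹ * p.aXY (p.ξ n)

theorem ketCoeff_ne_zero (hω : 0 < p.ω.im) (hη : p.IsGeneric) (hξ : p.InhomogeneityCondition)
    {κ : ℂ} (hκ : κ ≠ 0) (n : Fin N) (r : Fin 2) : p.ketCoeff κ n r ≠ 0 := by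
  rw [ketCoeff]
  split_ifs
  · exact mul_ne_zero (inv_ne_zero hκ) (aXY_xi_ne_zero hω hη hξ n)
  · exact mul_ne_zero hκ (dFun_xi_sub_ne_zero hω hη hξ n)

theorem braCoeff_ne_zero (hω : 0 < p.ω.im) (hη : p.IsGeneric) (hξ : p.InhomogeneityCondition)
    {κ : ℂ} (hκ : κ ≠ 0) (n : Fin N) (r : Fin 2) : p.braCoeff κ n r ≠ 0 := by
  rw [braCoeff]
  split_ifs
  · exact mul_ne_zero hκ (dFun_xi_sub_ne_zero hω hη hξ n)
  · exact mul_ne_zero (inv_ne_zero hκ) (aXY_xi_ne_zero hω hη hξ n)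

theorem xiShift_zero (n : Fin N) : p.xiShift n 0 = p.ξ n := by simp [xiShift]

theorem xiShift_one (n : Fin N) : p.xiShift n 1 = p.ξ n - p.η := by simp [xiShift]

theorem transfer_sovKet (hω : 0 < p.ω.im) (hη : p.IsGeneric) (hreg : p.IsRegular)
    (hx : p.x ≤ 1) (hy : p.y ≤ 1) (hξ : p.InhomogeneityCondition) {κ : ℂ} (hκ : κ ≠ 0) (nrm : ℂ)
    (h : Spins N) (n : Fin N) : p.transfer κ (p.xiShift n (h n)) (p.sovKet nrm 0 h) =
      p.ketCoeff κ n (h n) • p.sovKet nrm 0 (flip h n) := by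
  obtain hn | hn : h n = 0 ∨ h n = 1 := by lia
  · rw [flip, hn, xiShift_zero, transfer_sovKet_zero hω hη hreg hx hy hξ hκ nrm hn]
    rfl
  · rw [flip, hn, xiShift_one, transfer_sovKet_one hω hη hreg hx hy hξ κ nrm hn]
    rfl

theorem transfer_sovBra (hω : 0 < p.ω.im) (hη : p.IsGeneric) (hreg : p.IsRegular)
    (hx : p.x ≤ 1) (hy : p.y ≤ 1) (hξ : p.InhomogeneityCondition) {κ : ℂ} (hκ : κ ≠ 0) (nrm : ℂ)
    (h : Spins N) (n : Fin N) :
    (p.transfer κ (p.xiShift n (h n))).dualMap (p.sovBra nrm 0 h) =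
      p.braCoeff κ n (h n) • p.sovBra nrm 0 (flip h n) := by
  obtain hn | hn : h n = 0 ∨ h n = 1 := by lia
  · rw [flip, hn, xiShift_zero, transfer_sovBra_zero hω hη hreg hx hy hξ κ nrm hn]
    rfl
  · rw [flip, hn, xiShift_one, transfer_sovBra_one hω hη hreg hx hy hξ hκ nrm hn]
    rfl

theorem sovBra_apply_sovKet_ne_zero (hω : 0 < p.ω.im) (hN : 1 ≤ N) (hη : p.IsGeneric)
    (hreg : p.IsRegular) (hx : p.x ≤ 1) (hy : p.y ≤ 1) (hξ : p.InhomogeneityCondition)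
    {nrm : ℂ} (hnrm : nrm ≠ 0) (h : Spins N) : p.sovBra nrm 0 h (p.sovKet nrm 0 h) ≠ 0 := by
  induction h using Spins.induction_lower with
  | h1 => exact sovBra_one_apply_ne_zero hω hη hreg hξ hnrm
  | hs h n hn ih =>
    have hf : Function.update h n 0 = flip h n := by rw [flip, hn]; rfl
    have hfn : flip h n n = 0 := by rw [flip_apply_self, hn]; rfl
    rw [hf]
    intro h0
    -- compare the two evaluations of `⟨flip h n| T(ξₙ) |h⟩`
    have he := congrArg (p.sovBra nrm 0 (flip h n)) (transfer_expansion hω hN 1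
      (p.xiShift n (flip h n n)) h (sovKet_mem_sector hω hη hreg nrm h))
    have hL : p.sovBra nrm 0 (flip h n) (p.transfer 1 (p.xiShift n (flip h n n))
        (p.sovKet nrm 0 h)) = p.braCoeff 1 n (flip h n n) * p.sovBra nrm 0 h (p.sovKet nrm 0 h) := by
      rw [← LinearMap.dualMap_apply, transfer_sovBra hω hη hreg hx hy hξ one_ne_zero, flip_flip]
      rfl
    rw [map_smul, hL, map_sum] at he
    refine mul_ne_zero (mul_ne_zero (exp_ne_zero _) (det_thetaMatrix_ne_zero hω hN hreg hξ h))
      (mul_ne_zero (braCoeff_ne_zero hω hη hξ one_ne_zero _ _) ih) (he.trans ?_)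
    refine Finset.sum_eq_zero fun m _ => ?_
    rw [transfer_sovKet hω hη hreg hx hy hξ one_ne_zero, map_smul, map_smul]
    by_cases hm : m = n
    · rw [hm, h0, smul_zero, smul_zero]
    · rw [sovBra_apply_eq_zero hω hη hreg nrm, smul_zero, smul_zero]
      intro hc
      have := congrFun hc n
      rw [flip_apply_self, flip_apply_of_ne _ (Ne.symm hm), hn] at this
      exact zero_ne_one this

end Model

theorem diagOp_apply {N : ℕ} (f : Spins N × ℤ → ℂ) (v : Ket N) (s : Spins N × ℤ) :
    diagOp f v s = v s * f s := by
  induction v using Finsupp.induction_linear with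
  | zero => simp
  | add v w hv hw => rw [map_add, Finsupp.add_apply, hv, hw, Finsupp.add_apply, add_mul]
  | single t x =>
    rw [diagOp_single, Finsupp.single_apply, Finsupp.single_apply]
    split_ifs with h
    · rw [h]
    · rw [zero_mul]

namespace Model

variable {N : ℕ} {p : Model N}

/-! ### The space of states -/

theorem sTau_apply (v : Ket N) (s : Spins N × ℤ) : p.sTau v s =
    (p.sTauVal 0 - 2 * p.η * (weight s.1 + s.2 : ℤ)) * v s := by
  have h1 : ∀ n : Fin N, sigmaZ n v s = v s * spinVal (s.1 n) := fun n => diagOp_apply _ _ _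
  have h2 : p.tauOp v s = v s * p.height s.2 := diagOp_apply _ _ _
  simp only [sTau, spinOp, LinearMap.add_apply, LinearMap.smul_apply, LinearMap.sum_apply,
    Finsupp.add_apply, Finsupp.smul_apply, Finsupp.finsetSum_apply, h1, h2, smul_eq_mul]
  rw [← Finset.mul_sum]
  simp only [spinVal, Finset.sum_sub_distrib, ← Finset.mul_sum, sTauVal, height, t0, halfPeriod,
    weight]
  push_cast
  simp
  ring

/-- The span of the basis kets in the space of states of the antiperiodic model. -/
def balancedKets (N : ℕ) : Submodule ℂ (Ket N) :=
  Finsupp.supported ℂ ℂ {s : Spins N × ℤ | s.2 = -weight s.1}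

theorem ketSpace_zero (hη : p.IsGeneric) : p.ketSpace 0 = balancedKets N := by
  have hη0 := hη.eta_ne_zero
  ext v
  rw [ketSpace, Module.End.mem_eigenspace_iff]
  constructor
  · intro h s hs
    have h1 := congrArg (fun w : Ket N => w s) h
    simp only [sTau_apply, Finsupp.smul_apply, smul_eq_mul] at h1
    have h2 : p.η * ((weight s.1 + s.2 : ℤ) : ℂ) * v s = 0 := by linear_combination -(1 / 2) * h1
    have h3 := (mul_eq_zero.1 ((mul_eq_zero.1 h2).resolve_right
      (Finsupp.mem_support_iff.1 hs))).resolve_left hη0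
    have h4 : weight s.1 + s.2 = 0 := by exact_mod_cast h3
    show s.2 = -weight s.1
    lia
  · intro h
    ext s
    rw [sTau_apply, Finsupp.smul_apply, smul_eq_mul]
    by_cases hs : v s = 0
    · rw [hs, mul_zero, mul_zero]
    · have : s.2 = -weight s.1 := h (Finsupp.mem_support_iff.2 hs)
      rw [this]
      simp

theorem sector_le_ketSpace (hη : p.IsGeneric) (m : ℤ) : sector N m (-m) ≤ p.ketSpace 0 := by
  rw [ketSpace_zero hη]
  refine Finsupp.supported_mono fun s hs => ?_
  show s.2 = -weight s.1
  rw [hs.1, hs.2]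

theorem eq_sum_of_mem_balancedKets {v : Ket N} (hv : v ∈ balancedKets N) :
    v = ∑ h : Spins N, v (h, -weight h) • Finsupp.single (h, -weight h) 1 := by
  ext s
  rw [Finsupp.finsetSum_apply]
  simp only [Finsupp.smul_apply, Finsupp.single_apply, smul_eq_mul]
  by_cases hs : s.2 = -weight s.1
  · rw [Finset.sum_eq_single s.1]
    · rw [← hs]; simp
    · intro h _ hh
      rw [if_neg, mul_zero]
      rintro rfl
      exact hh rfl
    · simp
  · rw [Finset.sum_eq_zero]
    · by_contra hne
      exact hs (hv (Finsupp.mem_support_iff.2 hne))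
    · intro h _
      rw [if_neg, mul_zero]
      rintro rfl
      exact hs rfl

theorem apply_eq_zero_of_mem_braSpace (hη : p.IsGeneric) {φ : Bra N} (hφ : φ ∈ p.braSpace 0)
    {s : Spins N × ℤ} (hs : s.2 ≠ -weight s.1) : φ (Finsupp.single s 1) = 0 := by
  have hη0 := hη.eta_ne_zero
  have h1 := Module.End.mem_eigenspace_iff.1 hφ.2
  have h2 := congrArg (fun χ : Bra N => χ (Finsupp.single s 1)) h1
  have h3 : p.sTau (Finsupp.single s 1) =
      (p.sTauVal 0 - 2 * p.η * (weight s.1 + s.2 : ℤ)) • Finsupp.single s 1 := by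
    ext t
    rw [sTau_apply, Finsupp.smul_apply, smul_eq_mul, Finsupp.single_apply]
    split_ifs with h
    · rw [h]
    · simp
  simp only [LinearMap.dualMap_apply, h3, map_smul, LinearMap.smul_apply, smul_eq_mul] at h2
  have h4 : p.η * ((weight s.1 + s.2 : ℤ) : ℂ) * φ (Finsupp.single s 1) = 0 := by
    linear_combination -(1 / 2) * h2
  refine (mul_eq_zero.1 h4).resolve_left (mul_ne_zero hη0 ?_)
  intro h5
  have : weight s.1 + s.2 = 0 := by exact_mod_cast h5
  lia

theorem braSector_le_braSpace (m : ℤ) : braSector N m (-m) ≤ p.braSpace 0 := by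
  intro φ hφ
  constructor
  · have : φ = ∑ h : Spins N, φ (Finsupp.single (h, -m) 1) • basisBra h (-m) := by
      refine bra_ext fun ⟨h, a⟩ => ?_
      rw [LinearMap.sum_apply]
      simp only [LinearMap.smul_apply, basisBra_single, smul_eq_mul]
      by_cases ha : a = -m
      · subst ha
        simp
      · rw [hφ _ (fun hc => ha hc.2), Finset.sum_eq_zero]
        intro h' _
        rw [if_neg, mul_zero]
        intro hc
        exact ha (Prod.ext_iff.1 hc).2
    rw [this]
    exact Submodule.sum_mem _ fun h _ => Submodule.smul_mem _ _
      (Submodule.subset_span ⟨(h, -m), rfl⟩)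
  · rw [SetLike.mem_coe, Module.End.mem_eigenspace_iff]
    refine bra_ext fun s => ?_
    have h3 : p.sTau (Finsupp.single s 1) =
        (p.sTauVal 0 - 2 * p.η * (weight s.1 + s.2 : ℤ)) • Finsupp.single s 1 := by
      ext t
      rw [sTau_apply, Finsupp.smul_apply, smul_eq_mul, Finsupp.single_apply]
      split_ifs with h
      · rw [h]
      · simp
    rw [LinearMap.dualMap_apply, h3, map_smul, LinearMap.smul_apply, smul_eq_mul, smul_eq_mul]
    by_cases hs : weight s.1 = m ∧ s.2 = -m
    · rw [hs.1, hs.2]; simp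
    · rw [hφ s hs, mul_zero, mul_zero]

/-! ### Completeness of the separate bases -/

variable (p) in
/-- The components of the separate bras. -/
def braMatrix (nrm : ℂ) : Matrix (Spins N) (Spins N) ℂ := fun h h' =>
  p.sovBra nrm 0 h (Finsupp.single (h', -weight h') 1)

variable (p) in
/-- The components of the separate kets. -/
def ketMatrix (nrm : ℂ) : Matrix (Spins N) (Spins N) ℂ := fun h' h =>
  p.sovKet nrm 0 h (h', -weight h')

theorem sovKet_eq_sum (hω : 0 < p.ω.im) (hη : p.IsGeneric) (hreg : p.IsRegular) (nrm : ℂ)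
    (h : Spins N) : p.sovKet nrm 0 h =
      ∑ h', p.ketMatrix nrm h' h • Finsupp.single (h', -weight h') 1 := by
  refine eq_sum_of_mem_balancedKets ?_
  rw [← ketSpace_zero hη]
  exact sector_le_ketSpace hη _ (sovKet_mem_sector hω hη hreg nrm h)

theorem det_mul_det_ne_zero (hω : 0 < p.ω.im) (hN : 1 ≤ N) (hη : p.IsGeneric)
    (hreg : p.IsRegular) (hx : p.x ≤ 1) (hy : p.y ≤ 1) (hξ : p.InhomogeneityCondition)
    {nrm : ℂ} (hnrm : nrm ≠ 0) : (p.braMatrix nrm).det * (p.ketMatrix nrm).det ≠ 0 := by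
  have : p.braMatrix nrm * p.ketMatrix nrm =
      Matrix.diagonal fun h => p.sovBra nrm 0 h (p.sovKet nrm 0 h) := by
    ext h h'
    have h1 : (p.braMatrix nrm * p.ketMatrix nrm) h h' =
        p.sovBra nrm 0 h (p.sovKet nrm 0 h') := by
      rw [sovKet_eq_sum hω hη hreg nrm h', map_sum, Matrix.mul_apply]
      refine Finset.sum_congr rfl fun q _ => ?_
      rw [map_smul, smul_eq_mul, mul_comm]
      rfl
    rw [h1]
    by_cases hh : h = h'
    · rw [hh, Matrix.diagonal_apply_eq]
    · rw [Matrix.diagonal_apply_ne _ hh, sovBra_apply_eq_zero hω hη hreg nrm hh]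
  rw [← Matrix.det_mul, this, Matrix.det_diagonal]
  exact Finset.prod_ne_zero_iff.2 fun h _ =>
    sovBra_apply_sovKet_ne_zero hω hN hη hreg hx hy hξ hnrm h

theorem ket_eq_zero (hω : 0 < p.ω.im) (hN : 1 ≤ N) (hη : p.IsGeneric)
    (hreg : p.IsRegular) (hx : p.x ≤ 1) (hy : p.y ≤ 1) (hξ : p.InhomogeneityCondition)
    {nrm : ℂ} (hnrm : nrm ≠ 0) {v : Ket N} (hv : v ∈ p.ketSpace 0)
    (h0 : ∀ h, p.sovBra nrm 0 h v = 0) : v = 0 := by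
  rw [ketSpace_zero hη] at hv
  have hsum := eq_sum_of_mem_balancedKets hv
  have : (fun h => v (h, -weight h)) = 0 := by
    refine Matrix.eq_zero_of_mulVec_eq_zero
      (left_ne_zero_of_mul (det_mul_det_ne_zero hω hN hη hreg hx hy hξ hnrm)) (funext fun h => ?_)
    have := h0 h
    rw [hsum, map_sum] at this
    refine Eq.trans (Finset.sum_congr rfl fun h' _ => ?_) this
    rw [map_smul, smul_eq_mul, mul_comm]
    rfl
  rw [hsum]
  exact Finset.sum_eq_zero fun h _ => by rw [congrFun this h, Pi.zero_apply, zero_smul]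

theorem bra_eq_zero (hω : 0 < p.ω.im) (hN : 1 ≤ N) (hη : p.IsGeneric)
    (hreg : p.IsRegular) (hx : p.x ≤ 1) (hy : p.y ≤ 1) (hξ : p.InhomogeneityCondition)
    {nrm : ℂ} (hnrm : nrm ≠ 0) {φ : Bra N} (hφ : φ ∈ p.braSpace 0)
    (h0 : ∀ h, φ (p.sovKet nrm 0 h) = 0) : φ = 0 := by
  have : (fun h => φ (Finsupp.single (h, -weight h) 1)) = 0 := by
    refine Matrix.eq_zero_of_vecMul_eq_zero
      (right_ne_zero_of_mul (det_mul_det_ne_zero hω hN hη hreg hx hy hξ hnrm)) (funext fun h => ?_)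
    have := h0 h
    rw [sovKet_eq_sum hω hη hreg nrm h, map_sum] at this
    refine Eq.trans (Finset.sum_congr rfl fun h' _ => ?_) this
    rw [map_smul, smul_eq_mul, mul_comm]
  refine bra_ext fun s => ?_
  by_cases hs : s.2 = -weight s.1
  · have := congrFun this s.1
    simp only [← hs] at this
    exact this
  · rw [apply_eq_zero_of_mem_braSpace hη hφ hs]; rfl

/-! ### Separate states as eigenstates -/

section Abstract

variable {V : Type*} [AddCommGroup V] [Module ℂ V]

theorem prod_flip (f : Fin N → Fin 2 → ℂ) (h : Spins N) (n : Fin N) :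
    ∏ a, f a (flip h n a) = f n (1 - h n) * ∏ a ∈ Finset.univ.erase n, f a (h a) := by
  rw [← Finset.mul_prod_erase _ _ (Finset.mem_univ n), flip_apply_self]
  congr 1
  exact Finset.prod_congr rfl fun a ha => by rw [flip_apply_of_ne h (Finset.ne_of_mem_erase ha)]

/-- A state with separate coefficients is an eigenstate once the coefficients satisfy the discrete
Baxter equations. -/
theorem separate_isEigen {T : ℂ → V →ₗ[ℂ] V} {K : Spins N → V} {c : Fin N → Fin 2 → ℂ}
    (hK : ∀ h n, T (p.xiShift n (h n)) (K h) = c n (h n) • K (flip h n))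
    (hT : ∀ u h, (exp (I * p.y * u) * (p.thetaMatrix 0 h).det) • T u (K h) =
      ∑ n, (exp (I * p.y * p.xiShift n (h n)) * p.rowDet h n u) • T (p.xiShift n (h n)) (K h))
    {t : ℂ → ℂ} (ht : ∀ u h, (exp (I * p.y * u) * (p.thetaMatrix 0 h).det) * t u =
      ∑ n, (exp (I * p.y * p.xiShift n (h n)) * p.rowDet h n u) * t (p.xiShift n (h n)))
    {f : Fin N → Fin 2 → ℂ}
    (hf : ∀ n r, f n (1 - r) * c n (1 - r) * exp (I * p.y * p.xiShift n (1 - r)) =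
      f n r * t (p.xiShift n r) * exp (I * p.y * p.xiShift n r)) (u : ℂ) :
    T u (∑ h, ((∏ a, f a (h a)) * (p.thetaMatrix 0 h).det) • K h) =
      t u • ∑ h, ((∏ a, f a (h a)) * (p.thetaMatrix 0 h).det) • K h := by
  refine smul_right_injective V (exp_ne_zero (I * p.y * u)) ?_
  simp only [map_sum, map_smul, Finset.smul_sum]
  have h1 : ∀ h : Spins N, exp (I * p.y * u) • ((∏ a, f a (h a)) * (p.thetaMatrix 0 h).det) •
      T u (K h) = ∑ n, ((∏ a, f a (h a)) * (exp (I * p.y * p.xiShift n (h n)) * p.rowDet h n u *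
        c n (h n))) • K (flip h n) := fun h => by
    rw [smul_smul, show exp (I * p.y * u) * ((∏ a, f a (h a)) * (p.thetaMatrix 0 h).det) =
      (∏ a, f a (h a)) * (exp (I * p.y * u) * (p.thetaMatrix 0 h).det) by ring, mul_smul, hT,
      Finset.smul_sum]
    refine Finset.sum_congr rfl fun n _ => ?_
    rw [hK, smul_smul, smul_smul]
    congr 1
    ring
  have h2 : ∀ h : Spins N, exp (I * p.y * u) • t u •
      ((∏ a, f a (h a)) * (p.thetaMatrix 0 h).det) • K h =
      ∑ n, ((∏ a, f a (h a)) * (exp (I * p.y * p.xiShift n (h n)) * p.rowDet h n u *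
        t (p.xiShift n (h n)))) • K h := fun h => by
    rw [← Finset.sum_smul, ← Finset.mul_sum, ← ht, smul_smul, smul_smul]
    congr 1
    ring
  simp only [h1, h2]
  rw [Finset.sum_comm, Finset.sum_comm (s := Finset.univ) (t := Finset.univ)
    (f := fun h n => ((∏ a, f a (h a)) * (exp (I * p.y * p.xiShift n (h n)) * p.rowDet h n u *
        t (p.xiShift n (h n)))) • K h)]
  refine Finset.sum_congr rfl fun n _ => ?_
  refine Finset.sum_nbij' (fun h => flip h n) (fun h => flip h n) (by simp) (by simp)
    (fun h _ => flip_flip h n) (fun h _ => flip_flip h n) fun h _ => ?_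
  congr 1
  have hr : p.rowDet (flip h n) n u = p.rowDet h n u := by
    rw [rowDet, updateRow_thetaMatrix_flip]; rfl
  have h11 : (1 : Fin 2) - (1 - h n) = h n := by lia
  have := hf n (1 - h n)
  rw [h11] at this
  rw [hr, prod_flip, flip_apply_self, ← Finset.mul_prod_erase _ _ (Finset.mem_univ n)]
  linear_combination (∏ a ∈ Finset.univ.erase n, f a (h a)) * p.rowDet h n u * this

/-- Simplicity of the spectrum. -/
theorem exists_eq_smul_of_isEigen {T : ℂ → V →ₗ[ℂ] V} {Φ : Spins N → V →ₗ[ℂ] ℂ}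
    {c : Fin N → Fin 2 → ℂ} (hc : ∀ n r, c n r ≠ 0)
    (hΦ : ∀ h n v, Φ h (T (p.xiShift n (h n)) v) = c n (h n) * Φ (flip h n) v)
    {W : Submodule ℂ V} (hW : ∀ v ∈ W, (∀ h, Φ h v = 0) → v = 0) {t : ℂ → ℂ} {v w : V}
    (hv : v ∈ W) (hw : w ∈ W) (hw0 : w ≠ 0) (hTv : ∀ u, T u v = t u • v)
    (hTw : ∀ u, T u w = t u • w) : ∃ k : ℂ, v = k • w := by
  have key : ∀ z ∈ W, (∀ u, T u z = t u • z) → Φ (fun _ => 0) z = 0 → z = 0 := by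
    intro z hz hTz h0
    refine hW z hz fun h => ?_
    induction h using Spins.induction_raise with
    | h0 => exact h0
    | hs h n hn ih =>
      have := hΦ h n z
      rw [hTz, map_smul, ih, smul_zero] at this
      have hf : Function.update h n 1 = flip h n := by rw [flip, hn]; rfl
      rw [hf]
      exact (mul_eq_zero.1 this.symm).resolve_left (hc _ _)
  have hw1 : Φ (fun _ => 0) w ≠ 0 := fun h => hw0 (key w hw hTw h)
  refine ⟨Φ (fun _ => 0) v / Φ (fun _ => 0) w, sub_eq_zero.1 (key _ (W.sub_mem hv (W.smul_mem _ hw))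
    (fun u => ?_) ?_)⟩
  · rw [map_sub, map_smul, hTv, hTw, smul_sub, smul_comm]
  · rw [map_sub, map_smul, smul_eq_mul, div_mul_cancel₀ _ hw1, sub_self]

end Abstract

/-! ### Eigenstates from solutions of the Baxter equation -/

theorem IsQuasiPeriodic.isThetaOrder {t : ℂ → ℂ} (ht : Differentiable ℂ t)
    (hper : p.IsQuasiPeriodic t) :
    IsThetaOrder p.ω N p.thetaNorm fun u => exp (I * p.y * u) * t u where
  differentiable := Differentiable.mul (by fun_prop) ht
  add_pi u := by
    have e2 : ((-1 : ℂ) ^ p.y) * (-1) ^ p.y = 1 := by rw [← mul_pow]; simp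
    rw [hper.1, mul_add, exp_add, show I * p.y * Real.pi = (p.y : ℕ) * (Real.pi * I) by ring,
      exp_nat_mul, exp_pi_mul_I, pow_add]
    linear_combination exp (I * p.y * u) * (-1) ^ N * t u * e2
  add_pi_mul u := by
    have : exp (2 * I * p.thetaNorm) = exp (I * p.y * (Real.pi * p.ω)) *
        exp (2 * I * (∑ k, p.ξ k - (N : ℂ) / 2 * p.η + p.x * ((Real.pi : ℂ) / 2))) := by
      rw [← exp_add]
      congr 1
      simp only [thetaNorm, tVal, spinVal_zero, halfPeriod]
      simp
      ring
    rw [hper.2, this, mul_add, exp_add]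
    ring

theorem mul_det_thetaMatrix_of_isQuasiPeriodic (hω : 0 < p.ω.im) (hN : 1 ≤ N) {t : ℂ → ℂ}
    (ht : Differentiable ℂ t) (hper : p.IsQuasiPeriodic t) (u : ℂ) (h : Spins N) :
    (exp (I * p.y * u) * (p.thetaMatrix 0 h).det) * t u =
      ∑ n, (exp (I * p.y * p.xiShift n (h n)) * p.rowDet h n u) * t (p.xiShift n (h n)) := by
  have := (hper.isThetaOrder ht).mul_det_thetaMatrix hω hN h u
  refine Eq.trans ?_ (this.trans (Finset.sum_congr rfl fun n _ => ?_))
  · ring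
  · rw [rowDet]; ring

theorem IsTQ.apply_xi {t Q : ℂ → ℂ} (h : p.IsTQ t Q) (n : Fin N) :
    t (p.ξ n) * Q (p.ξ n) = p.aXY (p.ξ n) * Q (p.ξ n - p.η) := by
  rw [h, dFun_xi, zero_mul, add_zero]

theorem IsTQ.apply_xi_sub {t Q : ℂ → ℂ} (h : p.IsTQ t Q) (n : Fin N) :
    t (p.ξ n - p.η) * Q (p.ξ n - p.η) = p.dFun (p.ξ n - p.η) * Q (p.ξ n) := by
  rw [h, aXY, aFun_xi_sub, mul_zero, zero_mul, zero_add, sub_add_cancel]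

theorem exp_xi (n : Fin N) : exp (I * p.y * p.ξ n) =
    exp (I * p.y * p.η) * exp (I * p.y * (p.ξ n - p.η)) := by
  rw [← exp_add]; congr 1; ring

theorem separateKet_isEigenKet (hω : 0 < p.ω.im) (hN : 1 ≤ N) (hη : p.IsGeneric)
    (hreg : p.IsRegular) (hx : p.x ≤ 1) (hy : p.y ≤ 1) (hξ : p.InhomogeneityCondition)
    {κ : ℂ} (hκ : κ ≠ 0) {nrm : ℂ} (hnrm : nrm ≠ 0) {t Q : ℂ → ℂ} (ht : Differentiable ℂ t)
    (htQ : p.IsTQ t Q) (hQ : ∀ n, (Q (p.ξ n), Q (p.ξ n - p.η)) ≠ (0, 0))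
    (hper : p.IsQuasiPeriodic t) :
    p.IsEigenKet κ t (p.separateKet nrm κ fun a h => Q (p.xiShift a h)) := by
  refine ⟨Submodule.sum_mem _ fun h _ => Submodule.smul_mem _ _ (sector_le_ketSpace hη _
    (sovKet_mem_sector hω hη hreg nrm h)), fun h0 => ?_, ?_⟩
  · have : ∀ n, ∃ r : Fin 2, Q (p.xiShift n r) ≠ 0 := fun n => by
      by_contra! hc
      refine hQ n (Prod.ext ?_ ?_)
      · rw [← xiShift_zero]; exact hc 0
      · rw [← xiShift_one]; exact hc 1
    choose h hh using this
    have h1 := congrArg (p.sovBra nrm 0 h) h0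
    rw [separateKet, map_sum, map_zero, Finset.sum_eq_single h (fun h' _ hne => by
      rw [map_smul, sovBra_apply_eq_zero hω hη hreg nrm (Ne.symm hne), smul_zero]) (by simp),
      map_smul, smul_eq_mul] at h1
    refine mul_ne_zero (mul_ne_zero (Finset.prod_ne_zero_iff.2 fun a _ => mul_ne_zero
      (pow_ne_zero _ ?_) (hh a)) (det_thetaMatrix_ne_zero hω hN hreg hξ h))
      (sovBra_apply_sovKet_ne_zero hω hN hη hreg hx hy hξ hnrm h) h1
    exact mul_ne_zero (mul_ne_zero (inv_ne_zero hκ) (exp_ne_zero _))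
      (div_ne_zero (aXY_xi_ne_zero hω hη hξ a) (dFun_xi_sub_ne_zero hω hη hξ a))
  · refine separate_isEigen (p := p) (T := fun u => p.transfer κ u) (K := fun h => p.sovKet nrm 0 h)
      (transfer_sovKet hω hη hreg hx hy hξ hκ nrm)
      (fun u h => transfer_expansion hω hN κ u h (sovKet_mem_sector hω hη hreg nrm h))
      (mul_det_thetaMatrix_of_isQuasiPeriodic hω hN ht hper)
      (f := fun a r => (κ⁻¹ * Complex.exp (Complex.I * p.y * p.η) *
        (p.aXY (p.ξ a) / p.dFun (p.ξ a - p.η))) ^ (r : ℕ) * Q (p.xiShift a r)) fun n r => ?_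
    have hd := dFun_xi_sub_ne_zero hω hη hξ n
    obtain rfl | rfl : r = 0 ∨ r = 1 := by lia
    · have := htQ.apply_xi n
      simp only [sub_zero, xiShift_one, xiShift_zero, ketCoeff, one_ne_zero, if_false, exp_xi n]
      simp
      field_simp
      linear_combination -this
    · have := htQ.apply_xi_sub n
      simp only [sub_self, xiShift_one, xiShift_zero, ketCoeff, if_true, exp_xi n]
      simp
      field_simp
      linear_combination -p.aXY (p.ξ n) * this

theorem separateBra_isEigenBra (hω : 0 < p.ω.im) (hN : 1 ≤ N) (hη : p.IsGeneric)
    (hreg : p.IsRegular) (hx : p.x ≤ 1) (hy : p.y ≤ 1) (hξ : p.InhomogeneityCondition)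
    {κ : ℂ} (hκ : κ ≠ 0) {nrm : ℂ} (hnrm : nrm ≠ 0) {t Q : ℂ → ℂ} (ht : Differentiable ℂ t)
    (htQ : p.IsTQ t Q) (hQ : ∀ n, (Q (p.ξ n), Q (p.ξ n - p.η)) ≠ (0, 0))
    (hper : p.IsQuasiPeriodic t) :
    p.IsEigenBra κ t (p.separateBra nrm κ fun a h => Q (p.xiShift a h)) := by
  refine ⟨Submodule.sum_mem _ fun h _ => Submodule.smul_mem _ _ (braSector_le_braSpace _
    (sovBra_mem_braSector hω hη hreg nrm h)), fun h0 => ?_, ?_⟩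
  · have : ∀ n, ∃ r : Fin 2, Q (p.xiShift n r) ≠ 0 := fun n => by
      by_contra! hc
      refine hQ n (Prod.ext ?_ ?_)
      · rw [← xiShift_zero]; exact hc 0
      · rw [← xiShift_one]; exact hc 1
    choose h hh using this
    have h1 := congrArg (fun φ : Bra N => φ (p.sovKet nrm 0 h)) h0
    simp only [separateBra, LinearMap.sum_apply, LinearMap.smul_apply, LinearMap.zero_apply] at h1
    rw [Finset.sum_eq_single h (fun h' _ hne => by
      rw [sovBra_apply_eq_zero hω hη hreg nrm hne, smul_zero]) (by simp), smul_eq_mul] at h1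
    exact mul_ne_zero (mul_ne_zero (Finset.prod_ne_zero_iff.2 fun a _ => mul_ne_zero
      (pow_ne_zero _ (mul_ne_zero hκ (exp_ne_zero _))) (hh a))
      (det_thetaMatrix_ne_zero hω hN hreg hξ h))
      (sovBra_apply_sovKet_ne_zero hω hN hη hreg hx hy hξ hnrm h) h1
  · refine separate_isEigen (p := p) (T := fun u => (p.transfer κ u).dualMap)
      (K := fun h => p.sovBra nrm 0 h)
      (transfer_sovBra hω hη hreg hx hy hξ hκ nrm)
      (fun u h => transfer_dual_expansion hω hN κ u h (sovBra_mem_braSector hω hη hreg nrm h))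
      (mul_det_thetaMatrix_of_isQuasiPeriodic hω hN ht hper)
      (f := fun a r => (κ * Complex.exp (Complex.I * p.y * p.η)) ^ (r : ℕ) * Q (p.xiShift a r))
      fun n r => ?_
    obtain rfl | rfl : r = 0 ∨ r = 1 := by lia
    · have := htQ.apply_xi n
      simp only [sub_zero, xiShift_one, xiShift_zero, braCoeff, one_ne_zero, if_false, exp_xi n]
      simp
      field_simp
      linear_combination -this
    · have := htQ.apply_xi_sub n
      simp only [sub_self, xiShift_one, xiShift_zero, braCoeff, if_true, exp_xi n]
      simp
      field_simp
      linear_combination -this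

end Model

end DynSixVertex

end

theorem mainTheorem11 {N : ℕ} (hN : 1 ≤ N) (p : DynSixVertex.Model N)
    (hω : 0 < p.ω.im) (hη : p.IsGeneric) (hx : p.x ≤ 1) (hy : p.y ≤ 1)
    (hxy : Even N → ¬ (p.x = 0 ∧ p.y = 0)) (hξ : p.InhomogeneityCondition)
    (κ : ℂ) (hκ : κ ≠ 0) (nrm : ℂ) (hnrm : nrm ≠ 0)
    (t Q : ℂ → ℂ) (ht : Differentiable ℂ t) (htQ : p.IsTQ t Q)
    (hQ : ∀ n, (Q (p.ξ n), Q (p.ξ n - p.η)) ≠ (0, 0)) (hper : p.IsQuasiPeriodic t) :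
    t ∈ p.transferSpectrum κ ∧
    p.IsEigenKet κ t (p.separateKet nrm κ fun a h => Q (p.xiShift a h)) ∧
    (∀ v, p.IsEigenKet κ t v →
      ∃ c : ℂ, v = c • p.separateKet nrm κ fun a h => Q (p.xiShift a h)) ∧
    p.IsEigenBra κ t (p.separateBra nrm κ fun a h => Q (p.xiShift a h)) ∧
    (∀ φ, p.IsEigenBra κ t φ →
      ∃ c : ℂ, φ = c • p.separateBra nrm κ fun a h => Q (p.xiShift a h)) := by
  have hreg := p.isRegular hω hη hx hy hxy
  have hK := DynSixVertex.Model.separateKet_isEigenKet hω hN hη hreg hx hy hξ hκ hnrm ht htQ hQ hper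
  have hL := DynSixVertex.Model.separateBra_isEigenBra hω hN hη hreg hx hy hξ hκ hnrm ht htQ hQ hper
  refine ⟨⟨_, hK⟩, hK, fun v hv => ?_, hL, fun φ hφ => ?_⟩
  · refine DynSixVertex.Model.exists_eq_smul_of_isEigen (p := p) (T := fun u => p.transfer κ u)
      (Φ := fun h => p.sovBra nrm 0 h) (c := p.braCoeff κ)
      (DynSixVertex.Model.braCoeff_ne_zero hω hη hξ hκ) (fun h n v => ?_)
      (fun v hv h0 => DynSixVertex.Model.ket_eq_zero hω hN hη hreg hx hy hξ hnrm hv h0)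
      hv.1 hK.1 hK.2.1 hv.2.2 hK.2.2
    rw [← LinearMap.dualMap_apply, DynSixVertex.Model.transfer_sovBra hω hη hreg hx hy hξ hκ]
    rfl
  · refine DynSixVertex.Model.exists_eq_smul_of_isEigen (p := p)
      (T := fun u => (p.transfer κ u).dualMap)
      (Φ := fun h => LinearMap.applyₗ (p.sovKet nrm 0 h)) (c := p.ketCoeff κ)
      (DynSixVertex.Model.ketCoeff_ne_zero hω hη hξ hκ) (fun h n φ => ?_)
      (fun φ hφ h0 => DynSixVertex.Model.bra_eq_zero hω hN hη hreg hx hy hξ hnrm hφ h0)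
      hφ.1 hL.1 hL.2.1 hφ.2.2 hL.2.2
    simp only [LinearMap.applyₗ_apply_apply, LinearMap.dualMap_apply]
    rw [DynSixVertex.Model.transfer_sovKet hω hη hreg hx hy hξ hκ, map_smul]
    rfl
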